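/- Let $d,k\ge 1$ and let $\lambda_1,\dots,\lambda_d\in\mathbb C$ have modulus $1$ and be one-resonant of index $(1,\dots,1)$: for $1\le j\le d$ and $m\in\mathbb N^d$, $\lambda_1^{m_1}\cdots\lambda_d^{m_d}=\lambda_j$ if and only if $m=(q,\dots,q)+e_j$ for some $q\in\mathbb N$. Put $\Lambda=\operatorname{diag}(\lambda_1,\dots,\lambda_d)$, $\Lambda'=\operatorname{diag}(\lambda_2,\dots,\lambda_d)$ and $F_{\mathrm N}(z)=\Lambda z\,\bigl(1-\tfrac{(z^1\cdots z^d)^k}{kd}\bigr)$. For $0\le h<k$ and $R,\theta,\beta>0$ let $B_h(R,\theta,\beta)$ be the set of $z\in\mathbb C^d$ such that, with $u=z^1\cdots z^d$, $|z^j|<|u|^\beta$ for all $j$, $|u^k-\tfrac1{2R}|<\tfrac1{2R}$ and $|\arg u-\tfrac{2\pi h}k|<\theta$ (angles modulo $2\pi$). Roots and logarithms below are principal. There is a constant $c\in\mathbb C$, depending only on $F_{\mathrm N}$, such that the following holds. Let $l\in\mathbb N$, $l>2kd+1$, and let $F$ be a holomorphic automorphism of $\mathbb C^d$ with $F(z)=F_{\mathrm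 N}(z)+O(\|z\|^l)$ as $z\to0$. Let $0\le h<k$, $\theta_0\in(0,\tfrac{\pi}{2k})$, and $\beta_0\in(0,\tfrac1d)$ with $\beta_0(l+d-1)>2k+1$. With $z_n=F^n(z)$ and $U_n=(z_n^1\cdots z_n^d)^{-k}$, put, for $2\le j\le d$, $$\psi(z)=\lim_{n\to\infty}\bigl(U_n-n+c\log U_n\bigr),\qquad \sigma_j(z)=\lim_{n\to\infty}\lambda_j^{-n}z_n^j\sqrt[kd]{\frac{\psi(z)+n}{\psi(z)}},\qquad \tau_j=\sqrt[kd]{\psi}\,\sigma_j .$$ 1. For all sufficiently large $R_0$, the set $B_h=B_h(R_0,\theta_0,\beta_0)$ is a uniform local basin of attraction for $F$, that is, $F(B_h)\subseteq B_h$ and $F^n\to0$ uniformly on $B_h$; moreover $\operatorname{Re}\psi>0$ on $B_h$. 2. Let $R_0>0$ be such that $B_h=B_h(R_0,\theta_0,\beta_0)$ is a uniform local basin of attraction for $F$, and let $\Omega_h=\bigcup_{n\in\mathbb N}F^{-n}(B_h)$. Then $F(\Omega_h)=\Omega_h$. If $\operatorname{Re}\psi>0$ on $B_h$, then on $B_h$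 the limit defining $\psi$ is uniform and those defining $\sigma_2,\dots,\sigma_d$ are locally uniform, $\psi,\sigma_j,\tau_j$ are holomorphic, $\sigma_j$ and $\tau_j$ have no zeros, and $$\psi\circ F=\psi+1,\qquad \sigma_j\circ F=\lambda_j\sigma_j\sqrt[kd]{\frac{\psi}{\psi+1}},\qquad \tau_j\circ F=\lambda_j\tau_j .$$ The formulas $\hat\psi(z)=\psi(F^n(z))-n$ and $\hat\tau_j(z)=\lambda_j^{-n}\tau_j(F^n(z))$, for any $n$ with $F^n(z)\in B_h$, give a well-defined biholomorphism $\hat\phi=(\hat\psi,\hat\tau_2,\dots,\hat\tau_d)$ from $\Omega_h$ onto $\mathbb C\times(\mathbb C^*)^{d-1}$, which conjugates $F$ to $(\zeta,\xi)\mapsto(\zeta+1,\Lambda'\xi)$. There is a biholomorphic self-map $\eta$ of $\mathbb C\times(\mathbb C^*)^{d-1}$ such that $\eta\circ\hat\phi$ conjugates $F$ to $(\zeta,\xi)\mapsto(\zeta+1,\xi)$. 3. For every $R_0>0$ such that $B_h(R_0,\theta_0,\beta_0)$ is a uniform local basin of attraction for $F$, with $\Omega_h$ as in 2, there is a biholomorphic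 map $\Omega_h\to\mathbb C\times(\mathbb C^*)^{d-1}$ conjugating $F$ to $(\zeta,\xi)\mapsto(\zeta+1,\xi)$. -/

import Mathlib

open Filter Topology Asymptotics

noncomputable section

/-- `F` is a holomorphic automorphism of `ℂ^d`: it is holomorphic and has a holomorphic inverse. -/
def IsHolAut {d : ℕ} (F : (Fin d → ℂ) → (Fin d → ℂ)) : Prop :=
  Differentiable ℂ F ∧ ∃ G : (Fin d → ℂ) → (Fin d → ℂ),
    Differentiable ℂ G ∧ Function.LeftInverse G F ∧ Function.RightInverse G F

/-- `f` restricts to a biholomorphic map from the open set `U` onto the open set `V`. -/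
def IsBiholOn {d : ℕ} (f : (Fin d → ℂ) → (Fin d → ℂ)) (U V : Set (Fin d → ℂ)) : Prop :=
  IsOpen U ∧ IsOpen V ∧ DifferentiableOn ℂ f U ∧ Set.BijOn f U V ∧
    ∃ g : (Fin d → ℂ) → (Fin d → ℂ), DifferentiableOn ℂ g V ∧ Set.InvOn g f U V

/-- The multipliers `lam` are one-resonant of index `α`: a relation
`lam j = ∏ i, lam i ^ m i` holds exactly when `m = q α + e_j` for some `q ∈ ℕ`. -/
def IsOneResonant {d : ℕ} (lam : Fin d → ℂ) (α : Fin d → ℕ) : Prop :=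
  ∀ (j : Fin d) (m : Fin d → ℕ),
    lam j = ∏ i, lam i ^ m i ↔ ∃ q : ℕ, m = q • α + Pi.single j 1

/-- The normal form `F_N(z) = Λ z (1 - (z¹⋯z^d)^k / (k d))`. -/
def normalForm {d : ℕ} (k : ℕ) (lam : Fin d → ℂ) (z : Fin d → ℂ) : Fin d → ℂ :=
  fun j => lam j * z j * (1 - (∏ i, z i) ^ k / ((k : ℂ) * (d : ℂ)))

/-- The sector `S_h(R,θ)`; the condition on the argument (which is an angle modulo `2π`)
says that the angle between `u` and the ray of argument `2πh/k` is less than `θ`. -/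
def sector (k h : ℕ) (R θ : ℝ) : Set ℂ :=
  {u | ‖u ^ k - ((1 / (2 * R) : ℝ) : ℂ)‖ < 1 / (2 * R) ∧
    |(u * Complex.exp (-(2 * (Real.pi : ℂ) * Complex.I * (h : ℂ) / (k : ℂ)))).arg| < θ}

/-- The local basin `B_h(R,θ,β)`. -/
def localBasin (d k h : ℕ) (R θ β : ℝ) : Set (Fin d → ℂ) :=
  {z | (∀ j, ‖z j‖ < ‖∏ i, z i‖ ^ β) ∧ ∏ i, z i ∈ sector k h R θ}

/-- `B` is a uniform local basin of attraction to the origin for `F`. -/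
def IsUniformLocalBasin {d : ℕ} (F : (Fin d → ℂ) → (Fin d → ℂ)) (B : Set (Fin d → ℂ)) : Prop :=
  Set.MapsTo F B B ∧ TendstoUniformlyOn (fun n => F^[n]) (fun _ => 0) atTop B

/-- The global basin `⋃ₙ F⁻ⁿ(B)`. -/
def globalBasin {d : ℕ} (F : (Fin d → ℂ) → (Fin d → ℂ)) (B : Set (Fin d → ℂ)) :
    Set (Fin d → ℂ) :=
  ⋃ n : ℕ, F^[n] ⁻¹' B

/-- The variable `U = (z¹⋯z^d)^{-k}`. -/
def bigU {d : ℕ} (k : ℕ) (z : Fin d → ℂ) : ℂ := ((∏ i, z i) ^ k)⁻¹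

/-- `ψₙ(z) = Uₙ - n + c log Uₙ`, where `Uₙ = U(Fⁿ(z))`. -/
def psiSeq {d : ℕ} (k : ℕ) (c : ℂ) (F : (Fin d → ℂ) → (Fin d → ℂ)) (n : ℕ) (z : Fin d → ℂ) : ℂ :=
  bigU k (F^[n] z) - n + c * Complex.log (bigU k (F^[n] z))

/-- The Fatou coordinate `ψ = lim ψₙ`. -/
def psi {d : ℕ} (k : ℕ) (c : ℂ) (F : (Fin d → ℂ) → (Fin d → ℂ)) (z : Fin d → ℂ) : ℂ :=
  limUnder atTop (fun n => psiSeq k c F n z)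

/-- The principal branch of the `N`-th root. -/
def root (N : ℕ) (x : ℂ) : ℂ := x ^ (1 / (N : ℂ))

/-- `σ_{j,n}(z) = λ_j^{-n} z_n^j ((ψ(z)+n)/ψ(z))^{1/(kd)}`, where `z_n = Fⁿ(z)`. -/
def sigmaSeq {d : ℕ} (k : ℕ) (c : ℂ) (lam : Fin d → ℂ) (F : (Fin d → ℂ) → (Fin d → ℂ))
    (j : Fin d) (n : ℕ) (z : Fin d → ℂ) : ℂ :=
  (lam j ^ n)⁻¹ * F^[n] z j * root (k * d) ((psi k c F z + n) / psi k c F z)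

/-- `σ_j = lim σ_{j,n}`. -/
def sigma {d : ℕ} (k : ℕ) (c : ℂ) (lam : Fin d → ℂ) (F : (Fin d → ℂ) → (Fin d → ℂ))
    (j : Fin d) (z : Fin d → ℂ) : ℂ :=
  limUnder atTop (fun n => sigmaSeq k c lam F j n z)

/-- `τ_j = ψ^{1/(kd)} σ_j`. -/
def tau {d : ℕ} (k : ℕ) (c : ℂ) (lam : Fin d → ℂ) (F : (Fin d → ℂ) → (Fin d → ℂ))
    (j : Fin d) (z : Fin d → ℂ) : ℂ :=
  root (k * d) (psi k c F z) * sigma k c lam F j z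

/-- `ℂ × (ℂ*)^{d-1}`, as an open subset of `ℂ^d`; the first coordinate has index `0`. -/
def cylinder (d : ℕ) [NeZero d] : Set (Fin d → ℂ) := {w | ∀ j, j ≠ 0 → w j ≠ 0}

/-- The map `(ζ,ξ) ↦ (ζ+1,ξ)`. -/
def shift {d : ℕ} [NeZero d] (w : Fin d → ℂ) : Fin d → ℂ :=
  fun j => if j = 0 then w 0 + 1 else w j

/-- The map `(ζ,ξ) ↦ (ζ+1,Λ'ξ)` with `Λ' = diag(λ₂,…,λ_d)`. -/
def shiftRot {d : ℕ} [NeZero d] (lam : Fin d → ℂ) (w : Fin d → ℂ) : Fin d → ℂ :=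
  fun j => if j = 0 then w 0 + 1 else lam j * w j

end

/-!
Put `u = z_1 ⋯ z_d` and `U = u^{-k}`. The multipliers enter only through `|λ_j| = 1` and
`∏ λ_j = 1`. In the coordinates `U` and `t_j = U^{1/(kd)} z_j` (all `d` of them) the local basin is
`Re U > R`, `|Im U| < κ Re U`, `∏ t_j = ω`, `|t_j| < |U|^δ` (`localBasin_eq_chartDomain`), and `F`
becomes `U ↦ U + 1 - c / U + O(|U|^{-p})`, `t_j ↦ λ_j t_j exp (s_j)` with `s_j = O(|U|^{-p})` and
`p > 1`, where `c = -(1 + 1/(kd)) / 2` (`IsTangentToNormalForm.exists_step_asymptotics`). The point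
is that `|z_j|` is bounded from below by `|u|^{1 - (d-1)β}`, so that the error `O(‖z‖^l)` is small
relative to each `z_j`. The step of `U` keeps `U` in its cone, and the growth of `|U|^δ` absorbs the
errors `s_j`; this makes the basin invariant for large `R`.

Since `p > 1`, the sums of the errors converge, so that `U_n - n + c log U_n` and `λ_j^{-n} t_{j,n}`
converge, uniformly in the appropriate sense, with limits `ψ = U + c log U + o(1)` and
`τ_j = t_j (1 + o(1))` as `|U| → ∞` (`IsTangentToNormalForm.exists_isFatouDomain`). The latter limit
is nowhere zero, being `t_j` times an exponential, and it is the `τ_j` of the statement because the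
roots of numbers in the right half plane multiply as expected
(`IsFatouDomain.tendstoLocallyUniformlyOn_sigmaSeq`). Both limits exist on the whole global basin `Ω`
and give the extended Fatou map `Φ` there.

For bijectivity, consider the affine maps `T_n (ζ, ξ) = (ζ + n - c log n, Λ'^n ξ)`. Under `T_n`
every compact part of `ℂ × (ℂ*)^{d-1}` moves into the domain of the chart with `|U| → ∞`, so that
`G_n = F^{-n} ∘ chart⁻¹ ∘ T_n` is defined there for large `n`, and the expansions of `ψ` and `τ_j` show
that `Φ ∘ G_n → id` locally uniformly. By the Cauchy estimates `Φ ∘ G_n` is then a perturbation of the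
identity with small Lipschitz constant, so it is injective with holomorphic inverse on a ball of fixed
radius. Since also `G_n⁻¹ → Φ` pointwise on `Ω`, it follows that `Φ` is biholomorphic from `Ω` onto
`ℂ × (ℂ*)^{d-1}` (`bijOn_and_differentiableOn_inverse_of_approx`, `IsFatouDomain.isBiholOn_fatouMap`).

A uniform local basin of arbitrary radius enters the basins of large radius after a bounded time
(`exists_mapsTo_iterate_chartDomain`), so it has the same global basin and inherits the limits.
Finally `(ζ, ξ) ↦ (ζ, ξ_j λ_j^{-ζ})` removes the rotation `Λ'`.
-/

/-! ### Holomorphic maps between complex normed spaces -/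

section NormedSpaces

variable {E G : Type*} [NormedAddCommGroup E] [NormedSpace ℂ E]
  [NormedAddCommGroup G] [NormedSpace ℂ G]

theorem norm_fderiv_le_of_norm_le_ball {f : E → G} {x : E} {r ε : ℝ} (hr : 0 < r)
    (hf : DifferentiableOn ℂ f (Metric.ball x r)) (hb : ∀ y ∈ Metric.ball x r, ‖f y‖ ≤ ε) :
    ‖fderiv ℂ f x‖ ≤ 2 * ε / r := by
  refine Complex.norm_fderiv_le_div_of_mapsTo_ball hf (fun y hy => ?_) hr
  rw [Metric.mem_closedBall, dist_eq_norm]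
  have h1 := hb y hy
  have h2 := hb x (Metric.mem_ball_self hr)
  calc ‖f y - f x‖ ≤ ‖f y‖ + ‖f x‖ := norm_sub_le _ _
    _ ≤ 2 * ε := by linarith

/-- Weierstrass' theorem for maps of several variables: by the Cauchy estimates the derivatives
converge locally uniformly as well. -/
theorem differentiableOn_of_tendstoLocallyUniformlyOn [ProperSpace E] [CompleteSpace G]
    {f : ℕ → E → G} {g : E → G} {U : Set E} (hU : IsOpen U)
    (hlim : TendstoLocallyUniformlyOn f g atTop U) (hf : ∀ n, DifferentiableOn ℂ (f n) U) :
    DifferentiableOn ℂ g U := by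
  intro x hx
  obtain ⟨r, hr, hrU⟩ : ∃ r > 0, Metric.closedBall x (2 * r) ⊆ U := by
    obtain ⟨s, hs, hsU⟩ := Metric.nhds_basis_closedBall.mem_iff.mp (hU.mem_nhds hx)
    exact ⟨s / 2, by positivity, by convert hsU using 2; ring⟩
  have hunif : TendstoUniformlyOn f g atTop (Metric.closedBall x (2 * r)) :=
    (tendstoLocallyUniformlyOn_iff_forall_isCompact hU).mp hlim _ hrU (isCompact_closedBall _ _)
  have hsub : ∀ y ∈ Metric.ball x r, Metric.ball y r ⊆ Metric.closedBall x (2 * r) := by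
    intro y hy z hz
    rw [Metric.mem_ball] at hy hz
    rw [Metric.mem_closedBall]
    linarith [dist_triangle z y x]
  have hdiff : ∀ n, ∀ y ∈ Metric.ball x r, DifferentiableAt ℂ (f n) y := fun n y hy =>
    ((hf n).mono (hsub y hy |>.trans hrU)).differentiableAt (Metric.ball_mem_nhds y hr)
  have hcauchy : UniformCauchySeqOn (fun n => fderiv ℂ (f n)) atTop (Metric.ball x r) := by
    rw [Metric.uniformCauchySeqOn_iff]
    intro ε hε
    obtain ⟨N, hN⟩ := Metric.uniformCauchySeqOn_iff.mp hunif.uniformCauchySeqOn (ε * r / 4)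
      (by positivity)
    refine ⟨N, fun m hm n hn y hy => ?_⟩
    rw [dist_eq_norm, ← fderiv_fun_sub (hdiff m y hy) (hdiff n y hy)]
    have := norm_fderiv_le_of_norm_le_ball (f := fun z => f m z - f n z) (x := y) (ε := ε * r / 4) hr
      (((hf m).mono (hsub y hy |>.trans hrU)).sub ((hf n).mono (hsub y hy |>.trans hrU)))
      (fun z hz => by
        rw [← dist_eq_norm]; exact (hN m hm n hn z (hsub y hy hz)).le)
    refine this.trans_lt ?_
    rw [div_lt_iff₀ hr]
    nlinarith
  have hptlim : ∀ y ∈ Metric.ball x r, ∃ L, Tendsto (fun n => fderiv ℂ (f n) y) atTop (𝓝 L) :=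
    fun y hy => cauchySeq_tendsto_of_complete (hcauchy.cauchySeq hy)
  choose! g' hg' using hptlim
  exact (hasFDerivAt_of_tendstoUniformlyOn Metric.isOpen_ball
    (hcauchy.tendstoUniformlyOn_of_tendsto hg') (fun n y hy => (hdiff n y hy).hasFDerivAt)
    (fun y hy => hunif.tendsto_at (hsub y hy (Metric.mem_ball_self hr)))
    (Metric.mem_ball_self hr)).differentiableAt.differentiableWithinAt

/-- A holomorphic map that is close to the identity on a ball approximates the identity with
constant `1 / 2` on the concentric ball of half the radius. -/
theorem approximatesLinearOn_id_of_norm_sub_le {f : E → E} {w : E} {r : ℝ} (hr : 0 < r)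
    (hf : ∀ x ∈ Metric.closedBall w (2 * r), DifferentiableAt ℂ f x)
    (hb : ∀ x ∈ Metric.closedBall w (2 * r), ‖f x - x‖ ≤ r / 4) :
    ApproximatesLinearOn f ((ContinuousLinearEquiv.refl ℂ E : E ≃L[ℂ] E) : E →L[ℂ] E)
      (Metric.ball w r) (1 / 2) ∧
    ∀ x ∈ Metric.ball w r, ‖fderiv ℂ f x - ContinuousLinearMap.id ℂ E‖ ≤ 1 / 2 := by
  have hsub : ∀ y ∈ Metric.ball w r, Metric.ball y r ⊆ Metric.closedBall w (2 * r) := by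
    intro y hy z hz
    rw [Metric.mem_ball] at hy hz
    rw [Metric.mem_closedBall]
    linarith [dist_triangle z y w]
  have hd : ∀ x ∈ Metric.ball w r, DifferentiableAt ℂ f x := fun x hx =>
    hf x (hsub x hx (Metric.mem_ball_self hr))
  have hderiv : ∀ x ∈ Metric.ball w r, ‖fderiv ℂ (fun y => f y - y) x‖ ≤ 1 / 2 := by
    intro x hx
    have := norm_fderiv_le_of_norm_le_ball (f := fun y => f y - y) (x := x) (ε := r / 4) hr
      (fun y hy => ((hf y (hsub x hx hy)).sub differentiableAt_id).differentiableWithinAt)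
      (fun y hy => hb y (hsub x hx hy))
    refine this.trans (le_of_eq ?_)
    field_simp
    norm_num
  refine ⟨?_, fun x hx => ?_⟩
  · intro x hx y hy
    have := (convex_ball w r).norm_image_sub_le_of_norm_fderiv_le (𝕜 := ℂ)
      (f := fun y => f y - y) (fun z hz => (hd z hz).sub differentiableAt_id) hderiv hy hx
    have h2 : f x - f y - (x - y) = f x - x - (f y - y) := by abel
    simpa [h2] using this
  · have := hderiv x hx
    rwa [fderiv_fun_sub (hd x hx) differentiableAt_fun_id, fderiv_fun_id] at this

/-- The inverse function theorem for a holomorphic map close to the identity on a ball, with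
control of the domain: the centre of the ball is in the domain of the inverse. -/
theorem exists_localInverse_of_norm_sub_le [CompleteSpace E] {f : E → E} {w : E} {r : ℝ}
    (hr : 0 < r) (hf : ∀ x ∈ Metric.closedBall w (2 * r), DifferentiableAt ℂ f x)
    (hb : ∀ x ∈ Metric.closedBall w (2 * r), ‖f x - x‖ ≤ r / 8) :
    Set.InjOn f (Metric.ball w r) ∧ ∃ e : E → E, DifferentiableAt ℂ e w ∧
      ∀ᶠ y in 𝓝 w, e y ∈ Metric.ball w r ∧ f (e y) = y := by
  obtain ⟨hA, hD⟩ := approximatesLinearOn_id_of_norm_sub_le hr hf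
    (fun x hx => (hb x hx).trans (by linarith))
  have hc : Subsingleton E ∨ (1 / 2 : NNReal) <
      ‖((ContinuousLinearEquiv.refl ℂ E).symm : E →L[ℂ] E)‖₊⁻¹ := by
    rcases subsingleton_or_nontrivial E with h | h
    · exact Or.inl h
    · right
      have : ‖((ContinuousLinearEquiv.refl ℂ E).symm : E →L[ℂ] E)‖₊ = 1 := by
        rw [← NNReal.coe_inj]
        exact ContinuousLinearMap.norm_id
      rw [this]
      norm_num
  refine ⟨hA.injOn hc, ?_⟩
  let e := hA.toOpenPartialHomeomorph f (Metric.ball w r) hc Metric.isOpen_ball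
  have hmem : w ∈ e.target := by
    rcases subsingleton_or_nontrivial E with h | h
    · exact ⟨w, Metric.mem_ball_self hr, Subsingleton.elim _ _⟩
    have hN : ‖((ContinuousLinearEquiv.refl ℂ E).symm : E →L[ℂ] E)‖₊ = 1 := by
      rw [← NNReal.coe_inj]
      exact ContinuousLinearMap.norm_id
    refine hA.closedBall_subset_target hc Metric.isOpen_ball (b := w) (ε := r / 2) (by positivity)
      (Metric.closedBall_subset_ball (by linarith)) ?_
    rw [hN, Metric.mem_closedBall, dist_comm, dist_eq_norm]
    refine (hb w (Metric.mem_closedBall_self (by positivity))).trans ?_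
    norm_num
    linarith
  have htarget : e.target ∈ 𝓝 w := e.open_target.mem_nhds hmem
  have hx : e.symm w ∈ Metric.ball w r := e.map_target hmem
  refine ⟨e.symm, ?_, ?_⟩
  · have hunit : ‖ContinuousLinearMap.id ℂ E - fderiv ℂ f (e.symm w)‖ < 1 := by
      rw [norm_sub_rev]
      exact (hD _ hx).trans_lt (by norm_num)
    let u : (E →L[ℂ] E)ˣ := Units.oneSub (ContinuousLinearMap.id ℂ E - fderiv ℂ f (e.symm w)) hunit
    have hu : ((ContinuousLinearEquiv.unitsEquiv ℂ E u : E ≃L[ℂ] E) : E →L[ℂ] E)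
        = fderiv ℂ f (e.symm w) := by
      have : (u : E →L[ℂ] E) = fderiv ℂ f (e.symm w) := by
        change (1 : E →L[ℂ] E) - (ContinuousLinearMap.id ℂ E - fderiv ℂ f (e.symm w)) = _
        ext v
        simp
      rw [← this]
      ext v
      rfl
    refine (e.hasFDerivAt_symm (f' := ContinuousLinearEquiv.unitsEquiv ℂ E u) hmem
      ?_).differentiableAt
    rw [hu]
    refine (hf _ ?_).hasFDerivAt
    exact Metric.ball_subset_closedBall (Metric.ball_subset_ball (by linarith) hx)
  · filter_upwards [htarget] with y hy
    exact ⟨e.map_target hy, e.right_inv hy⟩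

/-- A holomorphic map `Φ : Ω → V` is biholomorphic as soon as it is the pointwise limit of maps
`H n` which are eventually inverted by holomorphic maps `G n`, defined on larger and larger parts
of `V` and with `Φ ∘ G n → id` locally uniformly. -/
theorem bijOn_and_differentiableOn_inverse_of_approx [ProperSpace E] {Ω V : Set E}
    (hV : IsOpen V) {Φ : E → E} {G H : ℕ → E → E} (hmaps : Set.MapsTo Φ Ω V)
    (hGΩ : ∀ K ⊆ V, IsCompact K → ∀ᶠ n in atTop, ∀ x ∈ K,
      G n x ∈ Ω ∧ DifferentiableAt ℂ (G n) x ∧ DifferentiableAt ℂ (fun y => Φ (G n y)) x)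
    (hΦG : TendstoLocallyUniformlyOn (fun n x => Φ (G n x)) id atTop V)
    (hH : ∀ z ∈ Ω, Tendsto (fun n => H n z) atTop (𝓝 (Φ z)))
    (hGH : ∀ z ∈ Ω, ∀ᶠ n in atTop, G n (H n z) = z) :
    Set.BijOn Φ Ω V ∧ ∃ g : E → E, DifferentiableOn ℂ g V ∧ Set.InvOn g Φ Ω V := by
  have : CompleteSpace E := inferInstance
  -- on a fixed ball around `w`, for large `n`, `Φ ∘ G n` is injective and has a local inverse
  have key : ∀ w ∈ V, ∃ r > 0, ∀ᶠ n in atTop,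
      Set.InjOn (fun x => Φ (G n x)) (Metric.ball w r) ∧
      (∀ x ∈ Metric.ball w r, G n x ∈ Ω ∧ DifferentiableAt ℂ (G n) x) ∧
      ∃ e : E → E, DifferentiableAt ℂ e w ∧
      ∀ᶠ y in 𝓝 w, e y ∈ Metric.ball w r ∧ Φ (G n (e y)) = y := by
    intro w hw
    obtain ⟨r, hr, hrV⟩ : ∃ r > 0, Metric.closedBall w (2 * r) ⊆ V := by
      obtain ⟨s, hs, hsU⟩ := Metric.nhds_basis_closedBall.mem_iff.mp (hV.mem_nhds hw)
      exact ⟨s / 2, by positivity, by convert hsU using 2; ring⟩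
    have hunif := (tendstoLocallyUniformlyOn_iff_forall_isCompact hV).mp hΦG _ hrV
      (isCompact_closedBall _ _)
    refine ⟨r, hr, ?_⟩
    filter_upwards [hGΩ _ hrV (isCompact_closedBall _ _),
      Metric.tendstoUniformlyOn_iff.mp hunif (r / 8) (by positivity)] with n hn hn'
    obtain ⟨h1, h2⟩ := exists_localInverse_of_norm_sub_le (f := fun x => Φ (G n x)) hr
      (fun x hx => (hn x hx).2.2) (fun x hx => by
        have := (hn' x hx).le
        rwa [dist_comm, dist_eq_norm] at this)
    exact ⟨h1, fun x hx => ⟨(hn x (Metric.ball_subset_closedBall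
      (Metric.ball_subset_ball (by linarith) hx))).1, (hn x (Metric.ball_subset_closedBall
      (Metric.ball_subset_ball (by linarith) hx))).2.1⟩, h2⟩
  have hinj : Set.InjOn Φ Ω := by
    intro z hz z' hz' heq
    obtain ⟨r, hr, hev⟩ := key (Φ z) (hmaps hz)
    have h1 := (hH z hz).eventually (Metric.ball_mem_nhds _ hr)
    have h2 := (hH z' hz').eventually (Metric.ball_mem_nhds _ hr)
    rw [← heq] at h2
    obtain ⟨n, ⟨hI, -⟩, h1, h2, h3, h4⟩ :=
      (hev.and (h1.and (h2.and ((hGH z hz).and (hGH z' hz'))))).exists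
    have := hI h1 h2 (by simp only [h3, h4]; exact heq)
    rw [← h3, ← h4, this]
  have hsurj : Set.SurjOn Φ Ω V := by
    intro w hw
    obtain ⟨r, hr, hev⟩ := key w hw
    obtain ⟨n, -, hG, e, -, he⟩ := hev.exists
    exact ⟨G n (e w), (hG _ he.self_of_nhds.1).1, he.self_of_nhds.2⟩
  have hbij : Set.BijOn Φ Ω V := ⟨hmaps, hinj, hsurj⟩
  have hinv := hbij.invOn_invFunOn
  refine ⟨hbij, Function.invFunOn Φ Ω, fun w hw => ?_, hinv⟩
  obtain ⟨r, hr, hev⟩ := key w hw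
  obtain ⟨n, -, hG, e, hed, he⟩ := hev.exists
  have hcongr : Function.invFunOn Φ Ω =ᶠ[𝓝 w] fun y => G n (e y) := by
    filter_upwards [he, hV.mem_nhds hw] with y hy hyV
    refine hinj (Function.invFunOn_mem (hsurj hyV)) (hG _ hy.1).1 ?_
    rw [hinv.2 hyV, hy.2]
  have hGe : DifferentiableAt ℂ (fun y => G n (e y)) w :=
    DifferentiableAt.comp w (hG _ he.self_of_nhds.1).2 hed
  exact (hGe.congr_of_eventuallyEq hcongr).differentiableWithinAt

end NormedSpaces

/-! ### Coordinates on the local basin -/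

/-- The coordinates `t_j = U^{1/(kd)} z_j` (principal branch), which `F` multiplies by `λ_j` up to
a summable error. All `d` of them are kept; on the local basin their product is a fixed root of
unity. -/
noncomputable def tcoord {d : ℕ} (k : ℕ) (z : Fin d → ℂ) (j : Fin d) : ℂ :=
  z j * Complex.exp (Complex.log (bigU k z) / (k * d))

/-- The local basin described in the coordinates `(U, t)`: `U` lies in a truncated cone around the
positive real axis, the product of the `t_j` is `ω`, and no `t_j` exceeds `|U|^δ`. -/
def chartDomain (d k : ℕ) (R κ δ : ℝ) (ω : ℂ) : Set (Fin d → ℂ) :=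
  {z | R < (bigU k z).re ∧ |(bigU k z).im| < κ * (bigU k z).re ∧ ∏ j, tcoord k z j = ω ∧
    ∀ j, ‖tcoord k z j‖ < ‖bigU k z‖ ^ δ}

theorem norm_exp_log_div {U : ℂ} (hU : U ≠ 0) (x : ℝ) :
    ‖Complex.exp (Complex.log U / x)‖ = ‖U‖ ^ (1 / x) := by
  rw [Complex.norm_exp, Complex.div_ofReal_re, Complex.log_re,
    Real.rpow_def_of_pos (norm_pos_iff.mpr hU)]
  ring_nf

section Chart

variable {d k : ℕ}

theorem prod_tcoord [NeZero d] (z : Fin d → ℂ) :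
    ∏ j, tcoord k z j = (∏ j, z j) * Complex.exp (Complex.log (bigU k z) / k) := by
  have hd : (d : ℂ) ≠ 0 := NeZero.ne _
  simp only [tcoord, Finset.prod_mul_distrib, Finset.prod_const, Finset.card_univ,
    Fintype.card_fin, ← Complex.exp_nat_mul]
  congr 2
  field_simp

theorem norm_tcoord {z : Fin d → ℂ} (hU : bigU k z ≠ 0) (j : Fin d) :
    ‖tcoord k z j‖ = ‖z j‖ * ‖bigU k z‖ ^ (1 / ((k : ℝ) * d)) := by
  have := norm_exp_log_div hU ((k : ℝ) * d)
  rw [tcoord, norm_mul, ← this]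
  push_cast
  rfl

theorem norm_bigU (k : ℕ) (z : Fin d → ℂ) : ‖bigU k z‖ = (‖∏ i, z i‖ ^ k)⁻¹ := by
  rw [bigU, norm_inv, norm_pow]

theorem norm_prod_eq (hk : 0 < k) (z : Fin d → ℂ) :
    ‖∏ i, z i‖ = ‖bigU k z‖ ^ (-(1 / (k : ℝ))) := by
  have hk' : (k : ℝ) ≠ 0 := by positivity
  rw [norm_bigU, Real.rpow_neg (by positivity), Real.inv_rpow (by positivity), inv_inv,
    ← Real.rpow_natCast, ← Real.rpow_mul (norm_nonneg _)]
  field_simp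
  simp

theorem norm_sub_lt_iff_lt_re_inv {w : ℂ} {R : ℝ} (hR : 0 < R) :
    ‖w - ((1 / (2 * R) : ℝ) : ℂ)‖ < 1 / (2 * R) ↔ R < (w⁻¹).re := by
  rcases eq_or_ne w 0 with rfl | hw
  · have h2 : (0 : ℝ) < 1 / (2 * R) := by positivity
    simp only [zero_sub, norm_neg, Complex.norm_real, Real.norm_of_nonneg h2.le, lt_irrefl,
      inv_zero, Complex.zero_re, hR.not_gt]
  · have hpos : 0 < Complex.normSq w := Complex.normSq_pos.mpr hw
    have h2 : (0 : ℝ) < 1 / (2 * R) := by positivity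
    rw [← sq_lt_sq₀ (norm_nonneg _) h2.le, ← Complex.normSq_eq_norm_sq, Complex.inv_re,
      lt_div_iff₀ hpos]
    simp only [Complex.normSq_apply, Complex.sub_re, Complex.ofReal_re, Complex.sub_im,
      Complex.ofReal_im, sub_zero]
    have : (w.re - 1 / (2 * R)) * (w.re - 1 / (2 * R)) + w.im * w.im - (1 / (2 * R)) ^ 2
        = (R * (w.re * w.re + w.im * w.im) - w.re) / R := by
      field_simp
      ring
    constructor
    · intro h
      have h3 : (R * (w.re * w.re + w.im * w.im) - w.re) / R < 0 := by linarith
      have := (div_neg_iff.mp h3).resolve_left (fun h => by linarith [h.2])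
      linarith [this.1]
    · intro h
      have h3 : (R * (w.re * w.re + w.im * w.im) - w.re) / R < 0 :=
        div_neg_of_neg_of_pos (by linarith) hR
      linarith

theorem abs_arg_lt_iff_abs_im_lt {U : ℂ} (hU : 0 < U.re) {α : ℝ} (hα : α < Real.pi / 2)
    (hα0 : 0 < α) : |U.arg| < α ↔ |U.im| < Real.tan α * U.re := by
  have harg : |U.arg| < Real.pi / 2 := Complex.abs_arg_lt_pi_div_two_iff.mpr (Or.inl hU)
  have h1 : Real.tan |U.arg| = |U.im| / U.re := by
    have htan := Complex.tan_arg U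
    rcases le_total 0 U.arg with h | h
    · have him : 0 ≤ U.im := Complex.arg_nonneg_iff.mp h
      rw [abs_of_nonneg h, htan, abs_of_nonneg him]
    · have him : U.im ≤ 0 := by
        by_contra hc
        push Not at hc
        have h0 := Complex.arg_nonneg_iff.mpr hc.le
        have : U.arg = 0 := le_antisymm h h0
        exact hc.ne' (Complex.arg_eq_zero_iff.mp this).2
      rw [abs_of_nonpos h, Real.tan_neg, htan, abs_of_nonpos him, neg_div]
  rw [← div_lt_iff₀ hU, ← h1]
  have hm := Real.strictMonoOn_tan
  exact (hm.lt_iff_lt ⟨by linarith [abs_nonneg U.arg, Real.pi_pos], harg⟩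
    ⟨by linarith [Real.pi_pos], hα⟩).symm

/-- The local basin in the coordinates `(U, t)`. The condition that `u` lies in the sector of index
`h` splits into a condition on `U` and the choice `ω = e^{2πih/k}` of the branch of `u = U^{-1/k}`,
which is the condition on the product of the `t_j`. -/
theorem localBasin_eq_chartDomain [NeZero d] (hk : 0 < k) (h : ℕ) {R θ β : ℝ} (hR : 0 < R)
    (hθ : 0 < θ) (hθk : θ < Real.pi / (2 * k)) :
    localBasin d k h R θ β = chartDomain d k R (Real.tan (k * θ)) ((1 / d - β) / k)
      (Complex.exp (2 * (Real.pi : ℂ) * Complex.I * (h : ℂ) / (k : ℂ))) := by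
  have hk' : (0 : ℝ) < k := by exact_mod_cast hk
  have hkc : (k : ℂ) ≠ 0 := by exact_mod_cast hk.ne'
  have hd' : (0 : ℝ) < d := by exact_mod_cast Nat.pos_of_ne_zero (NeZero.ne d)
  have hα : k * θ < Real.pi / 2 := by
    rw [lt_div_iff₀ (by positivity)] at hθk
    linarith
  have hα0 : 0 < k * θ := by positivity
  ext z
  simp only [localBasin, sector, chartDomain, Set.mem_ofPred_eq, prod_tcoord]
  rw [norm_sub_lt_iff_lt_re_inv hR]
  change _ ∧ R < (bigU k z).re ∧ _ ↔ _
  set a : ℂ := 2 * (Real.pi : ℂ) * Complex.I * (h : ℂ) / (k : ℂ) with ha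
  set u := ∏ i, z i with hu
  by_cases hRU : R < (bigU k z).re
  swap
  · simp [hRU]
  simp only [hRU, true_and]
  have hre : 0 < (bigU k z).re := hR.trans hRU
  have hU0 : bigU k z ≠ 0 := fun h0 => by simp [h0] at hre
  have hu0 : u ≠ 0 := fun h0 => by simp [bigU, ← hu, h0, hk.ne'] at hU0
  have hβ : (∀ j, ‖z j‖ < ‖u‖ ^ β) ↔ ∀ j, ‖tcoord k z j‖ < ‖bigU k z‖ ^ ((1 / d - β) / k) := by
    refine forall_congr' fun j => ?_
    have hn : 0 < ‖bigU k z‖ := norm_pos_iff.mpr hU0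
    have he : ((1 : ℝ) / d - β) / k = -(1 / (k : ℝ)) * β + 1 / ((k : ℝ) * d) := by
      field_simp
      ring
    rw [norm_tcoord hU0, hu, norm_prod_eq hk, ← Real.rpow_mul hn.le, he, Real.rpow_add hn,
      mul_lt_mul_iff_of_pos_right (Real.rpow_pos_of_pos hn _)]
  rw [hβ, ← abs_arg_lt_iff_abs_im_lt hre hα hα0]
  set v := u * Complex.exp (-a) with hv
  have hv0 : v ≠ 0 := mul_ne_zero hu0 (Complex.exp_ne_zero _)
  have hvU : bigU k z = (v ^ k)⁻¹ := by
    rw [bigU, ← hu, hv, mul_pow, ← Complex.exp_nat_mul]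
    have : (k : ℂ) * -a = -((h : ℤ) * (2 * Real.pi * Complex.I)) := by
      rw [ha]; push_cast; field_simp
    rw [this, Complex.exp_neg, Complex.exp_int_mul_two_pi_mul_I]
    simp
  have hmain : |v.arg| < θ ↔ |(bigU k z).arg| < k * θ ∧
      u * Complex.exp (Complex.log (bigU k z) / k) = Complex.exp a := by
    have huv : u = v * Complex.exp a := by
      rw [hv, mul_assoc, ← Complex.exp_add]; simp
    have huv' : u * Complex.exp (Complex.log (bigU k z) / k) = Complex.exp a ↔
        v * Complex.exp (Complex.log (bigU k z) / k) = 1 := by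
      rw [huv, mul_right_comm]
      exact ⟨fun h => mul_right_cancel₀ (Complex.exp_ne_zero a) (by rw [h, one_mul]),
        fun h => by rw [h, one_mul]⟩
    rw [huv']
    constructor
    · intro harg
      have hlog : Complex.log (bigU k z) = -(k * Complex.log v) := by
        have him : (-(k * Complex.log v)).im = -(k * v.arg) := by
          simp [Complex.mul_im, Complex.log_im]
        have habs : |k * v.arg| < Real.pi / 2 := by
          rw [abs_mul, abs_of_pos hk']
          exact (mul_lt_mul_of_pos_left harg hk').trans hα
        rw [abs_lt] at habs
        rw [← Complex.log_exp (x := -(k * Complex.log v)) (by rw [him]; linarith [Real.pi_pos])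
          (by rw [him]; linarith [Real.pi_pos]), Complex.exp_neg, Complex.exp_nat_mul,
          Complex.exp_log hv0, hvU]
      constructor
      · rw [← Complex.log_im, hlog]
        simp only [Complex.neg_im, Complex.mul_im, Complex.natCast_re, Complex.natCast_im,
          Complex.log_im, zero_mul, add_zero, abs_neg, abs_mul, abs_of_pos hk']
        exact mul_lt_mul_of_pos_left harg hk'
      · have : Complex.log (bigU k z) / k = -Complex.log v := by
          rw [hlog]; field_simp
        rw [this, Complex.exp_neg, Complex.exp_log hv0, mul_inv_cancel₀ hv0]
    · rintro ⟨harg, hprod⟩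
      have hve : v = Complex.exp (-(Complex.log (bigU k z) / k)) := by
        rw [Complex.exp_neg]
        exact eq_inv_of_mul_eq_one_left hprod
      have him : (-(Complex.log (bigU k z) / k)).im = -((bigU k z).arg / k) := by
        rw [Complex.neg_im, ← Complex.ofReal_natCast, Complex.div_ofReal_im, Complex.log_im]
      have hlt : |(bigU k z).arg / k| < θ := by
        rw [abs_div, abs_of_pos hk', div_lt_iff₀ hk']
        linarith
      have hθπ : θ < Real.pi := by
        refine hθk.trans_le (div_le_self Real.pi_pos.le ?_)
        have : (1 : ℝ) ≤ k := by exact_mod_cast hk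
        linarith
      rw [← Complex.log_im, hve, Complex.log_exp, him, abs_neg]
      · exact hlt
      · rw [him]; rw [abs_lt] at hlt; linarith
      · rw [him]; rw [abs_lt] at hlt; linarith
  rw [hmain]
  tauto

variable {R κ δ : ℝ} {ω : ℂ} {z : Fin d → ℂ}

theorem bigU_re_pos_of_mem (hR : 0 ≤ R) (hz : z ∈ chartDomain d k R κ δ ω) : 0 < (bigU k z).re :=
  hR.trans_lt hz.1

theorem bigU_ne_zero_of_mem (hR : 0 ≤ R) (hz : z ∈ chartDomain d k R κ δ ω) : bigU k z ≠ 0 :=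
  fun h0 => by simpa [h0] using bigU_re_pos_of_mem hR hz

theorem prod_ne_zero_of_bigU_ne_zero (hk : 0 < k) (hz : bigU k z ≠ 0) : ∏ i, z i ≠ 0 :=
  fun h0 => hz (by simp [bigU, h0, hk.ne'])

theorem apply_ne_zero_of_bigU_ne_zero (hk : 0 < k) (hz : bigU k z ≠ 0) (j : Fin d) : z j ≠ 0 :=
  fun h0 => prod_ne_zero_of_bigU_ne_zero hk hz (Finset.prod_eq_zero (Finset.mem_univ j) h0)

theorem norm_bigU_le_of_mem (hR : 0 ≤ R) (hz : z ∈ chartDomain d k R κ δ ω) :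
    ‖bigU k z‖ ≤ (1 + κ) * (bigU k z).re := by
  have h1 := Complex.norm_le_abs_re_add_abs_im (bigU k z)
  rw [abs_of_pos (bigU_re_pos_of_mem hR hz)] at h1
  linarith [hz.2.1]

/-- On the domain of the chart, the coordinates `t_j` are also bounded from below, because their
product has modulus one. -/
theorem le_norm_tcoord_of_mem (hR : 0 ≤ R) (hω : ‖ω‖ = 1) (hz : z ∈ chartDomain d k R κ δ ω)
    (j : Fin d) : ‖bigU k z‖ ^ (-(δ * (d - 1))) ≤ ‖tcoord k z j‖ := by
  have hn : 0 < ‖bigU k z‖ := norm_pos_iff.mpr (bigU_ne_zero_of_mem hR hz)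
  have h1 : ‖tcoord k z j‖ * ∏ i ∈ Finset.univ.erase j, ‖tcoord k z i‖ = 1 := by
    rw [Finset.mul_prod_erase _ (fun i => ‖tcoord k z i‖) (Finset.mem_univ j), ← norm_prod,
      hz.2.2.1, hω]
  have h2 : ∏ i ∈ Finset.univ.erase j, ‖tcoord k z i‖ ≤ ‖bigU k z‖ ^ (δ * (d - 1)) := by
    calc ∏ i ∈ Finset.univ.erase j, ‖tcoord k z i‖
        ≤ ∏ i ∈ Finset.univ.erase j, ‖bigU k z‖ ^ δ :=
          Finset.prod_le_prod (fun _ _ => norm_nonneg _) (fun i _ => (hz.2.2.2 i).le)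
      _ = ‖bigU k z‖ ^ (δ * (d - 1)) := by
          have hd1 : 1 ≤ d := Nat.one_le_iff_ne_zero.mpr (fun h => by subst h; exact j.elim0)
          rw [Finset.prod_const, Finset.card_erase_of_mem (Finset.mem_univ j), Finset.card_univ,
            Fintype.card_fin, ← Real.rpow_natCast, ← Real.rpow_mul hn.le, Nat.cast_sub hd1,
            Nat.cast_one]
  rw [Real.rpow_neg hn.le, inv_le_iff_one_le_mul₀ (Real.rpow_pos_of_pos hn _)]
  exact h1.symm.le.trans (mul_le_mul_of_nonneg_left h2 (norm_nonneg _))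

theorem norm_apply_lt_of_mem (hR : 0 ≤ R) (hz : z ∈ chartDomain d k R κ δ ω) (j : Fin d) :
    ‖z j‖ < ‖bigU k z‖ ^ (δ - 1 / ((k : ℝ) * d)) := by
  have hU0 := bigU_ne_zero_of_mem hR hz
  have hn : 0 < ‖bigU k z‖ := norm_pos_iff.mpr hU0
  have := hz.2.2.2 j
  rw [norm_tcoord hU0] at this
  rw [Real.rpow_sub hn, lt_div_iff₀ (Real.rpow_pos_of_pos hn _)]
  exact this

end Chart

/-! ### Taylor expansions at infinity -/

theorem isBigO_neg_mul_log_one_sub {m : ℂ} (hm : m ≠ 0) :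
    (fun w : ℂ => -m * Complex.log (1 - w / m) - w - w ^ 2 / (2 * m)) =O[𝓝 0] fun w => w ^ 3 := by
  have h1 := Complex.log_sub_logTaylor_isBigO 2
  have ht : Tendsto (fun w : ℂ => -w / m) (𝓝 0) (𝓝 0) := by
    have : Continuous fun w : ℂ => -w / m := by fun_prop
    simpa using this.tendsto 0
  have h2 := (h1.comp_tendsto ht).const_mul_left (-m)
  refine (h2.congr_left fun w => ?_).trans ?_
  · simp only [Function.comp_apply, Complex.logTaylor_succ, Complex.logTaylor_zero, neg_div,
      ← sub_eq_add_neg]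
    simp
    field_simp
    ring
  · refine IsBigO.of_bound (‖m‖⁻¹ ^ 3) (Eventually.of_forall fun w => ?_)
    simp only [Function.comp_apply, norm_pow, norm_div, norm_neg]
    rw [div_pow, inv_pow]
    exact le_of_eq (by ring)

theorem isBigO_exp_sub_one_sub_id_sub_sq :
    (fun x : ℂ => Complex.exp x - 1 - x - x ^ 2 / 2) =O[𝓝 0] fun x => x ^ 3 := by
  refine IsBigO.of_bound (Real.exp 1) ?_
  filter_upwards [Metric.ball_mem_nhds (0 : ℂ) one_pos] with x hx
  have h := Complex.norm_exp_sub_sum_le_norm_mul_exp x 3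
  have hs : Complex.exp x - ∑ m ∈ Finset.range 3, x ^ m / (m.factorial : ℂ)
      = Complex.exp x - 1 - x - x ^ 2 / 2 := by
    simp [Finset.sum_range_succ, Nat.factorial]
    ring
  rw [hs] at h
  refine h.trans ?_
  rw [norm_pow, mul_comm]
  have : ‖x‖ ≤ 1 := (mem_ball_zero_iff.mp hx).le
  gcongr

/-- The choice of `c` makes the term of order `w ^ 2` vanish. -/
theorem isBigO_exp_log_expansion {m c : ℂ} (hm : m ≠ 0) (hc : c = -(1 / 2) * (1 + 1 / m)) :
    (fun w : ℂ => Complex.exp (-m * Complex.log (1 - w / m)) - 1 - w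
      + c * w * (-m * Complex.log (1 - w / m))) =O[𝓝 0] fun w => w ^ 3 := by
  set f : ℂ → ℂ := fun w => -m * Complex.log (1 - w / m) with hf
  have h1 : (fun w => f w - w - w ^ 2 / (2 * m)) =O[𝓝 0] fun w : ℂ => w ^ 3 :=
    isBigO_neg_mul_log_one_sub hm
  have hid : (fun w : ℂ => w) =O[𝓝 0] fun _ => (1 : ℂ) :=
    (continuous_id.tendsto (0 : ℂ)).isBigO_one ℂ
  have h32 : (fun w : ℂ => w ^ 3) =O[𝓝 0] fun w : ℂ => w ^ 2 := by
    have := (isBigO_refl (fun w : ℂ => w ^ 2) (𝓝 0)).mul hid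
    simpa [pow_succ] using this
  have h21 : (fun w : ℂ => w ^ 2) =O[𝓝 0] fun w : ℂ => w := by
    have := (isBigO_refl (fun w : ℂ => w) (𝓝 0)).mul hid
    simpa [pow_succ] using this
  have h2 : (fun w => f w - w) =O[𝓝 0] fun w : ℂ => w ^ 2 := by
    have h3 := (h1.trans h32).add ((isBigO_refl (fun w : ℂ => w ^ 2) (𝓝 0)).const_mul_left
      (1 / (2 * m)))
    refine h3.congr_left fun w => ?_
    ring
  have h3 : f =O[𝓝 0] fun w : ℂ => w := by
    have h4 := (h2.trans h21).add (isBigO_refl (fun w : ℂ => w) (𝓝 0))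
    exact h4.congr_left fun w => by ring
  have hf0 : Tendsto f (𝓝 0) (𝓝 0) := h3.trans_tendsto (continuous_id.tendsto (0 : ℂ))
  have h4 : (fun w => Complex.exp (f w) - 1 - f w - f w ^ 2 / 2) =O[𝓝 0] fun w : ℂ => w ^ 3 :=
    (isBigO_exp_sub_one_sub_id_sub_sq.comp_tendsto hf0).trans (h3.pow 3)
  have h5 : (fun w => f w ^ 2 - w ^ 2) =O[𝓝 0] fun w : ℂ => w ^ 3 := by
    have := h2.mul (h3.add (isBigO_refl (fun w : ℂ => w) (𝓝 0)))
    refine this.congr (fun w => by ring) (fun w => by ring)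
  have h6 : (fun w => w * (f w - w)) =O[𝓝 0] fun w : ℂ => w ^ 3 :=
    ((isBigO_refl (fun w : ℂ => w) (𝓝 0)).mul h2).congr_right fun w => by ring
  have h7 := ((h4.add h1).add (h5.const_mul_left (1 / 2))).add (h6.const_mul_left c)
  refine h7.congr_left fun w => ?_
  have : c * w * f w = c * (w * (f w - w)) + c * w ^ 2 := by ring
  change _ = Complex.exp (f w) - 1 - w + c * w * f w
  rw [this, hc]
  generalize f w = y
  field_simp
  ring

/-- The step of the Fatou coordinate: if `ℓ` is the increment of `log U` and `w = 1 / U`, then the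
increment of `U + c log U` is `1` up to an error of order `|w| ^ (q - 1)`. -/
theorem isBigO_fatou_step {α : Type*} {𝓕 : Filter α} {m c : ℂ} (hm : m ≠ 0)
    (hc : c = -(1 / 2) * (1 + 1 / m)) {w e ℓ : α → ℂ} (hw : Tendsto w 𝓕 (𝓝 0))
    (hw0 : ∀ᶠ x in 𝓕, w x ≠ 0) {q : ℝ} (hq2 : 2 ≤ q) (hq3 : q ≤ 3)
    (he : e =O[𝓕] fun x => ‖w x‖ ^ q)
    (hℓ : ∀ x, ℓ x = -m * Complex.log (1 - w x / m) + e x) :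
    ((fun x => (w x)⁻¹ * (Complex.exp (ℓ x) - 1) - 1 + c * ℓ x) =O[𝓕] fun x => ‖w x‖ ^ (q - 1)) ∧
      (fun x => ℓ x - w x) =O[𝓕] fun x => ‖w x‖ ^ (2 : ℝ) := by
  set f : ℂ → ℂ := fun w => -m * Complex.log (1 - w / m) with hf
  have hwle : ∀ᶠ x in 𝓕, ‖w x‖ ≤ 1 := by
    have := hw.norm.eventually (eventually_lt_nhds (b := 1) (by simp))
    exact this.mono fun _ h => h.le
  have hpow : ∀ {a b : ℝ}, a ≤ b → (fun x => ‖w x‖ ^ b) =O[𝓕] fun x => ‖w x‖ ^ a := by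
    intro a b hab
    refine IsBigO.of_bound 1 ?_
    filter_upwards [hwle, hw0] with x hx hx0
    rw [Real.norm_of_nonneg (by positivity), Real.norm_of_nonneg (by positivity), one_mul]
    exact Real.rpow_le_rpow_of_exponent_ge (norm_pos_iff.mpr hx0) hx hab
  have hnpow : ∀ n : ℕ, (fun x => w x ^ n) =O[𝓕] fun x => ‖w x‖ ^ (n : ℝ) := fun n =>
    IsBigO.of_bound 1 (Eventually.of_forall fun x => by simp)
  have hpow0 : Tendsto (fun x => ‖w x‖ ^ q) 𝓕 (𝓝 0) := by
    have := hw.norm.rpow_const (p := q) (Or.inr (by linarith))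
    simpa [Real.zero_rpow (by linarith : q ≠ 0)] using this
  have he0 : Tendsto e 𝓕 (𝓝 0) := he.trans_tendsto hpow0
  have hfw : (fun x => f (w x) - w x) =O[𝓕] fun x => ‖w x‖ ^ (2 : ℝ) := by
    have h1 := (isBigO_neg_mul_log_one_sub hm).comp_tendsto hw
    have h1' : (fun x => f (w x) - w x - w x ^ 2 / (2 * m)) =O[𝓕] fun x => ‖w x‖ ^ (2 : ℝ) :=
      (h1.trans (hnpow 3)).trans (hpow (by norm_num))
    have h2 := h1'.add ((hnpow 2).const_mul_left (1 / (2 * m)))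
    refine h2.congr_left fun x => ?_
    ring
  have hf0 : Tendsto (fun x => f (w x)) 𝓕 (𝓝 0) := by
    have h1 : Tendsto (fun x => f (w x) - w x) 𝓕 (𝓝 0) := by
      refine hfw.trans_tendsto ?_
      have := hw.norm.rpow_const (p := 2) (Or.inr (by norm_num))
      simpa using this
    simpa using h1.add hw
  constructor
  · have h1 := (isBigO_exp_log_expansion hm hc).comp_tendsto hw
    have hg : (fun x => (w x)⁻¹ * (Complex.exp (f (w x)) - 1 - w x + c * w x * f (w x)))
        =O[𝓕] fun x => ‖w x‖ ^ (q - 1) := by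
      have h2 := (isBigO_refl (fun x => (w x)⁻¹) 𝓕).mul h1
      refine h2.trans (IsBigO.trans ?_ ((hnpow 2).trans (hpow (by push_cast; linarith))))
      refine IsBigO.of_bound 1 (Filter.Eventually.mono hw0 fun x hx => le_of_eq ?_)
      simp only [Function.comp_apply]
      rw [one_mul]
      congr 1
      field_simp
    have hE : (fun x => Complex.exp (e x) - 1) =O[𝓕] fun x => ‖w x‖ ^ q := by
      refine IsBigO.trans ?_ he
      refine IsBigO.of_bound 2 ?_
      have := he0.norm.eventually (eventually_lt_nhds (b := 1) (by simp))
      filter_upwards [this] with x hx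
      exact Complex.norm_exp_sub_one_le hx.le
    have hexpf : (fun x => Complex.exp (f (w x))) =O[𝓕] fun _ => (1 : ℝ) :=
      ((Complex.continuous_exp.tendsto 0).comp hf0).isBigO_one ℝ
    have h3 : (fun x => (w x)⁻¹ * (Complex.exp (f (w x)) * (Complex.exp (e x) - 1)))
        =O[𝓕] fun x => ‖w x‖ ^ (q - 1) := by
      have h4 := (isBigO_refl (fun x => (w x)⁻¹) 𝓕).norm_right.mul (hexpf.mul hE)
      refine h4.trans (IsBigO.of_bound 1 ?_)
      filter_upwards [hw0] with x hx
      have hx' : 0 < ‖w x‖ := norm_pos_iff.mpr hx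
      rw [norm_mul, norm_norm, norm_inv, one_mul, one_mul, Real.norm_of_nonneg (by positivity),
        Real.norm_of_nonneg (by positivity), Real.rpow_sub hx', Real.rpow_one]
      exact le_of_eq (by ring)
    have h5 : (fun x => c * e x) =O[𝓕] fun x => ‖w x‖ ^ (q - 1) :=
      (he.trans (hpow (by linarith))).const_mul_left c
    refine ((hg.add h3).add h5).congr' ?_ EventuallyEq.rfl
    filter_upwards [hw0] with x hx
    rw [hℓ, Complex.exp_add]
    change _ = (w x)⁻¹ * (Complex.exp (f (w x)) * Complex.exp (e x) - 1) - 1 + c * (f (w x) + e x)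
    field_simp
    ring
  · refine (hfw.add (he.trans (hpow hq2))).congr_left fun x => ?_
    rw [hℓ]
    ring

/-! ### The dynamics near infinity in the chart -/

/-- The standing assumptions: `F` agrees with the normal form up to order `l`, the multipliers have
modulus and product one, and the exponent `β` and the order `l` are compatible. -/
structure IsTangentToNormalForm {d : ℕ} (k : ℕ) (lam : Fin d → ℂ) (F : (Fin d → ℂ) → (Fin d → ℂ))
    (l : ℕ) (β κ : ℝ) (ω : ℂ) : Prop where
  k_pos : 0 < k
  norm_lam : ∀ j, ‖lam j‖ = 1
  prod_lam : ∏ j, lam j = 1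
  isBigO : (fun z => F z - normalForm k lam z) =O[𝓝 0] (fun z => ‖z‖ ^ l)
  beta_pos : 0 < β
  beta_lt : β < 1 / d
  lt_beta_mul : 2 * k + 1 < β * ((l : ℝ) + d - 1)
  kappa_pos : 0 < κ
  norm_omega : ‖ω‖ = 1

/-- The neighbourhoods of infinity in the local basin, in the sense `|U| → ∞`. -/
noncomputable def basinAtInfty (d k : ℕ) (κ δ : ℝ) (ω : ℂ) : Filter (Fin d → ℂ) :=
  comap (fun z => ‖bigU k z‖) atTop ⊓ 𝓟 (chartDomain d k 1 κ δ ω)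

section Basic

variable {d k : ℕ} {κ δ : ℝ} {ω : ℂ}

theorem eventually_mem_chartDomain :
    ∀ᶠ z in basinAtInfty d k κ δ ω, z ∈ chartDomain d k 1 κ δ ω :=
  mem_inf_of_right (mem_principal_self _)

theorem tendsto_norm_bigU :
    Tendsto (fun z => ‖bigU k z‖) (basinAtInfty d k κ δ ω) atTop :=
  tendsto_comap.mono_left inf_le_left

theorem tendsto_inv_bigU :
    Tendsto (fun z => (bigU k z)⁻¹) (basinAtInfty d k κ δ ω) (𝓝 0) := by
  rw [tendsto_zero_iff_norm_tendsto_zero]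
  simp only [norm_inv]
  exact tendsto_norm_bigU.inv_tendsto_atTop

theorem eventually_bigU_ne_zero : ∀ᶠ z in basinAtInfty d k κ δ ω, bigU k z ≠ 0 :=
  eventually_mem_chartDomain.mono fun _ hz => bigU_ne_zero_of_mem zero_le_one hz

theorem exists_forall_of_eventually_basinAtInfty {P : (Fin d → ℂ) → Prop}
    (h : ∀ᶠ z in basinAtInfty d k κ δ ω, P z) :
    ∃ R : ℝ, 1 ≤ R ∧ ∀ z ∈ chartDomain d k R κ δ ω, P z := by
  rw [basinAtInfty, eventually_inf_principal, eventually_comap] at h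
  obtain ⟨R, hR⟩ := eventually_atTop.mp h
  refine ⟨max R 1, le_max_right _ _, fun z hz => hR ‖bigU k z‖ ?_ z rfl ?_⟩
  · exact ((le_max_left _ _).trans hz.1.le).trans (Complex.re_le_norm _)
  · exact ⟨(le_max_right _ _).trans_lt hz.1, hz.2⟩

theorem tendsto_id_basinAtInfty (hδ : δ < 1 / ((k : ℝ) * d)) :
    Tendsto id (basinAtInfty d k κ δ ω) (𝓝 0) := by
  rw [tendsto_pi_nhds]
  intro j
  rw [Pi.zero_apply, tendsto_zero_iff_norm_tendsto_zero]
  have h1 : Tendsto (fun z => ‖bigU k z‖ ^ (δ - 1 / ((k : ℝ) * d))) (basinAtInfty d k κ δ ω)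
      (𝓝 0) := by
    have := (tendsto_rpow_neg_atTop (y := 1 / ((k : ℝ) * d) - δ) (by linarith)).comp
      (tendsto_norm_bigU (d := d) (k := k) (κ := κ) (δ := δ) (ω := ω))
    simpa [Function.comp_def] using this
  refine squeeze_zero' (Eventually.of_forall fun _ => norm_nonneg _) ?_ h1
  filter_upwards [eventually_mem_chartDomain] with z hz
  exact (norm_apply_lt_of_mem zero_le_one hz j).le

end Basic

theorem eventually_nhds_one_mem_cone {κ : ℝ} (hκ : 0 < κ) :
    ∀ᶠ x : ℂ in 𝓝 1, 1 / 2 < x.re ∧ |x.im| < κ * x.re := by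
  refine Eventually.and ?_ ?_
  · exact (Complex.continuous_re.tendsto 1).eventually (lt_mem_nhds (by norm_num))
  · have h1 : Tendsto (fun x : ℂ => κ * x.re - |x.im|) (𝓝 1) (𝓝 (κ * (1 : ℂ).re - |(1 : ℂ).im|)) :=
      (by fun_prop : Continuous fun x : ℂ => κ * x.re - |x.im|).tendsto 1
    have h2 := h1.eventually (lt_mem_nhds (a := 0) (by simpa using hκ))
    exact h2.mono fun x hx => by linarith

section Estimates

variable {d k : ℕ} {lam : Fin d → ℂ} {F : (Fin d → ℂ) → (Fin d → ℂ)}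
  {l : ℕ} {β κ : ℝ} {ω : ℂ}

namespace IsTangentToNormalForm

theorem lam_ne_zero (hF : IsTangentToNormalForm k lam F l β κ ω) (j : Fin d) : lam j ≠ 0 :=
  fun h => by simpa [h] using hF.norm_lam j

/-- The error of `F` relative to the normal form, coordinate by coordinate. The lower bound for
`|z_j|` costs only `d - 1` powers of `|u| ^ β`, whence the exponent. -/
theorem isBigO_relative_error [NeZero d] (hF : IsTangentToNormalForm k lam F l β κ ω) (j : Fin d) :
    (fun z => F z j / (lam j * z j * (1 - (bigU k z)⁻¹ / ((k : ℂ) * d))) - 1)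
      =O[basinAtInfty d k κ ((1 / d - β) / k) ω]
      fun z => ‖(bigU k z)⁻¹‖ ^ ((β * ((l : ℝ) + d - 1) - 1) / k) := by
  have hk : (0 : ℝ) < k := by exact_mod_cast hF.k_pos
  have hd : (0 : ℝ) < d := by exact_mod_cast Nat.pos_of_ne_zero (NeZero.ne d)
  have hδ : (1 / d - β) / k < 1 / ((k : ℝ) * d) := by
    have h1 : 1 / ((k : ℝ) * d) = (1 / d) / k := by field_simp
    rw [h1, div_lt_div_iff_of_pos_right hk]
    linarith [hF.beta_pos]
  set δ : ℝ := (1 / d - β) / k with hδdef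
  set 𝓕 := basinAtInfty d k κ δ ω
  have h1 : (fun z => F z j - normalForm k lam z j) =O[𝓕] fun z => ‖z‖ ^ l := by
    have h2 := hF.isBigO.comp_tendsto (tendsto_id_basinAtInfty (κ := κ) (ω := ω) hδ)
    exact (isBigO_pi.mp h2) j
  have h2 : (fun z : Fin d → ℂ => ‖z‖ ^ l) =O[𝓕] fun z => ‖bigU k z‖ ^ ((δ - 1 / (k * d)) * l) := by
    refine IsBigO.of_bound 1 ?_
    filter_upwards [eventually_mem_chartDomain] with z hz
    have h3 : ‖z‖ ≤ ‖bigU k z‖ ^ (δ - 1 / ((k : ℝ) * d)) :=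
      (pi_norm_le_iff_of_nonneg (by positivity)).mpr fun i =>
        (norm_apply_lt_of_mem zero_le_one hz i).le
    rw [Real.norm_of_nonneg (by positivity), Real.norm_of_nonneg (by positivity), one_mul,
      Real.rpow_mul (norm_nonneg _), Real.rpow_natCast]
    exact pow_le_pow_left₀ (norm_nonneg _) h3 l
  have h3 : (fun z : Fin d → ℂ => (z j)⁻¹) =O[𝓕]
      fun z => ‖bigU k z‖ ^ (δ * (d - 1) + 1 / (k * d)) := by
    refine IsBigO.of_bound 1 ?_
    filter_upwards [eventually_mem_chartDomain] with z hz
    have hU0 := bigU_ne_zero_of_mem zero_le_one hz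
    have hn : 0 < ‖bigU k z‖ := norm_pos_iff.mpr hU0
    have h4 := le_norm_tcoord_of_mem zero_le_one hF.norm_omega hz j
    rw [norm_tcoord hU0, Real.rpow_neg hn.le] at h4
    have hz0 : 0 < ‖z j‖ := norm_pos_iff.mpr (apply_ne_zero_of_bigU_ne_zero hF.k_pos hU0 j)
    rw [Real.norm_of_nonneg (by positivity), one_mul, Real.rpow_add hn, norm_inv,
      inv_le_iff_one_le_mul₀ hz0]
    rw [inv_le_iff_one_le_mul₀ (Real.rpow_pos_of_pos hn _)] at h4
    linarith
  have h4 : (fun z => (lam j * (1 - (bigU k z)⁻¹ / ((k : ℂ) * d)))⁻¹) =O[𝓕] fun _ => (1 : ℝ) := by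
    have h5 : Tendsto (fun z => (lam j * (1 - (bigU k z)⁻¹ / ((k : ℂ) * d)))⁻¹) 𝓕
        (𝓝 (lam j * (1 - 0 / ((k : ℂ) * d)))⁻¹) := by
      refine Tendsto.inv₀ ?_ ?_
      · exact ((tendsto_inv_bigU.div_const _).const_sub 1).const_mul _
      · simpa using hF.lam_ne_zero j
    exact h5.isBigO_one ℝ
  have h5 := (h1.trans h2).mul (h3.mul h4)
  have hne : ∀ᶠ z in 𝓕, (1 - (bigU k z)⁻¹ / ((k : ℂ) * d)) ≠ 0 := by
    have : Tendsto (fun z => 1 - (bigU k z)⁻¹ / ((k : ℂ) * d)) 𝓕 (𝓝 (1 - 0 / ((k : ℂ) * d))) :=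
      (tendsto_inv_bigU.div_const _).const_sub 1
    exact this.eventually_ne (by simp)
  refine (h5.congr' ?_ EventuallyEq.rfl).trans ?_
  · filter_upwards [eventually_bigU_ne_zero, hne] with z hz hz2
    have hz0 := apply_ne_zero_of_bigU_ne_zero hF.k_pos hz j
    have hl0 := hF.lam_ne_zero j
    have hnf : normalForm k lam z j = lam j * z j * (1 - (bigU k z)⁻¹ / ((k : ℂ) * d)) := by
      simp [normalForm, bigU]
    rw [hnf]
    generalize 1 - (bigU k z)⁻¹ / ((k : ℂ) * d) = y at *
    field_simp
  · refine IsBigO.of_bound 1 ?_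
    filter_upwards [eventually_bigU_ne_zero] with z hz
    have hn : 0 < ‖bigU k z‖ := norm_pos_iff.mpr hz
    rw [mul_one, ← Real.rpow_add hn, norm_inv, Real.inv_rpow hn.le, ← Real.rpow_neg hn.le, one_mul]
    refine le_of_eq ?_
    congr 2
    rw [hδdef]
    field_simp
    ring

/-- The logarithm of the relative error of `F` in the coordinate `j`. -/
theorem exists_log_error [NeZero d] (hF : IsTangentToNormalForm k lam F l β κ ω) :
    ∃ L : (Fin d → ℂ) → Fin d → ℂ,
      (∀ j, (fun z => L z j) =O[basinAtInfty d k κ ((1 / d - β) / k) ω]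
        fun z => ‖(bigU k z)⁻¹‖ ^ ((β * ((l : ℝ) + d - 1) - 1) / k)) ∧
      ∀ᶠ z in basinAtInfty d k κ ((1 / d - β) / k) ω, ∀ j,
        F z j = lam j * z j * (1 - (bigU k z)⁻¹ / ((k : ℂ) * d)) * Complex.exp (L z j) := by
  have hk : (0 : ℝ) < k := by exact_mod_cast hF.k_pos
  set 𝓕 := basinAtInfty d k κ ((1 / d - β) / k) ω
  set γ : ℝ := (β * ((l : ℝ) + d - 1) - 1) / k with hγ
  have hγ0 : 0 < γ := div_pos (by linarith [hF.lt_beta_mul]) hk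
  set y : (Fin d → ℂ) → Fin d → ℂ := fun z j =>
    F z j / (lam j * z j * (1 - (bigU k z)⁻¹ / ((k : ℂ) * d))) - 1 with hy
  have hpow0 : Tendsto (fun z => ‖(bigU k z)⁻¹‖ ^ γ) 𝓕 (𝓝 0) := by
    have := tendsto_inv_bigU (d := d) (k := k) (κ := κ) (δ := (1 / d - β) / k) (ω := ω)
      |>.norm.rpow_const (p := γ) (Or.inr hγ0.le)
    simpa only [norm_zero, Real.zero_rpow hγ0.ne'] using this
  have hyO : ∀ j, (fun z => y z j) =O[𝓕] fun z => ‖(bigU k z)⁻¹‖ ^ γ := hF.isBigO_relative_error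
  have hy0 : ∀ j, Tendsto (fun z => y z j) 𝓕 (𝓝 0) := fun j => (hyO j).trans_tendsto hpow0
  refine ⟨fun z j => Complex.log (1 + y z j), fun j => ?_, ?_⟩
  · refine IsBigO.trans (IsBigO.of_bound (3 / 2) ?_) (hyO j)
    have := (hy0 j).norm.eventually (eventually_le_nhds (b := 1 / 2) (by simp))
    filter_upwards [this] with z hz
    exact Complex.norm_log_one_add_half_le_self hz
  · have hne : ∀ᶠ z in 𝓕, (1 - (bigU k z)⁻¹ / ((k : ℂ) * d)) ≠ 0 := by
      have : Tendsto (fun z => 1 - (bigU k z)⁻¹ / ((k : ℂ) * d)) 𝓕 (𝓝 (1 - 0 / ((k : ℂ) * d))) :=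
        (tendsto_inv_bigU.div_const _).const_sub 1
      exact this.eventually_ne (by simp)
    have hyne : ∀ᶠ z in 𝓕, ∀ j, 1 + y z j ≠ 0 := by
      rw [eventually_all]
      intro j
      exact ((hy0 j).const_add 1).eventually_ne (by simp)
    filter_upwards [hne, hyne, eventually_bigU_ne_zero] with z h1 h2 h3 j
    have hz0 := apply_ne_zero_of_bigU_ne_zero hF.k_pos h3 j
    have hl0 := hF.lam_ne_zero j
    have h4 : 1 + y z j = F z j / (lam j * z j * (1 - (bigU k z)⁻¹ / ((k : ℂ) * d))) :=
      add_sub_cancel _ _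
    rw [Complex.exp_log (h2 j), h4,
      mul_div_cancel₀ _ (mul_ne_zero (mul_ne_zero hl0 hz0) h1)]

end IsTangentToNormalForm

end Estimates

section Steps

variable {d k : ℕ} [NeZero d] {lam : Fin d → ℂ} {F : (Fin d → ℂ) → (Fin d → ℂ)}
  {l : ℕ} {β κ : ℝ} {ω : ℂ}

namespace IsTangentToNormalForm

/-- One step of `F` in the chart. Here `ℓ` is the increment of `log U` and the `s j` are the
logarithms of the relative errors of the `t_j`; since the product of the `t_j` is preserved, they
add up to zero. -/
theorem exists_step_asymptotics (hF : IsTangentToNormalForm k lam F l β κ ω) {c : ℂ}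
    (hc : c = -(1 / 2) * (1 + 1 / ((k : ℂ) * d))) :
    ∃ p : ℝ, 1 < p ∧ ∃ (ℓ : (Fin d → ℂ) → ℂ) (s : (Fin d → ℂ) → Fin d → ℂ),
      (∀ᶠ z in basinAtInfty d k κ ((1 / d - β) / k) ω,
        bigU k (F z) = bigU k z * Complex.exp (ℓ z)) ∧
      (∀ᶠ z in basinAtInfty d k κ ((1 / d - β) / k) ω,
        Complex.log (bigU k (F z)) = Complex.log (bigU k z) + ℓ z) ∧
      (∀ᶠ z in basinAtInfty d k κ ((1 / d - β) / k) ω, ∀ j,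
        tcoord k (F z) j = lam j * tcoord k z j * Complex.exp (s z j)) ∧
      (∀ z, ∑ j, s z j = 0) ∧
      (∀ j, (fun z => s z j) =O[basinAtInfty d k κ ((1 / d - β) / k) ω]
        fun z => ‖(bigU k z)⁻¹‖ ^ p) ∧
      ((fun z => bigU k z * (Complex.exp (ℓ z) - 1) - 1 + c * ℓ z)
        =O[basinAtInfty d k κ ((1 / d - β) / k) ω] fun z => ‖(bigU k z)⁻¹‖ ^ p) ∧
      (fun z => ℓ z - (bigU k z)⁻¹) =O[basinAtInfty d k κ ((1 / d - β) / k) ω]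
        fun z => ‖(bigU k z)⁻¹‖ ^ (2 : ℝ) := by
  have hk : (0 : ℝ) < k := by exact_mod_cast hF.k_pos
  have hkc : (k : ℂ) ≠ 0 := by exact_mod_cast hF.k_pos.ne'
  have hdc : (d : ℂ) ≠ 0 := NeZero.ne _
  have hmc : (k : ℂ) * d ≠ 0 := mul_ne_zero hkc hdc
  obtain ⟨L, hLO, hFL⟩ := hF.exists_log_error
  set 𝓕 := basinAtInfty d k κ ((1 / d - β) / k) ω with h𝓕
  set γ : ℝ := (β * ((l : ℝ) + d - 1) - 1) / k with hγ
  have hγ2 : 2 < γ := by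
    rw [hγ, lt_div_iff₀ hk]
    linarith [hF.lt_beta_mul]
  have hw : Tendsto (fun z => (bigU k z)⁻¹) 𝓕 (𝓝 0) := tendsto_inv_bigU
  have hw0 : ∀ᶠ z in 𝓕, (bigU k z)⁻¹ ≠ 0 := eventually_bigU_ne_zero.mono fun _ h => inv_ne_zero h
  have hpow : ∀ {a b : ℝ}, a ≤ b →
      (fun z => ‖(bigU k z)⁻¹‖ ^ b) =O[𝓕] fun z => ‖(bigU k z)⁻¹‖ ^ a := by
    intro a b hab
    refine IsBigO.of_bound 1 ?_
    have hwle : ∀ᶠ z in 𝓕, ‖(bigU k z)⁻¹‖ ≤ 1 :=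
      hw.norm.eventually (eventually_le_nhds (b := 1) (by simp))
    filter_upwards [hwle, hw0] with x hx hx0
    rw [Real.norm_of_nonneg (by positivity), Real.norm_of_nonneg (by positivity), one_mul]
    exact Real.rpow_le_rpow_of_exponent_ge (norm_pos_iff.mpr hx0) hx hab
  have hsumO : (fun z => ∑ i, L z i) =O[𝓕] fun z => ‖(bigU k z)⁻¹‖ ^ γ :=
    IsBigO.fun_sum fun i _ => hLO i
  set e : (Fin d → ℂ) → ℂ := fun z => -k * ∑ i, L z i with he
  set ℓ : (Fin d → ℂ) → ℂ := fun z =>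
    -((k : ℂ) * d) * Complex.log (1 - (bigU k z)⁻¹ / ((k : ℂ) * d)) + e z with hℓ
  set s : (Fin d → ℂ) → Fin d → ℂ := fun z j => L z j - (∑ i, L z i) / d with hs
  -- the Taylor remainder of `F_N` limits the exponent of the total error to `3`
  have heO : e =O[𝓕] fun z => ‖(bigU k z)⁻¹‖ ^ (min γ 3) :=
    (hsumO.const_mul_left _).trans (hpow (min_le_left _ _))
  obtain ⟨hstep, hℓO⟩ := isBigO_fatou_step (𝓕 := 𝓕) (w := fun z => (bigU k z)⁻¹) (e := e) (ℓ := ℓ)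
    hmc hc hw hw0 (q := min γ 3) (le_min hγ2.le (by norm_num)) (min_le_right _ _) heO
    (fun _ => rfl)
  have hsO : ∀ j, (fun z => s z j) =O[𝓕] fun z => ‖(bigU k z)⁻¹‖ ^ (min γ 3 - 1) := fun j =>
    ((hLO j).sub ((hsumO.const_mul_left (d : ℂ)⁻¹).congr_left fun z => by ring)).trans
      (hpow (by linarith [min_le_left γ 3]))
  have hℓ0 : Tendsto ℓ 𝓕 (𝓝 0) := by
    have h1 : Tendsto (fun z => ℓ z - (bigU k z)⁻¹) 𝓕 (𝓝 0) := by
      refine hℓO.trans_tendsto ?_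
      have := hw.norm.rpow_const (p := 2) (Or.inr (by norm_num))
      simpa only [norm_zero, Real.zero_rpow two_ne_zero] using this
    simpa using h1.add hw
  have hne : ∀ᶠ z in 𝓕, (1 - (bigU k z)⁻¹ / ((k : ℂ) * d)) ≠ 0 := by
    have : Tendsto (fun z => 1 - (bigU k z)⁻¹ / ((k : ℂ) * d)) 𝓕 (𝓝 (1 - 0 / ((k : ℂ) * d))) :=
      (hw.div_const _).const_sub 1
    exact this.eventually_ne (by simp)
  have hU : ∀ᶠ z in 𝓕, bigU k (F z) = bigU k z * Complex.exp (ℓ z) := by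
    filter_upwards [hFL, hne, eventually_bigU_ne_zero] with z hz h1 hU0
    have hprod : ∏ j, F z j = (∏ j, z j) * (1 - (bigU k z)⁻¹ / ((k : ℂ) * d)) ^ d
        * Complex.exp (∑ j, L z j) := by
      rw [Complex.exp_sum]
      simp only [hz, Finset.prod_mul_distrib, hF.prod_lam, Finset.prod_const, Finset.card_univ,
        Fintype.card_fin, one_mul]
    have hexp : Complex.exp (ℓ z) =
        (((1 - (bigU k z)⁻¹ / ((k : ℂ) * d)) ^ d * Complex.exp (∑ j, L z j)) ^ k)⁻¹ := by
      simp only [hℓ, he]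
      rw [mul_pow, ← Complex.exp_nat_mul, mul_inv, ← Complex.exp_neg, ← pow_mul, Complex.exp_add]
      congr 1
      · rw [neg_mul, Complex.exp_neg]
        congr 1
        rw [← Complex.exp_log h1, ← Complex.exp_nat_mul, Complex.log_exp]
        · push_cast
          ring_nf
        · exact Complex.neg_pi_lt_log_im _
        · exact Complex.log_im_le_pi _
      · rw [neg_mul]
    rw [hexp]
    simp only [bigU] at *
    rw [hprod]
    rw [mul_assoc, mul_pow, mul_inv]
  have hlog : ∀ᶠ z in 𝓕, Complex.log (bigU k (F z)) = Complex.log (bigU k z) + ℓ z := by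
    have him : ∀ᶠ z in 𝓕, |(ℓ z).im| < Real.pi / 2 := by
      have h1 : Tendsto (fun z => |(ℓ z).im|) 𝓕 (𝓝 |(0 : ℂ).im|) :=
        ((Complex.continuous_im.tendsto 0).comp hℓ0).abs
      exact h1.eventually (eventually_lt_nhds (by simp [Real.pi_pos]))
    filter_upwards [hU, him, eventually_mem_chartDomain] with z h1 h2 hz
    have hU0 := bigU_ne_zero_of_mem zero_le_one hz
    have h3 : |(bigU k z).arg| < Real.pi / 2 :=
      Complex.abs_arg_lt_pi_div_two_iff.mpr (Or.inl (bigU_re_pos_of_mem zero_le_one hz))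
    rw [abs_lt] at h2 h3
    rw [h1]
    conv_lhs => rw [← Complex.exp_log hU0, ← Complex.exp_add]
    rw [Complex.log_exp]
    · rw [Complex.add_im, Complex.log_im]; linarith
    · rw [Complex.add_im, Complex.log_im]; linarith
  refine ⟨min γ 3 - 1, by linarith [lt_min hγ2 (by norm_num : (2 : ℝ) < 3)], ℓ, s, hU, hlog, ?_,
    ?_, hsO, ?_, hℓO⟩
  · filter_upwards [hlog, hFL, hne] with z h1 h2 h3 j
    rw [tcoord, tcoord, h1, h2 j]
    have hℓm : ℓ z / ((k : ℂ) * d) =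
        -Complex.log (1 - (bigU k z)⁻¹ / ((k : ℂ) * d)) - (∑ i, L z i) / d := by
      simp only [hℓ, he]
      generalize Complex.log (1 - (bigU k z)⁻¹ / ((k : ℂ) * d)) = y
      field_simp
      ring
    rw [add_div, hℓm, Complex.exp_add, Complex.exp_sub, Complex.exp_neg, Complex.exp_log h3]
    simp only [hs]
    rw [Complex.exp_sub]
    generalize 1 - (bigU k z)⁻¹ / ((k : ℂ) * d) = y at *
    generalize Complex.exp (Complex.log (bigU k z) / ((k : ℂ) * d)) = y'
    field_simp
  · intro z
    simp only [hs, Finset.sum_sub_distrib, Finset.sum_const, Finset.card_univ, Fintype.card_fin,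
      nsmul_eq_mul]
    field_simp
    ring
  · simpa only [inv_inv] using hstep

/-- The cone is entered by a step of size close to one, and the bounds `|t_j| < |U| ^ δ` persist
because `δ log |U|` grows by about `δ Re (1 / U)`, which dominates the errors of order `|U| ^ (-p)`
in `log |t_j|`. -/
theorem eventually_mapsTo (hF : IsTangentToNormalForm k lam F l β κ ω) :
    ∀ᶠ z in basinAtInfty d k κ ((1 / d - β) / k) ω,
      F z ∈ chartDomain d k 1 κ ((1 / d - β) / k) ω ∧
      (bigU k z).re + 1 / 2 ≤ (bigU k (F z)).re := by
  have hk : (0 : ℝ) < k := by exact_mod_cast hF.k_pos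
  obtain ⟨p, hp, ℓ, s, hU, -, ht, hs0, hsO, hstep, hℓO⟩ :=
    hF.exists_step_asymptotics rfl
  set δ : ℝ := (1 / d - β) / k with hδ
  have hδ0 : 0 < δ := div_pos (by linarith [hF.beta_lt]) hk
  set 𝓕 := basinAtInfty d k κ δ ω with h𝓕
  have hw : Tendsto (fun z => (bigU k z)⁻¹) 𝓕 (𝓝 0) := tendsto_inv_bigU
  have hpow0 : ∀ {a : ℝ}, 0 < a → Tendsto (fun z => ‖(bigU k z)⁻¹‖ ^ a) 𝓕 (𝓝 0) := by
    intro a ha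
    have := hw.norm.rpow_const (p := a) (Or.inr ha.le)
    simpa only [norm_zero, Real.zero_rpow ha.ne'] using this
  have hlittle : ∀ {a : ℝ}, 1 < a →
      (fun z => ‖(bigU k z)⁻¹‖ ^ a) =o[𝓕] fun z => ‖(bigU k z)⁻¹‖ := by
    intro a ha
    have h1 : (fun z => ‖(bigU k z)⁻¹‖ ^ (a - 1) * ‖(bigU k z)⁻¹‖) =o[𝓕]
        fun z => 1 * ‖(bigU k z)⁻¹‖ :=
      ((isLittleO_one_iff ℝ).mpr (hpow0 (by linarith))).mul_isBigO (isBigO_refl _ _)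
    refine h1.congr' ?_ (Eventually.of_forall fun z => one_mul _)
    filter_upwards [eventually_bigU_ne_zero] with z hz
    have hn : 0 < ‖(bigU k z)⁻¹‖ := norm_pos_iff.mpr (inv_ne_zero hz)
    rw [Real.rpow_sub hn, Real.rpow_one, div_mul_cancel₀ _ hn.ne']
  have hℓ0 : Tendsto ℓ 𝓕 (𝓝 0) := by
    have h1 : Tendsto (fun z => ℓ z - (bigU k z)⁻¹) 𝓕 (𝓝 0) :=
      hℓO.trans_tendsto (hpow0 (by norm_num))
    simpa using h1.add hw
  have hdiff : Tendsto (fun z => bigU k (F z) - bigU k z) 𝓕 (𝓝 1) := by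
    have h1 := hstep.trans_tendsto (hpow0 (by linarith))
    have h2 := (h1.add_const 1).sub (hℓ0.const_mul (-(1 / 2) * (1 + 1 / ((k : ℂ) * d))))
    rw [zero_add, mul_zero, sub_zero] at h2
    refine h2.congr' ?_
    filter_upwards [hU] with z hz
    rw [hz]
    ring
  -- small enough that errors of size `ε |U|⁻¹` are absorbed by `δ Re (1 / U)` on the cone
  set ε : ℝ := δ / (1 + κ) / (1 + δ) with hε
  have hκ := hF.kappa_pos
  have hε0 : 0 < ε := by positivity
  have hb1 : ∀ᶠ z in 𝓕, ∀ j, ‖s z j‖ ≤ ε * ‖(bigU k z)⁻¹‖ := by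
    rw [eventually_all]
    intro j
    have := ((hsO j).trans_isLittleO (hlittle hp)).def hε0
    exact this.mono fun z hz => by simpa only [norm_norm] using hz
  have hb2 : ∀ᶠ z in 𝓕, ‖ℓ z - (bigU k z)⁻¹‖ ≤ ε * ‖(bigU k z)⁻¹‖ := by
    have := (hℓO.trans_isLittleO (hlittle one_lt_two)).def hε0
    exact this.mono fun z hz => by simpa only [norm_norm] using hz
  filter_upwards [hU, ht, hdiff.eventually (eventually_nhds_one_mem_cone hF.kappa_pos), hb1, hb2, eventually_mem_chartDomain]
    with z hU ht hx hb1 hb2 hz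
  have hre := bigU_re_pos_of_mem zero_le_one hz
  have hU0 := bigU_ne_zero_of_mem zero_le_one hz
  have hn : 0 < ‖bigU k z‖ := norm_pos_iff.mpr hU0
  have hx1 : (bigU k (F z)).re = (bigU k z).re + (bigU k (F z) - bigU k z).re := by simp
  have hx2 : (bigU k (F z)).im = (bigU k z).im + (bigU k (F z) - bigU k z).im := by simp
  refine ⟨⟨?_, ?_, ?_, fun j => ?_⟩, ?_⟩
  · rw [hx1]; linarith [hx.1, hz.1]
  · rw [hx1, hx2, mul_add]
    exact (abs_add_le _ _).trans_lt (add_lt_add hz.2.1 hx.2)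
  · simp only [ht, Finset.prod_mul_distrib, hF.prod_lam, ← Complex.exp_sum, hs0, hz.2.2.1]
    simp
  · rw [ht j, hU, norm_mul, norm_mul, hF.norm_lam, one_mul, norm_mul, Complex.norm_exp,
      Complex.norm_exp, Real.mul_rpow (norm_nonneg _) (Real.exp_pos _).le, ← Real.exp_mul]
    have h1 : (s z j).re ≤ (ℓ z).re * δ := by
      have h2 : (s z j).re ≤ ε * ‖(bigU k z)⁻¹‖ := (Complex.re_le_norm _).trans (hb1 j)
      have h3 : ‖(bigU k z)⁻¹‖ / (1 + κ) ≤ ((bigU k z)⁻¹).re := by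
        rw [Complex.inv_re, Complex.normSq_eq_norm_sq, norm_inv, div_le_div_iff₀ (by positivity)
          (by positivity)]
        have h4 := norm_bigU_le_of_mem zero_le_one hz
        calc ‖bigU k z‖⁻¹ * ‖bigU k z‖ ^ 2 = ‖bigU k z‖ := by field_simp
          _ ≤ (bigU k z).re * (1 + κ) := by linarith
      have h4 : ((bigU k z)⁻¹).re - ε * ‖(bigU k z)⁻¹‖ ≤ (ℓ z).re := by
        have h5 := (Complex.abs_re_le_norm (ℓ z - (bigU k z)⁻¹)).trans hb2
        rw [Complex.sub_re, abs_le] at h5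
        linarith [h5.1]
      have h5 : ε * ‖(bigU k z)⁻¹‖ = (‖(bigU k z)⁻¹‖ / (1 + κ) - ε * ‖(bigU k z)⁻¹‖) * δ := by
        rw [hε]; field_simp; ring
      calc (s z j).re ≤ ε * ‖(bigU k z)⁻¹‖ := h2
        _ = (‖(bigU k z)⁻¹‖ / (1 + κ) - ε * ‖(bigU k z)⁻¹‖) * δ := h5
        _ ≤ (ℓ z).re * δ := mul_le_mul_of_nonneg_right (by linarith) hδ0.le
    exact mul_lt_mul_of_lt_of_le_of_pos_of_nonneg (hz.2.2.2 j) (Real.exp_le_exp.mpr h1)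
      (Real.exp_pos _) (by positivity)
  · rw [hx1]; linarith [hx.1]

end IsTangentToNormalForm

end Steps

/-! ### Convergence of the Fatou coordinates -/

section Limits

/-- Summation of errors of order `(x + n / 2) ^ (-p)`, with a bound for the distance to the limit
that is uniform in the sequence and decays in the starting point `x`. -/
theorem exists_limit_of_step_le {p C : ℝ} (hp : 1 < p) (hC : 0 ≤ C) :
    ∃ K : ℝ, 0 ≤ K ∧ ∀ (X : ℕ → ℂ) (x : ℝ), 1 ≤ x →
      (∀ n : ℕ, ‖X (n + 1) - X n‖ ≤ C * (x + n / 2) ^ (-p)) →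
      ∃ L, Tendsto X atTop (𝓝 L) ∧ ∀ n : ℕ, ‖X n - L‖ ≤ K * (x + n / 2) ^ (-((p - 1) / 2)) := by
  have hsum : Summable fun m : ℕ => (1 + (m : ℝ) / 2) ^ (-((p + 1) / 2)) := by
    have h1 : Summable fun m : ℕ => ((m : ℝ) / 2) ^ (-((p + 1) / 2)) := by
      have := (Real.summable_nat_rpow (p := -((p + 1) / 2)).mpr (by linarith)).mul_right
        ((1 / 2 : ℝ) ^ (-((p + 1) / 2)))
      refine this.congr fun m => ?_
      rw [← Real.mul_rpow (by positivity) (by positivity)]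
      ring_nf
    refine (summable_nat_add_iff 1).mp ?_
    refine Summable.of_nonneg_of_le (fun m => by positivity) (fun m => ?_)
      ((summable_nat_add_iff 1).mpr h1)
    exact Real.rpow_le_rpow_of_nonpos (by positivity) (by linarith) (by linarith)
  set T := ∑' m : ℕ, (1 + (m : ℝ) / 2) ^ (-((p + 1) / 2)) with hT
  have hT0 : 0 ≤ T := tsum_nonneg fun m => by positivity
  have hmain : ∀ (X : ℕ → ℂ) (x : ℝ), 1 ≤ x →
      (∀ n : ℕ, ‖X (n + 1) - X n‖ ≤ C * (x + n / 2) ^ (-p)) →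
      ∃ L, Tendsto X atTop (𝓝 L) ∧ ‖X 0 - L‖ ≤ C * T * x ^ (-((p - 1) / 2)) := by
    intro X x hx hX
    have hstep : ∀ n : ℕ, dist (X n) (X n.succ) ≤
        C * x ^ (-((p - 1) / 2)) * (1 + (n : ℝ) / 2) ^ (-((p + 1) / 2)) := by
      intro n
      rw [dist_comm, dist_eq_norm]
      refine (hX n).trans ?_
      have h0 : (0 : ℝ) ≤ (n : ℝ) / 2 := by positivity
      have hpos : 0 < x + (n : ℝ) / 2 := by linarith
      have h1 : -p = -((p - 1) / 2) + -((p + 1) / 2) := by ring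
      rw [h1, Real.rpow_add hpos, mul_assoc]
      refine mul_le_mul_of_nonneg_left (mul_le_mul ?_ ?_ (by positivity) (by positivity)) hC
      · exact Real.rpow_le_rpow_of_nonpos (by linarith) (by linarith) (by linarith)
      · exact Real.rpow_le_rpow_of_nonpos (by linarith) (by linarith) (by linarith)
    -- the exponent `-p` was split into a summable part and a part decaying in `x`
    have hs := hsum.mul_left (C * x ^ (-((p - 1) / 2)))
    obtain ⟨L, hL⟩ := cauchySeq_tendsto_of_complete (cauchySeq_of_dist_le_of_summable _ hstep hs)
    refine ⟨L, hL, ?_⟩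
    have := dist_le_tsum_of_dist_le_of_tendsto₀ _ hstep hs hL
    rw [tsum_mul_left, dist_eq_norm] at this
    exact this.trans (le_of_eq (by ring))
  refine ⟨C * T, by positivity, fun X x hx hX => ?_⟩
  obtain ⟨L, hL, -⟩ := hmain X x hx hX
  refine ⟨L, hL, fun n => ?_⟩
  obtain ⟨L', hL', hb⟩ := hmain (fun m => X (m + n)) (x + n / 2)
    (by have : (0 : ℝ) ≤ (n : ℝ) / 2 := by positivity
        linarith) (fun m => by
      have := hX (m + n)
      rw [show m + n + 1 = m + 1 + n by ring] at this
      refine this.trans (le_of_eq ?_)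
      push_cast
      ring_nf)
  have : L = L' := tendsto_nhds_unique ((tendsto_add_atTop_iff_nat n).mpr hL) hL'
  simpa [this] using hb

end Limits

/-- The sequence `λ_j^{-n} t_j(F^n z)`, whose limit extends `τ_j` to the global basin. -/
noncomputable def tauSeq {d : ℕ} (k : ℕ) (lam : Fin d → ℂ) (F : (Fin d → ℂ) → (Fin d → ℂ))
    (j : Fin d) (n : ℕ) (z : Fin d → ℂ) : ℂ :=
  (lam j ^ n)⁻¹ * tcoord k (F^[n] z) j

/-- The limit of `λ_j^{-n} t_j(F^n z)`. -/
noncomputable def tauLim {d : ℕ} (k : ℕ) (lam : Fin d → ℂ) (F : (Fin d → ℂ) → (Fin d → ℂ))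
    (j : Fin d) (z : Fin d → ℂ) : ℂ :=
  limUnder atTop (fun n => tauSeq k lam F j n z)

/-- A forward invariant open set on which the limits defining the coordinates `ψ` and `τ_j`
converge, at a rate that depends on the real part of `U` only. -/
structure IsFatouDomain {d : ℕ} (k : ℕ) (lam : Fin d → ℂ) (F : (Fin d → ℂ) → (Fin d → ℂ))
    (c : ℂ) (D : Set (Fin d → ℂ)) (K a : ℝ) : Prop where
  isOpen : IsOpen D
  rate_pos : 0 < a
  bound_nonneg : 0 ≤ K
  mapsTo : Set.MapsTo F D D
  one_lt_re : ∀ z ∈ D, 1 < (bigU k z).re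
  re_add_le : ∀ z ∈ D, ∀ n : ℕ, (bigU k z).re + n / 2 ≤ (bigU k (F^[n] z)).re
  tendsto_psi : ∀ z ∈ D, Tendsto (fun n => psiSeq k c F n z) atTop (𝓝 (psi k c F z))
  psi_bound : ∀ z ∈ D, ∀ n : ℕ, ‖psiSeq k c F n z - psi k c F z‖ ≤
    K * ((bigU k z).re + n / 2) ^ (-a)
  tau_bound : ∀ z ∈ D, ∀ j, ∃ r : ℕ → ℂ, ∀ n : ℕ,
    ‖r n‖ ≤ K * ((bigU k z).re + n / 2) ^ (-a) ∧
      tauSeq k lam F j n z = tauLim k lam F j z * Complex.exp (r n)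

section Existence

variable {d k : ℕ} [NeZero d] {lam : Fin d → ℂ} {F : (Fin d → ℂ) → (Fin d → ℂ)}
  {l : ℕ} {β κ : ℝ} {ω : ℂ}

namespace IsTangentToNormalForm

/-- The asymptotics of one step, as inequalities on a set `{Re U > R}` of the chart. -/
theorem exists_step_bounds (hF : IsTangentToNormalForm k lam F l β κ ω) {c : ℂ}
    (hc : c = -(1 / 2) * (1 + 1 / ((k : ℂ) * d))) :
    ∃ p : ℝ, 1 < p ∧ ∃ C : ℝ, 0 ≤ C ∧ ∃ s : (Fin d → ℂ) → Fin d → ℂ, ∃ R : ℝ, 1 ≤ R ∧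
      ∀ z ∈ chartDomain d k R κ ((1 / d - β) / k) ω,
        F z ∈ chartDomain d k 1 κ ((1 / d - β) / k) ω ∧
        (bigU k z).re + 1 / 2 ≤ (bigU k (F z)).re ∧
        ‖bigU k (F z) + c * Complex.log (bigU k (F z))
          - (bigU k z + c * Complex.log (bigU k z)) - 1‖ ≤ C * (bigU k z).re ^ (-p) ∧
        ∀ j, tcoord k (F z) j = lam j * tcoord k z j * Complex.exp (s z j) ∧
          ‖s z j‖ ≤ C * (bigU k z).re ^ (-p) := by
  obtain ⟨p, hp, ℓ, s, hU, hlog, ht, -, hsO, hstep, -⟩ := hF.exists_step_asymptotics hc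
  obtain ⟨C₀, hC₀, hb₀⟩ := hstep.exists_pos
  choose C₁ hC₁ hb₁ using fun j => (hsO j).exists_pos
  have hb₁' := eventually_all.mpr fun j => (hb₁ j).bound
  set C := max C₀ (∑ j, C₁ j) with hC
  obtain ⟨R, hR1, hR⟩ := exists_forall_of_eventually_basinAtInfty
    (hF.eventually_mapsTo.and (hU.and (hlog.and (ht.and (hb₀.bound.and hb₁')))))
  refine ⟨p, hp, C, hC₀.le.trans (le_max_left _ _), s, R, hR1, fun z hz => ?_⟩
  obtain ⟨⟨h1, h2⟩, h3, h4, h5, h6, h7⟩ := hR z hz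
  have hre : 0 < (bigU k z).re := bigU_re_pos_of_mem (by linarith) hz
  have hpow : ‖(bigU k z)⁻¹‖ ^ p ≤ (bigU k z).re ^ (-p) := by
    rw [norm_inv, Real.inv_rpow (norm_nonneg _), ← Real.rpow_neg (norm_nonneg _)]
    exact Real.rpow_le_rpow_of_nonpos hre (Complex.re_le_norm _) (by linarith)
  have hbd : ∀ C', C' ≤ C → 0 ≤ C' → C' * ‖‖(bigU k z)⁻¹‖ ^ p‖ ≤ C * (bigU k z).re ^ (-p) := by
    intro C' hC' h0
    rw [Real.norm_of_nonneg (by positivity)]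
    exact mul_le_mul hC' hpow (by positivity) (h0.trans hC')
  refine ⟨h1, h2, ?_, fun j => ⟨h5 j, (h7 j).trans (hbd _ ?_ (hC₁ j).le)⟩⟩
  · refine le_trans (le_of_eq ?_) (h6.trans (hbd _ (le_max_left _ _) hC₀.le))
    rw [h4, h3]
    congr 1
    ring
  · exact (Finset.single_le_sum (fun i _ => (hC₁ i).le) (Finset.mem_univ j)).trans
      (le_max_right _ _)

/-- All basins of large radius are Fatou domains, with common constants. -/
theorem exists_isFatouDomain (hF : IsTangentToNormalForm k lam F l β κ ω)
    (hopen : ∀ R : ℝ, 0 < R → IsOpen (chartDomain d k R κ ((1 / d - β) / k) ω)) {c : ℂ}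
    (hc : c = -(1 / 2) * (1 + 1 / ((k : ℂ) * d))) :
    ∃ K a R₁ : ℝ, 1 ≤ R₁ ∧ ∀ R, R₁ ≤ R →
      IsFatouDomain k lam F c (chartDomain d k R κ ((1 / d - β) / k) ω) K a := by
  obtain ⟨p, hp, C, hC, s, R₁, hR₁, hb⟩ := hF.exists_step_bounds hc
  obtain ⟨K, hK, hlim⟩ := exists_limit_of_step_le hp hC
  refine ⟨K, (p - 1) / 2, R₁, hR₁, fun R hR => ?_⟩
  set D := chartDomain d k R κ ((1 / d - β) / k) ω with hD
  have hsub : D ⊆ chartDomain d k R₁ κ ((1 / d - β) / k) ω := fun z hz =>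
    ⟨hR.trans_lt hz.1, hz.2⟩
  have hmaps : Set.MapsTo F D D := fun z hz => by
    obtain ⟨h1, h2, -⟩ := hb z (hsub hz)
    exact ⟨by linarith [hz.1], h1.2⟩
  have hmem : ∀ z ∈ D, ∀ n, F^[n] z ∈ D := fun z hz n => hmaps.iterate n hz
  have hre : ∀ z ∈ D, ∀ n : ℕ, (bigU k z).re + n / 2 ≤ (bigU k (F^[n] z)).re := by
    intro z hz n
    induction n with
    | zero => simp
    | succ n ih =>
      rw [Function.iterate_succ_apply']
      have := (hb _ (hsub (hmem z hz n))).2.1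
      push_cast
      linarith
  have hrpos : ∀ z ∈ D, 1 < (bigU k z).re := fun z hz => by linarith [hz.1]
  have hpow : ∀ z ∈ D, ∀ n : ℕ, C * (bigU k (F^[n] z)).re ^ (-p) ≤
      C * ((bigU k z).re + n / 2) ^ (-p) := by
    intro z hz n
    have := hrpos z hz
    exact mul_le_mul_of_nonneg_left (Real.rpow_le_rpow_of_nonpos (by positivity) (hre z hz n)
      (by linarith)) hC
  have hpsi : ∀ z ∈ D, ∃ L, Tendsto (fun n => psiSeq k c F n z) atTop (𝓝 L) ∧
      ∀ n : ℕ, ‖psiSeq k c F n z - L‖ ≤ K * ((bigU k z).re + n / 2) ^ (-((p - 1) / 2)) := by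
    intro z hz
    refine hlim _ _ (hrpos z hz).le fun n => le_trans (le_of_eq ?_)
      ((hb _ (hsub (hmem z hz n))).2.2.1.trans (hpow z hz n))
    simp only [psiSeq, Function.iterate_succ_apply']
    congr 1
    push_cast
    ring
  refine ⟨hopen R (by linarith), by linarith, hK, hmaps, hrpos, hre, ?_, ?_, ?_⟩
  · intro z hz
    obtain ⟨L, hL, -⟩ := hpsi z hz
    rwa [psi, hL.limUnder_eq]
  · intro z hz
    obtain ⟨L, hL, h⟩ := hpsi z hz
    rwa [psi, hL.limUnder_eq]
  · intro z hz j
    obtain ⟨S, hS, hSb⟩ := hlim (fun n => ∑ m ∈ Finset.range n, s (F^[m] z) j) _ (hrpos z hz).le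
      (fun n => by
        rw [Finset.sum_range_succ, add_sub_cancel_left]
        exact ((hb _ (hsub (hmem z hz n))).2.2.2 j).2.trans (hpow z hz n))
    have hseq : ∀ n, tauSeq k lam F j n z =
        tcoord k z j * Complex.exp (∑ m ∈ Finset.range n, s (F^[m] z) j) := by
      intro n
      induction n with
      | zero => simp [tauSeq]
      | succ n ih =>
        rw [Finset.sum_range_succ, Complex.exp_add, ← mul_assoc, ← ih, tauSeq, tauSeq,
          Function.iterate_succ_apply', ((hb _ (hsub (hmem z hz n))).2.2.2 j).1]
        have := hF.lam_ne_zero j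
        field_simp
        ring
    have hL : tauLim k lam F j z = tcoord k z j * Complex.exp S := by
      refine Tendsto.limUnder_eq ?_
      simp only [hseq]
      exact ((Complex.continuous_exp.tendsto S).comp hS).const_mul _
    refine ⟨fun n => ∑ m ∈ Finset.range n, s (F^[m] z) j - S, fun n => ⟨hSb n, ?_⟩⟩
    rw [hL, hseq, mul_assoc, ← Complex.exp_add]
    congr 2
    ring

end IsTangentToNormalForm

end Existence

/-! ### Uniform convergence and holomorphy of the chart -/

section General

/-- A locally bounded factor preserves uniform convergence to `1` locally. -/
theorem tendstoLocallyUniformlyOn_mul_of_tendstoUniformlyOn_one {X : Type*} [TopologicalSpace X]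
    {s : Set X} {f : ℕ → X → ℂ} {g : X → ℂ} {b : X → ℝ} (hf : TendstoUniformlyOn f 1 atTop s)
    (hb : ContinuousOn b s) (hgb : ∀ x ∈ s, ‖g x‖ ≤ b x) :
    TendstoLocallyUniformlyOn (fun n x => g x * f n x) g atTop s := by
  rw [Metric.tendstoLocallyUniformlyOn_iff]
  intro ε hε x hx
  have h1 : ∀ᶠ y in 𝓝[s] x, b y < b x + 1 := (hb x hx).eventually (gt_mem_nhds (by linarith))
  have hbx : 0 ≤ b x := (norm_nonneg _).trans (hgb x hx)
  refine ⟨{y | b y < b x + 1} ∩ s, inter_mem h1 self_mem_nhdsWithin, ?_⟩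
  have h2 := Metric.tendstoUniformlyOn_iff.mp hf (ε / (b x + 1)) (by positivity)
  filter_upwards [h2] with n hn y hy
  have h3 := hn y hy.2
  rw [dist_comm, dist_eq_norm] at h3 ⊢
  have h4 : g y * f n y - g y = g y * (f n y - (1 : X → ℂ) y) := by
    simp only [Pi.one_apply]; ring
  rw [h4, norm_mul]
  rw [lt_div_iff₀ (by positivity)] at h3
  have h5 : ‖g y‖ ≤ b x + 1 := (hgb y hy.2).trans hy.1.le
  calc ‖g y‖ * ‖f n y - (1 : X → ℂ) y‖ ≤ (b x + 1) * ‖f n y - (1 : X → ℂ) y‖ :=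
        mul_le_mul_of_nonneg_right h5 (norm_nonneg _)
    _ < ε := by linarith

theorem tendsto_mul_rpow_neg_atTop (K : ℝ) {a : ℝ} (ha : 0 < a) :
    Tendsto (fun n : ℕ => K * (1 + (n : ℝ) / 2) ^ (-a)) atTop (𝓝 0) := by
  have h1 : Tendsto (fun n : ℕ => 1 + (n : ℝ) / 2) atTop atTop :=
    tendsto_atTop_add_const_left _ _ (tendsto_natCast_atTop_atTop.atTop_div_const (by norm_num))
  simpa using ((tendsto_rpow_neg_atTop ha).comp h1).const_mul K

variable {d k : ℕ} {z : Fin d → ℂ}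

theorem differentiableAt_bigU (hz : bigU k z ≠ 0) : DifferentiableAt ℂ (bigU (d := d) k) z := by
  have h1 : DifferentiableAt ℂ (fun z : Fin d → ℂ => ∏ i, z i) z := by fun_prop
  refine (h1.pow k).inv ?_
  intro h0
  exact hz (inv_eq_zero.mpr h0)

theorem differentiableAt_log_bigU (hz : 0 < (bigU k z).re) :
    DifferentiableAt ℂ (fun z : Fin d → ℂ => Complex.log (bigU k z)) z :=
  (differentiableAt_bigU (fun h => by simp [h] at hz)).clog (Or.inl hz)

theorem differentiableAt_tcoord (hz : 0 < (bigU k z).re) (j : Fin d) :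
    DifferentiableAt ℂ (fun z : Fin d → ℂ => tcoord k z j) z := by
  unfold tcoord
  have h1 : DifferentiableAt ℂ
      (fun z : Fin d → ℂ => Complex.log (bigU k z) / ((k : ℂ) * d)) z := by
    simp only [div_eq_mul_inv]
    exact (differentiableAt_log_bigU hz).mul_const _
  exact (differentiableAt_apply j z).mul h1.cexp

theorem tcoord_ne_zero (hk : 0 < k) (hz : bigU k z ≠ 0) (j : Fin d) : tcoord k z j ≠ 0 :=
  mul_ne_zero (apply_ne_zero_of_bigU_ne_zero hk hz j) (Complex.exp_ne_zero _)

end General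

/-! ### The coordinates on the global basin -/

section GlobalBasin

variable {d k : ℕ} {lam : Fin d → ℂ} {F : (Fin d → ℂ) → (Fin d → ℂ)}

theorem psiSeq_add (c : ℂ) (n N : ℕ) (z : Fin d → ℂ) :
    psiSeq k c F (n + N) z = psiSeq k c F n (F^[N] z) - N := by
  simp only [psiSeq, Function.iterate_add_apply]
  push_cast
  ring

theorem tauSeq_add (j : Fin d) (n N : ℕ) (z : Fin d → ℂ) :
    tauSeq k lam F j (n + N) z = (lam j ^ N)⁻¹ * tauSeq k lam F j n (F^[N] z) := by
  simp only [tauSeq, Function.iterate_add_apply, pow_add, mul_inv]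
  ring

theorem mem_globalBasin {B : Set (Fin d → ℂ)} {z : Fin d → ℂ} :
    z ∈ globalBasin F B ↔ ∃ n : ℕ, F^[n] z ∈ B := by
  simp [globalBasin]

namespace IsFatouDomain

variable {c : ℂ} {D : Set (Fin d → ℂ)} {K a : ℝ}

theorem bigU_ne_zero (hD : IsFatouDomain k lam F c D K a) {z : Fin d → ℂ} (hz : z ∈ D) :
    bigU k z ≠ 0 := fun h => by
  have := hD.one_lt_re z hz
  simp only [h, Complex.zero_re] at this
  linarith

theorem re_pos (hD : IsFatouDomain k lam F c D K a) {z : Fin d → ℂ} (hz : z ∈ D) :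
    0 < (bigU k z).re := zero_lt_one.trans (hD.one_lt_re z hz)

theorem mul_rpow_le (hD : IsFatouDomain k lam F c D K a) {z : Fin d → ℂ} (hz : z ∈ D) (n : ℕ) :
    K * ((bigU k z).re + n / 2) ^ (-a) ≤ K * (1 + (n : ℝ) / 2) ^ (-a) := by
  have := hD.one_lt_re z hz
  exact mul_le_mul_of_nonneg_left (Real.rpow_le_rpow_of_nonpos (by positivity) (by linarith)
    (by linarith [hD.rate_pos])) hD.bound_nonneg

theorem tendsto_tau (hD : IsFatouDomain k lam F c D K a) {z : Fin d → ℂ} (hz : z ∈ D)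
    (j : Fin d) :
    Tendsto (fun n => tauSeq k lam F j n z) atTop (𝓝 (tauLim k lam F j z)) := by
  obtain ⟨r, hr⟩ := hD.tau_bound z hz j
  have h0 : Tendsto r atTop (𝓝 0) := by
    rw [tendsto_zero_iff_norm_tendsto_zero]
    exact squeeze_zero (fun _ => norm_nonneg _) (fun n => (hr n).1.trans (hD.mul_rpow_le hz n))
      (tendsto_mul_rpow_neg_atTop K hD.rate_pos)
  simp only [fun n => (hr n).2]
  have := (((Complex.continuous_exp.tendsto 0).comp h0).const_mul (tauLim k lam F j z))
  simpa using this

variable {z : Fin d → ℂ}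

theorem tendsto_psi_of_iterate_mem (hD : IsFatouDomain k lam F c D K a) {N : ℕ}
    (hz : F^[N] z ∈ D) : Tendsto (fun n => psiSeq k c F n z) atTop (𝓝 (psi k c F (F^[N] z) - N)) := by
  refine (tendsto_add_atTop_iff_nat N).mp ?_
  simp only [psiSeq_add]
  exact (hD.tendsto_psi _ hz).sub_const _

theorem psi_eq_of_iterate_mem (hD : IsFatouDomain k lam F c D K a) {N : ℕ}
    (hz : F^[N] z ∈ D) : psi k c F z = psi k c F (F^[N] z) - N :=
  (hD.tendsto_psi_of_iterate_mem hz).limUnder_eq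

theorem tendsto_tau_of_iterate_mem (hD : IsFatouDomain k lam F c D K a) {N : ℕ}
    (hz : F^[N] z ∈ D) (j : Fin d) : Tendsto (fun n => tauSeq k lam F j n z) atTop
      (𝓝 ((lam j ^ N)⁻¹ * tauLim k lam F j (F^[N] z))) := by
  refine (tendsto_add_atTop_iff_nat N).mp ?_
  simp only [tauSeq_add]
  exact (hD.tendsto_tau hz j).const_mul _

theorem tauLim_eq_of_iterate_mem (hD : IsFatouDomain k lam F c D K a) {N : ℕ}
    (hz : F^[N] z ∈ D) (j : Fin d) :
    tauLim k lam F j z = (lam j ^ N)⁻¹ * tauLim k lam F j (F^[N] z) :=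
  (hD.tendsto_tau_of_iterate_mem hz j).limUnder_eq

theorem iterate_mem (hD : IsFatouDomain k lam F c D K a) {N n : ℕ} (hz : F^[N] z ∈ D)
    (h : N ≤ n) : F^[n] z ∈ D := by
  obtain ⟨m, rfl⟩ := Nat.exists_eq_add_of_le h
  rw [add_comm, Function.iterate_add_apply]
  exact hD.mapsTo.iterate m hz

theorem psi_map (hD : IsFatouDomain k lam F c D K a) (hz : z ∈ globalBasin F D) :
    psi k c F (F z) = psi k c F z + 1 := by
  obtain ⟨N, hN⟩ := mem_globalBasin.mp hz
  have h1 : F^[N + 1] z ∈ D := hD.iterate_mem hN (Nat.le_succ N)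
  rw [hD.psi_eq_of_iterate_mem h1, hD.psi_eq_of_iterate_mem (z := F z) (N := N)
    (by rwa [← Function.iterate_succ_apply]), ← Function.iterate_succ_apply]
  push_cast
  ring

theorem tauLim_map (hD : IsFatouDomain k lam F c D K a) (hz : z ∈ globalBasin F D) {j : Fin d}
    (hl : lam j ≠ 0) : tauLim k lam F j (F z) = lam j * tauLim k lam F j z := by
  obtain ⟨N, hN⟩ := mem_globalBasin.mp hz
  have h1 : F^[N + 1] z ∈ D := hD.iterate_mem hN (Nat.le_succ N)
  rw [hD.tauLim_eq_of_iterate_mem h1, hD.tauLim_eq_of_iterate_mem (z := F z) (N := N)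
    (by rwa [← Function.iterate_succ_apply]), ← Function.iterate_succ_apply, pow_succ]
  field_simp

theorem tauLim_ne_zero (hD : IsFatouDomain k lam F c D K a) (hk : 0 < k)
    (hz : z ∈ globalBasin F D) {j : Fin d} (hl : lam j ≠ 0) : tauLim k lam F j z ≠ 0 := by
  obtain ⟨N, hN⟩ := mem_globalBasin.mp hz
  rw [hD.tauLim_eq_of_iterate_mem hN]
  refine mul_ne_zero (inv_ne_zero (pow_ne_zero _ hl)) fun h0 => ?_
  obtain ⟨r, hr⟩ := hD.tau_bound _ hN j
  have h1 := (hr 0).2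
  rw [h0, zero_mul] at h1
  refine tcoord_ne_zero hk (hD.bigU_ne_zero hN) j ?_
  simpa [tauSeq] using h1

section Uniform

variable {A : Set (Fin d → ℂ)} {N : ℕ}

/-- The limit defining `ψ` is uniform on every set that enters `D` after a bounded time. -/
theorem tendstoUniformlyOn_psi (hD : IsFatouDomain k lam F c D K a) (hA : Set.MapsTo F^[N] A D) :
    TendstoUniformlyOn (psiSeq k c F) (psi k c F) atTop A := by
  rw [Metric.tendstoUniformlyOn_iff]
  intro ε hε
  have h1 := (tendsto_mul_rpow_neg_atTop K hD.rate_pos).eventually (gt_mem_nhds hε)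
  rw [← map_add_atTop_eq_nat N, eventually_map]
  filter_upwards [h1] with n hn z hz
  rw [dist_comm, dist_eq_norm, psiSeq_add, hD.psi_eq_of_iterate_mem (hA hz), sub_sub_sub_cancel_right]
  exact ((hD.psi_bound _ (hA hz) n).trans (hD.mul_rpow_le (hA hz) n)).trans_lt hn

theorem tendstoUniformlyOn_tauSeq_div (hD : IsFatouDomain k lam F c D K a) (hk : 0 < k)
    {j : Fin d} (hl : lam j ≠ 0) (hA : Set.MapsTo F^[N] A D) :
    TendstoUniformlyOn (fun n z => tauSeq k lam F j n z / tauLim k lam F j z) 1 atTop A := by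
  rw [Metric.tendstoUniformlyOn_iff]
  intro ε hε
  have hexp : ∀ᶠ x : ℂ in 𝓝 0, dist 1 (Complex.exp x) < ε := by
    have h1 : Tendsto (fun x : ℂ => dist 1 (Complex.exp x)) (𝓝 0) (𝓝 (dist 1 (Complex.exp 0))) :=
      (by fun_prop : Continuous fun x : ℂ => dist 1 (Complex.exp x)).tendsto 0
    exact h1.eventually (gt_mem_nhds (by simpa using hε))
  obtain ⟨r, hr, hrε⟩ := Metric.eventually_nhds_iff.mp hexp
  have h1 := (tendsto_mul_rpow_neg_atTop K hD.rate_pos).eventually (gt_mem_nhds hr)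
  rw [← map_add_atTop_eq_nat N, eventually_map]
  filter_upwards [h1] with n hn z hz
  obtain ⟨ρ, hρ⟩ := hD.tau_bound _ (hA hz) j
  have h0 : tauLim k lam F j (F^[N] z) ≠ 0 :=
    hD.tauLim_ne_zero hk (mem_globalBasin.mpr ⟨0, hA hz⟩) hl
  rw [tauSeq_add, hD.tauLim_eq_of_iterate_mem (hA hz), (hρ n).2,
    mul_div_mul_left _ _ (inv_ne_zero (pow_ne_zero _ hl)), mul_div_cancel_left₀ _ h0]
  refine hrε ?_
  rw [dist_zero_right]
  exact (((hρ n).1).trans (hD.mul_rpow_le (hA hz) n)).trans_lt hn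

theorem eventually_lt_re (hD : IsFatouDomain k lam F c D K a) (hA : Set.MapsTo F^[N] A D) (M : ℝ) :
    ∀ᶠ n in atTop, ∀ z ∈ A, M < (bigU k (F^[n] z)).re := by
  have h1 : Tendsto (fun n : ℕ => 1 + (n : ℝ) / 2) atTop atTop :=
    tendsto_atTop_add_const_left _ _ (tendsto_natCast_atTop_atTop.atTop_div_const (by norm_num))
  rw [← map_add_atTop_eq_nat N, eventually_map]
  filter_upwards [h1.eventually_ge_atTop M] with n hn z hz
  rw [Function.iterate_add_apply]
  have := hD.re_add_le _ (hA hz) n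
  linarith [hD.one_lt_re _ (hA hz)]

end Uniform

section Holomorphic

theorem isOpen_globalBasin (hD : IsFatouDomain k lam F c D K a) (hF : Continuous F) :
    IsOpen (globalBasin F D) :=
  isOpen_iUnion fun n => hD.isOpen.preimage (hF.iterate n)

theorem differentiableOn_psi_self (hD : IsFatouDomain k lam F c D K a) (hF : Differentiable ℂ F) :
    DifferentiableOn ℂ (psi k c F) D := by
  refine differentiableOn_of_tendstoLocallyUniformlyOn hD.isOpen
    (hD.tendstoUniformlyOn_psi (N := 0) (Set.mapsTo_id D)).tendstoLocallyUniformlyOn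
    fun n z hz => ?_
  have hre : 0 < (bigU k (F^[n] z)).re := hD.re_pos (hD.mapsTo.iterate n hz)
  have h0 : bigU k (F^[n] z) ≠ 0 := hD.bigU_ne_zero (hD.mapsTo.iterate n hz)
  have hFn : DifferentiableAt ℂ F^[n] z := (hF.iterate n) z
  have h1 : DifferentiableAt ℂ (fun z => bigU k (F^[n] z)) z :=
    (differentiableAt_bigU h0).comp z hFn
  have h2 : DifferentiableAt ℂ (fun z => Complex.log (bigU k (F^[n] z))) z :=
    DifferentiableAt.comp z (differentiableAt_log_bigU hre) hFn
  exact ((h1.sub_const _).add (h2.const_mul c)).differentiableWithinAt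

theorem differentiableOn_tauLim_self (hD : IsFatouDomain k lam F c D K a) (hk : 0 < k)
    (hF : Differentiable ℂ F) {j : Fin d} (hl : lam j ≠ 0) :
    DifferentiableOn ℂ (tauLim k lam F j) D := by
  have hlim : TendstoLocallyUniformlyOn (fun n z => tauSeq k lam F j n z) (tauLim k lam F j)
      atTop D := by
    have h1 := tendstoLocallyUniformlyOn_mul_of_tendstoUniformlyOn_one (g := tauLim k lam F j)
      (b := fun z => ‖tcoord k z j‖ * Real.exp (K * (1 + ((0 : ℕ) : ℝ) / 2) ^ (-a)))
      (hD.tendstoUniformlyOn_tauSeq_div (N := 0) hk hl (Set.mapsTo_id D))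
      (fun z hz => ((differentiableAt_tcoord (hD.re_pos hz) j).continuousAt.norm.mul
        continuousAt_const).continuousWithinAt) ?_
    · refine h1.congr fun n z hz => ?_
      simp only
      rw [mul_div_cancel₀]
      exact hD.tauLim_ne_zero hk (mem_globalBasin.mpr ⟨0, hz⟩) hl
    · intro z hz
      obtain ⟨r, hr⟩ := hD.tau_bound z hz j
      have h2 : tauLim k lam F j z = tcoord k z j * Complex.exp (-r 0) := by
        have := (hr 0).2
        rw [Complex.exp_neg, eq_mul_inv_iff_mul_eq₀ (Complex.exp_ne_zero _), ← this]
        simp [tauSeq]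
      rw [h2, norm_mul]
      refine mul_le_mul_of_nonneg_left ?_ (norm_nonneg _)
      rw [Complex.norm_exp]
      refine Real.exp_le_exp.mpr ((Complex.re_le_norm _).trans ?_)
      rw [norm_neg]
      exact (hr 0).1.trans (hD.mul_rpow_le hz 0)
  refine differentiableOn_of_tendstoLocallyUniformlyOn hD.isOpen hlim fun n z hz => ?_
  have hre : 0 < (bigU k (F^[n] z)).re := hD.re_pos (hD.mapsTo.iterate n hz)
  have hFn : DifferentiableAt ℂ F^[n] z := (hF.iterate n) z
  have h2 : DifferentiableAt ℂ (fun z => tcoord k (F^[n] z) j) z :=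
    DifferentiableAt.comp z (differentiableAt_tcoord hre j) hFn
  exact (h2.const_mul _).differentiableWithinAt

theorem differentiableOn_psi (hD : IsFatouDomain k lam F c D K a) (hF : Differentiable ℂ F) :
    DifferentiableOn ℂ (psi k c F) (globalBasin F D) := by
  intro z hz
  obtain ⟨N, hN⟩ := mem_globalBasin.mp hz
  have hev : ∀ᶠ y in 𝓝 z, F^[N] y ∈ D :=
    (hF.continuous.iterate N).continuousAt.eventually (hD.isOpen.mem_nhds hN)
  have h1 : DifferentiableAt ℂ (fun y => psi k c F (F^[N] y) - N) z :=
    (DifferentiableAt.comp z ((hD.differentiableOn_psi_self hF).differentiableAt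
      (hD.isOpen.mem_nhds hN)) ((hF.iterate N) z)).sub_const _
  exact (h1.congr_of_eventuallyEq
    (hev.mono fun y hy => hD.psi_eq_of_iterate_mem hy)).differentiableWithinAt

theorem differentiableOn_tauLim (hD : IsFatouDomain k lam F c D K a) (hk : 0 < k)
    (hF : Differentiable ℂ F) {j : Fin d} (hl : lam j ≠ 0) :
    DifferentiableOn ℂ (tauLim k lam F j) (globalBasin F D) := by
  intro z hz
  obtain ⟨N, hN⟩ := mem_globalBasin.mp hz
  have hev : ∀ᶠ y in 𝓝 z, F^[N] y ∈ D :=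
    (hF.continuous.iterate N).continuousAt.eventually (hD.isOpen.mem_nhds hN)
  have h1 : DifferentiableAt ℂ (fun y => (lam j ^ N)⁻¹ * tauLim k lam F j (F^[N] y)) z :=
    (DifferentiableAt.comp z ((hD.differentiableOn_tauLim_self hk hF hl).differentiableAt
      (hD.isOpen.mem_nhds hN)) ((hF.iterate N) z)).const_mul _
  exact (h1.congr_of_eventuallyEq
    (hev.mono fun y hy => hD.tauLim_eq_of_iterate_mem hy j)).differentiableWithinAt

end Holomorphic

end IsFatouDomain

end GlobalBasin

/-! ### The chart and its inverse -/

theorem tendsto_log_div_of_tendsto_norm_atTop {α : Type*} {l : Filter α} {U : α → ℂ}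
    (hU : Tendsto (fun x => ‖U x‖) l atTop) :
    Tendsto (fun x => Complex.log (U x) / U x) l (𝓝 0) := by
  rw [tendsto_zero_iff_norm_tendsto_zero]
  have h1 : Tendsto (fun t : ℝ => Real.log t / t + Real.pi / t) atTop (𝓝 0) := by
    have h2 : Tendsto (fun t : ℝ => Real.log t / t) atTop (𝓝 0) :=
      Real.isLittleO_log_id_atTop.tendsto_div_nhds_zero
    simpa using h2.add (tendsto_const_nhds.div_atTop tendsto_id)
  refine squeeze_zero' (Eventually.of_forall fun _ => norm_nonneg _) ?_ (h1.comp hU)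
  filter_upwards [hU.eventually_ge_atTop 1] with x hx
  simp only [Function.comp_apply]
  rw [norm_div, ← add_div]
  have hpos : 0 < ‖U x‖ := by linarith
  refine div_le_div_of_nonneg_right ?_ hpos.le
  refine (Complex.norm_le_abs_re_add_abs_im _).trans ?_
  rw [Complex.log_re, Complex.log_im, abs_of_nonneg (Real.log_nonneg hx)]
  linarith [Complex.abs_arg_le_pi (U x)]

/-- The inverse of the chart `z ↦ (U, t_2, …, t_d)`, with `t_1` recovered from the product of all
`t_j` being `ω`. -/
noncomputable def chartInv {d : ℕ} [NeZero d] (k : ℕ) (ω : ℂ) (x : Fin d → ℂ) : Fin d → ℂ :=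
  fun j => (if j = 0 then ω / ∏ i ∈ Finset.univ.erase 0, x i else x j) *
    Complex.exp (-(Complex.log (x 0) / (k * d)))

section Chart

variable {d k : ℕ} [NeZero d] {ω : ℂ} {x : Fin d → ℂ}

theorem prod_chartInv (hx : ∀ j, j ≠ 0 → x j ≠ 0) :
    ∏ j, chartInv k ω x j = ω * Complex.exp (-(Complex.log (x 0) / k)) := by
  have hd : (d : ℂ) ≠ 0 := NeZero.ne _
  simp only [chartInv, Finset.prod_mul_distrib, Finset.prod_const, Finset.card_univ,
    Fintype.card_fin, ← Complex.exp_nat_mul]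
  congr 1
  · rw [← Finset.mul_prod_erase _ _ (Finset.mem_univ (0 : Fin d)), if_pos rfl]
    have h1 : ∏ i ∈ Finset.univ.erase (0 : Fin d),
        (if i = 0 then ω / ∏ i ∈ Finset.univ.erase 0, x i else x i)
        = ∏ i ∈ Finset.univ.erase (0 : Fin d), x i :=
      Finset.prod_congr rfl fun i hi => if_neg (Finset.ne_of_mem_erase hi)
    rw [h1, div_mul_cancel₀]
    exact Finset.prod_ne_zero_iff.mpr fun i hi => hx i (Finset.ne_of_mem_erase hi)
  · congr 1
    field_simp

theorem bigU_chartInv (hk : 0 < k) (hω : ω ^ k = 1) (h0 : x 0 ≠ 0) (hx : ∀ j, j ≠ 0 → x j ≠ 0) :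
    bigU k (chartInv k ω x) = x 0 := by
  have hkc : (k : ℂ) ≠ 0 := by exact_mod_cast hk.ne'
  rw [bigU, prod_chartInv hx, mul_pow, hω, one_mul, ← Complex.exp_nat_mul, ← Complex.exp_neg]
  have : -((k : ℂ) * -(Complex.log (x 0) / k)) = Complex.log (x 0) := by field_simp
  rw [this, Complex.exp_log h0]

theorem tcoord_chartInv (hk : 0 < k) (hω : ω ^ k = 1) (h0 : x 0 ≠ 0)
    (hx : ∀ j, j ≠ 0 → x j ≠ 0) (j : Fin d) : tcoord k (chartInv k ω x) j =
      if j = 0 then ω / ∏ i ∈ Finset.univ.erase 0, x i else x j := by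
  rw [tcoord, bigU_chartInv hk hω h0 hx, chartInv, mul_assoc, ← Complex.exp_add]
  simp

theorem prod_tcoord_chartInv (hk : 0 < k) (hω : ω ^ k = 1) (h0 : x 0 ≠ 0)
    (hx : ∀ j, j ≠ 0 → x j ≠ 0) : ∏ j, tcoord k (chartInv k ω x) j = ω := by
  rw [prod_tcoord, bigU_chartInv hk hω h0 hx, prod_chartInv hx, mul_assoc, ← Complex.exp_add]
  simp

theorem chartInv_chart {z : Fin d → ℂ} (hk : 0 < k) (hU : bigU k z ≠ 0)
    (hz : ∏ j, tcoord k z j = ω) :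
    chartInv k ω (fun j => if j = 0 then bigU k z else tcoord k z j) = z := by
  ext j
  have h1 : (if j = 0 then ω / ∏ i ∈ Finset.univ.erase (0 : Fin d),
      (if i = 0 then bigU k z else tcoord k z i)
      else (if j = 0 then bigU k z else tcoord k z j)) = tcoord k z j := by
    split_ifs with hj
    · subst hj
      have h2 : ∏ i ∈ Finset.univ.erase (0 : Fin d),
          (if i = 0 then bigU k z else tcoord k z i)
          = ∏ i ∈ Finset.univ.erase (0 : Fin d), tcoord k z i :=
        Finset.prod_congr rfl fun i hi => if_neg (Finset.ne_of_mem_erase hi)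
      rw [h2, ← hz, ← Finset.mul_prod_erase _ _ (Finset.mem_univ (0 : Fin d)), mul_div_cancel_right₀]
      exact Finset.prod_ne_zero_iff.mpr fun i _ => tcoord_ne_zero hk hU i
    · rfl
  rw [chartInv, h1, if_pos rfl, tcoord, mul_assoc, ← Complex.exp_add]
  simp

theorem differentiableAt_chartInv (h0 : 0 < (x 0).re) (hx : ∀ j, j ≠ 0 → x j ≠ 0) :
    DifferentiableAt ℂ (chartInv k ω) x := by
  rw [differentiableAt_pi]
  intro j
  have hlog : DifferentiableAt ℂ (fun x : Fin d → ℂ => -(Complex.log (x 0) / ((k : ℂ) * d))) x := by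
    simp only [div_eq_mul_inv]
    exact (((differentiableAt_apply (0 : Fin d) x).clog (Or.inl h0)).mul_const _).neg
  refine DifferentiableAt.mul ?_ hlog.cexp
  split_ifs with hj
  · have hprod : DifferentiableAt ℂ
        (fun x : Fin d → ℂ => ∏ i ∈ Finset.univ.erase (0 : Fin d), x i) x := by fun_prop
    simp only [div_eq_mul_inv]
    refine DifferentiableAt.const_mul (hprod.inv ?_) ω
    exact Finset.prod_ne_zero_iff.mpr fun i hi => hx i (Finset.ne_of_mem_erase hi)
  · exact differentiableAt_apply j x

end Chart

/-! ### The Fatou map is biholomorphic -/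

/-- The Fatou map `(ψ, τ_2, …, τ_d)` on the global basin. -/
noncomputable def fatouMap {d : ℕ} [NeZero d] (k : ℕ) (c : ℂ) (lam : Fin d → ℂ)
    (F : (Fin d → ℂ) → (Fin d → ℂ)) (z : Fin d → ℂ) : Fin d → ℂ :=
  fun j => if j = 0 then psi k c F z else tauLim k lam F j z

/-- The affine map `(ζ, ξ) ↦ (ζ + n - c log n, Λ'^n ξ)`, an asymptotic model for the chart of
`F^n z` in terms of the Fatou coordinates of `z`. -/
noncomputable def modelIterate {d : ℕ} [NeZero d] (c : ℂ) (lam : Fin d → ℂ) (n : ℕ)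
    (x : Fin d → ℂ) : Fin d → ℂ :=
  fun j => if j = 0 then x 0 + n - c * Complex.log n else lam j ^ n * x j

/-- The approximation of the Fatou map by the chart of `F^n`, renormalized by the model. -/
noncomputable def fatouApprox {d : ℕ} [NeZero d] (k : ℕ) (c : ℂ) (lam : Fin d → ℂ)
    (F : (Fin d → ℂ) → (Fin d → ℂ)) (n : ℕ) (z : Fin d → ℂ) : Fin d → ℂ :=
  fun j => if j = 0 then bigU k (F^[n] z) - n + c * Complex.log n else tauSeq k lam F j n z

section Model

variable {d : ℕ} [NeZero d]

theorem tendsto_modelIterate_zero_div (c : ℂ) (lam : Fin d → ℂ) (x : Fin d → ℂ) :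
    Tendsto (fun p : ℕ × (Fin d → ℂ) => modelIterate c lam p.1 p.2 0 / (p.1 : ℂ))
      (atTop ×ˢ 𝓝 x) (𝓝 1) := by
  have hn : Tendsto (fun p : ℕ × (Fin d → ℂ) => ‖(p.1 : ℂ)‖) (atTop ×ˢ 𝓝 x) atTop := by
    simp only [Complex.norm_natCast]
    exact tendsto_natCast_atTop_atTop.comp tendsto_fst
  have h1 : Tendsto (fun p : ℕ × (Fin d → ℂ) => p.2 0 / (p.1 : ℂ)) (atTop ×ˢ 𝓝 x) (𝓝 0) := by
    have h2 : Tendsto (fun p : ℕ × (Fin d → ℂ) => p.2 0) (atTop ×ˢ 𝓝 x) (𝓝 (x 0)) :=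
      ((continuous_apply (0 : Fin d)).tendsto x).comp tendsto_snd
    simpa [div_eq_mul_inv] using h2.mul
      (tendsto_inv₀_cobounded.comp (tendsto_norm_atTop_iff_cobounded.mp hn))
  have h3 := tendsto_log_div_of_tendsto_norm_atTop hn
  have h4 := (h1.add_const 1).sub (h3.const_mul c)
  rw [zero_add, mul_zero, sub_zero] at h4
  refine h4.congr' ?_
  filter_upwards [hn.eventually_gt_atTop 0] with p hp
  have hp0 : (p.1 : ℂ) ≠ 0 := norm_pos_iff.mp hp
  simp only [modelIterate, if_true]
  field_simp

end Model

theorem IsCompact.eventually_forall_of_eventually_prod_nhds {α X : Type*} [TopologicalSpace X]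
    {l : Filter α} {S : Set X} (hS : IsCompact S) {P : α → X → Prop}
    (h : ∀ x ∈ S, ∀ᶠ p : α × X in l ×ˢ 𝓝 x, P p.1 p.2) : ∀ᶠ n in l, ∀ x ∈ S, P n x := by
  simp only [← eventually_iSup, ← hS.prod_nhdsSet_eq_biSup] at h
  exact h.curry.mono fun _ hn => hn.self_of_nhdsSet

namespace IsFatouDomain

variable {d k : ℕ} {lam : Fin d → ℂ} {F : (Fin d → ℂ) → (Fin d → ℂ)} {c : ℂ}
  {D : Set (Fin d → ℂ)} {K a : ℝ}

/-- On the global basin `U_n ~ n`, because `U_n - n + c log U_n` converges. -/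
theorem tendsto_natCast_div_bigU (hD : IsFatouDomain k lam F c D K a)
    {z : Fin d → ℂ} (hz : z ∈ globalBasin F D) :
    Tendsto (fun n : ℕ => (n : ℂ) / bigU k (F^[n] z)) atTop (𝓝 1) := by
  obtain ⟨N, hN⟩ := mem_globalBasin.mp hz
  have hre : Tendsto (fun n => ‖bigU k (F^[n] z)‖) atTop atTop := by
    refine tendsto_atTop.mpr fun M => ?_
    filter_upwards [hD.eventually_lt_re (A := {z}) (N := N) (by simpa using hN) M] with n hn
    exact (hn z rfl).le.trans (Complex.re_le_norm _)
  have h1 := (hD.tendsto_psi_of_iterate_mem hN).mul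
    (tendsto_inv₀_cobounded.comp (tendsto_norm_atTop_iff_cobounded.mp hre))
  have h2 := ((tendsto_log_div_of_tendsto_norm_atTop hre).const_mul c).const_add 1
  have h3 := h2.sub h1
  rw [mul_zero, mul_zero, add_zero, sub_zero] at h3
  refine h3.congr' ?_
  filter_upwards [hre.eventually_gt_atTop 0] with n hn
  have h0 : bigU k (F^[n] z) ≠ 0 := norm_pos_iff.mp hn
  simp only [Function.comp_apply, psiSeq]
  field_simp
  ring

end IsFatouDomain

section Biholomorphic

variable {d k : ℕ} [NeZero d] {lam : Fin d → ℂ} {F : (Fin d → ℂ) → (Fin d → ℂ)} {c ω : ℂ}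
  {R κ δ K a : ℝ}

theorem isOpen_cylinder : IsOpen (cylinder d) := by
  have : cylinder d = ⋂ j : Fin d, {w | j ≠ 0 → w j ≠ 0} := by ext; simp [cylinder]
  rw [this]
  refine isOpen_iInter_of_finite fun j => ?_
  by_cases hj : j = 0
  · simp [hj]
  · simpa [hj] using isOpen_ne_fun (continuous_apply j) continuous_const

theorem norm_modelIterate_of_ne (hlam : ∀ j, ‖lam j‖ = 1) (n : ℕ) (x : Fin d → ℂ) {j : Fin d}
    (hj : j ≠ 0) : ‖modelIterate c lam n x j‖ = ‖x j‖ := by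
  simp [modelIterate, hj, hlam j]

/-- Along the model iteration `U ~ n` becomes large, while the `|t_j|` stay bounded: eventually the
model orbit is in the domain of the chart. -/
theorem eventually_chartInv_modelIterate_mem (hk : 0 < k) (hlam : ∀ j, ‖lam j‖ = 1)
    (hω : ω ^ k = 1) (hκ : 0 < κ) (hδ : 0 < δ) {x : Fin d → ℂ} (hx : x ∈ cylinder d) :
    ∀ᶠ p : ℕ × (Fin d → ℂ) in atTop ×ˢ 𝓝 x,
      chartInv k ω (modelIterate c lam p.1 p.2) ∈ chartDomain d k R κ δ ω ∧
      0 < (modelIterate c lam p.1 p.2 0).re ∧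
      ∀ j, j ≠ 0 → modelIterate c lam p.1 p.2 j ≠ 0 := by
  have h1 := (tendsto_modelIterate_zero_div c lam x).eventually
    (eventually_nhds_one_mem_cone hκ)
  have hnat : Tendsto (fun p : ℕ × (Fin d → ℂ) => (p.1 : ℝ)) (atTop ×ˢ 𝓝 x) atTop :=
    tendsto_natCast_atTop_atTop.comp tendsto_fst
  have hne : ∀ᶠ y : Fin d → ℂ in 𝓝 x, ∀ j, j ≠ 0 → y j ≠ 0 := by
    rw [eventually_all]
    intro j
    by_cases hj : j = 0
    · simp [hj]
    · filter_upwards [(continuous_apply j).continuousAt.eventually_ne (hx j hj)] with y hy _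
      exact hy
  -- a bound for all `|t_j|`, including the one with index `0`
  obtain ⟨M, hM⟩ : ∃ M : ℝ, ∀ᶠ y : Fin d → ℂ in 𝓝 x,
      ‖ω / ∏ i ∈ Finset.univ.erase (0 : Fin d), y i‖ < M ∧ ‖y‖ < M := by
    have hc : ContinuousAt (fun y : Fin d → ℂ => ‖ω / ∏ i ∈ Finset.univ.erase (0 : Fin d), y i‖) x := by
      refine (ContinuousAt.div continuousAt_const (by fun_prop) ?_).norm
      exact Finset.prod_ne_zero_iff.mpr fun i hi => hx i (Finset.ne_of_mem_erase hi)
    have hid : ContinuousAt (fun y : Fin d → ℂ => ‖y‖) x := continuous_norm.continuousAt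
    exact ⟨_, (hc.eventually (gt_mem_nhds ((le_max_left _ ‖x‖).trans_lt (lt_add_one _)))).and
      (hid.eventually (gt_mem_nhds ((le_max_right _ _).trans_lt (lt_add_one _))))⟩
  have hbig : ∀ᶠ p : ℕ × (Fin d → ℂ) in atTop ×ˢ 𝓝 x,
      0 < (p.1 : ℝ) ∧ R < p.1 / 2 ∧ M ≤ ((p.1 : ℝ) / 2) ^ δ := by
    have h2 : Tendsto (fun p : ℕ × (Fin d → ℂ) => (p.1 : ℝ) / 2) (atTop ×ˢ 𝓝 x) atTop :=
      hnat.atTop_div_const (by norm_num)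
    exact (hnat.eventually_gt_atTop 0).and ((h2.eventually_gt_atTop R).and
      (((tendsto_rpow_atTop hδ).comp h2).eventually_ge_atTop M))
  filter_upwards [h1, hbig, tendsto_snd.eventually hM, tendsto_snd.eventually hne] with
    ⟨n, y⟩ ⟨hu1, hu2⟩ ⟨hn, hR, hMn⟩ ⟨hM1, hM2⟩ hy
  simp only at *
  set U := modelIterate c lam n y 0 with hU
  have hnc : (n : ℂ) ≠ 0 := by exact_mod_cast hn.ne'
  have hUn : U = (n : ℝ) * (U / n) := by
    push_cast; field_simp
  have hre : U.re = n * (U / n).re := by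
    conv_lhs => rw [hUn, Complex.re_ofReal_mul]
  have him : U.im = n * (U / n).im := by
    conv_lhs => rw [hUn, Complex.im_ofReal_mul]
  have hre2 : (n : ℝ) / 2 < U.re := by rw [hre]; nlinarith
  have hpos : 0 < U.re := by linarith
  have hU0 : U ≠ 0 := fun h => by simp [h] at hpos
  have hmne : ∀ j, j ≠ 0 → modelIterate c lam n y j ≠ 0 := by
    intro j hj
    rw [← norm_ne_zero_iff, norm_modelIterate_of_ne hlam n y hj, norm_ne_zero_iff]
    exact hy j hj
  refine ⟨⟨?_, ?_, prod_tcoord_chartInv hk hω hU0 hmne, fun j => ?_⟩, hpos, hmne⟩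
  · rw [bigU_chartInv hk hω hU0 hmne]
    linarith
  · rw [bigU_chartInv hk hω hU0 hmne, ← hU, hre, him, abs_mul, abs_of_pos hn]
    nlinarith
  · rw [bigU_chartInv hk hω hU0 hmne, tcoord_chartInv hk hω hU0 hmne, ← hU]
    have hlt : M ≤ ‖U‖ ^ δ := hMn.trans (Real.rpow_le_rpow (by positivity)
      (hre2.le.trans (Complex.re_le_norm U)) hδ.le)
    refine lt_of_lt_of_le ?_ hlt
    split_ifs with hj
    · refine lt_of_le_of_lt (le_of_eq ?_) hM1
      rw [norm_div, norm_div, norm_prod, norm_prod]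
      congr 1
      exact Finset.prod_congr rfl fun i hi =>
        norm_modelIterate_of_ne hlam n y (Finset.ne_of_mem_erase hi)
    · rw [norm_modelIterate_of_ne hlam n y hj]
      exact (norm_le_pi_norm y j).trans_lt hM2

/-- The model undoes the renormalization: what is left is the chart of `F^n z`. -/
theorem modelIterate_fatouApprox (hlam : ∀ j, ‖lam j‖ = 1) (n : ℕ) (z : Fin d → ℂ) :
    modelIterate c lam n (fatouApprox k c lam F n z) =
      fun j => if j = 0 then bigU k (F^[n] z) else tcoord k (F^[n] z) j := by
  ext j
  have hl : lam j ≠ 0 := fun h => by simpa [h] using hlam j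
  by_cases hj : j = 0
  · subst hj
    simp only [modelIterate, fatouApprox, if_true]
    ring
  · simp [modelIterate, fatouApprox, hj, tauSeq, hl]

namespace IsFatouDomain

theorem tendsto_fatouApprox {D : Set (Fin d → ℂ)} (hD : IsFatouDomain k lam F c D K a)
    {z : Fin d → ℂ} (hz : z ∈ globalBasin F D) :
    Tendsto (fun n => fatouApprox k c lam F n z) atTop (𝓝 (fatouMap k c lam F z)) := by
  obtain ⟨N, hN⟩ := mem_globalBasin.mp hz
  rw [tendsto_pi_nhds]
  intro j
  by_cases hj : j = 0
  · subst hj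
    simp only [fatouApprox, fatouMap, if_true]
    have h1 := (continuousAt_clog (Or.inl one_pos : (1 : ℂ) ∈ Complex.slitPlane)).tendsto.comp
      (hD.tendsto_natCast_div_bigU hz)
    rw [Complex.log_one] at h1
    have h2 := hD.tendsto_psi_of_iterate_mem hN
    rw [← hD.psi_eq_of_iterate_mem hN] at h2
    have h3 := h2.add (h1.const_mul c)
    rw [mul_zero, add_zero] at h3
    refine h3.congr' ?_
    filter_upwards [eventually_gt_atTop 0,
      hD.eventually_lt_re (A := {z}) (N := N) (by simpa using hN) 0] with n hn hre
    have hre := hre z rfl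
    have h0 : bigU k (F^[n] z) ≠ 0 := fun h => by simp [h] at hre
    have hlog : Complex.log ((n : ℂ) / bigU k (F^[n] z)) =
        Complex.log n - Complex.log (bigU k (F^[n] z)) := by
      have harg : |(bigU k (F^[n] z)).arg| < Real.pi / 2 :=
        Complex.abs_arg_lt_pi_div_two_iff.mpr (Or.inl hre)
      have hn' : (0 : ℝ) < n := by exact_mod_cast hn
      rw [div_eq_mul_inv, ← Complex.ofReal_natCast, Complex.log_ofReal_mul hn' (inv_ne_zero h0),
        Complex.log_inv _ (fun h => by rw [h, abs_of_pos Real.pi_pos] at harg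
                                       linarith [Real.pi_pos]), Complex.ofReal_log hn'.le]
      ring
    simp only [Function.comp_apply, hlog, psiSeq]
    ring
  · simp only [fatouApprox, fatouMap, hj, if_false]
    have := hD.tendsto_tau_of_iterate_mem hN j
    rwa [← hD.tauLim_eq_of_iterate_mem hN] at this

/-- Inverse branches of the approximations `fatouApprox n`, followed by the Fatou map, converge to
the identity. -/
theorem tendsto_fatouMap_sub_id
    (hD : IsFatouDomain k lam F c (chartDomain d k R κ δ ω) K a) (hk : 0 < k)
    (hlam : ∀ j, ‖lam j‖ = 1) (hω : ω ^ k = 1) (hκ : 0 < κ) (hδ : 0 < δ)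
    {G : (Fin d → ℂ) → (Fin d → ℂ)} (hFG : Function.RightInverse G F)
    {x : Fin d → ℂ} (hx : x ∈ cylinder d) :
    Tendsto (fun p : ℕ × (Fin d → ℂ) =>
      fatouMap k c lam F (G^[p.1] (chartInv k ω (modelIterate c lam p.1 p.2))) - p.2)
      (atTop ×ˢ 𝓝 x) (𝓝 0) := by
  have hmem := eventually_chartInv_modelIterate_mem (R := R) (c := c) hk hlam hω hκ hδ hx
  have hratio := tendsto_modelIterate_zero_div c lam x
  have hnat : Tendsto (fun p : ℕ × (Fin d → ℂ) => (p.1 : ℝ)) (atTop ×ˢ 𝓝 x) atTop :=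
    tendsto_natCast_atTop_atTop.comp tendsto_fst
  have hhalf : ∀ᶠ p : ℕ × (Fin d → ℂ) in atTop ×ˢ 𝓝 x,
      1 / 2 < (modelIterate c lam p.1 p.2 0 / (p.1 : ℂ)).re :=
    hratio.eventually ((Complex.continuous_re.tendsto 1).eventually (lt_mem_nhds (by norm_num)))
  -- the error bound from the definition of a Fatou domain tends to zero along the model
  have herr : ∀ᶠ p : ℕ × (Fin d → ℂ) in atTop ×ˢ 𝓝 x,
      K * ((bigU k (chartInv k ω (modelIterate c lam p.1 p.2))).re + ((0 : ℕ) : ℝ) / 2) ^ (-a)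
        ≤ K * ((p.1 : ℝ) / 2) ^ (-a) := by
    filter_upwards [hmem, hhalf, hnat.eventually_gt_atTop 0] with ⟨n, y⟩ ⟨h1, h2, h3⟩ h4 hn
    simp only at *
    have h0 : modelIterate c lam n y 0 ≠ 0 := fun h => by simp [h] at h2
    rw [bigU_chartInv hk hω h0 h3]
    refine mul_le_mul_of_nonneg_left (Real.rpow_le_rpow_of_nonpos (by positivity) ?_
      (by linarith [hD.rate_pos])) hD.bound_nonneg
    rw [← Complex.ofReal_natCast, Complex.div_ofReal_re, lt_div_iff₀ hn] at h4
    push_cast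
    linarith
  have herr0 : Tendsto (fun p : ℕ × (Fin d → ℂ) => K * ((p.1 : ℝ) / 2) ^ (-a)) (atTop ×ˢ 𝓝 x)
      (𝓝 0) := by
    have h2 : Tendsto (fun p : ℕ × (Fin d → ℂ) => (p.1 : ℝ) / 2) (atTop ×ˢ 𝓝 x) atTop :=
      hnat.atTop_div_const (by norm_num)
    simpa using ((tendsto_rpow_neg_atTop hD.rate_pos).comp h2).const_mul K
  have hFGn : ∀ n : ℕ, ∀ y, F^[n] (G^[n] y) = y := fun n => hFG.iterate n
  rw [tendsto_pi_nhds]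
  intro j
  by_cases hj : j = 0
  · subst hj
    have hlog : Tendsto (fun p : ℕ × (Fin d → ℂ) =>
        Complex.log (modelIterate c lam p.1 p.2 0 / (p.1 : ℂ))) (atTop ×ˢ 𝓝 x) (𝓝 0) := by
      have h1 := (continuousAt_clog
        (Or.inl one_pos : (1 : ℂ) ∈ Complex.slitPlane)).tendsto.comp hratio
      rwa [Complex.log_one] at h1
    have hE : Tendsto (fun p : ℕ × (Fin d → ℂ) =>
        psi k c F (chartInv k ω (modelIterate c lam p.1 p.2)) -
          psiSeq k c F 0 (chartInv k ω (modelIterate c lam p.1 p.2))) (atTop ×ˢ 𝓝 x) (𝓝 0) := by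
      rw [tendsto_zero_iff_norm_tendsto_zero]
      refine squeeze_zero' (Eventually.of_forall fun _ => norm_nonneg _) ?_ herr0
      filter_upwards [hmem, herr] with p hp hp2
      rw [norm_sub_rev]
      exact (hD.psi_bound _ hp.1 0).trans hp2
    have h2 := hE.add (hlog.const_mul c)
    rw [mul_zero, add_zero] at h2
    refine h2.congr' ?_
    filter_upwards [hmem, hnat.eventually_gt_atTop 0] with ⟨n, y⟩ ⟨h1, h2, h3⟩ hn
    simp only at *
    have h0 : modelIterate c lam n y 0 ≠ 0 := fun h => by simp [h] at h2
    have hnc : (n : ℂ) ≠ 0 := by exact_mod_cast hn.ne'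
    have hlogU : Complex.log (modelIterate c lam n y 0) =
        Complex.log n + Complex.log (modelIterate c lam n y 0 / n) := by
      conv_lhs => rw [← mul_div_cancel₀ (modelIterate c lam n y 0) hnc]
      rw [← Complex.ofReal_natCast, Complex.log_ofReal_mul hn (div_ne_zero h0 (by exact_mod_cast hnc)),
        Complex.ofReal_log hn.le]
    simp only [Pi.sub_apply, fatouMap, if_true]
    rw [hD.psi_eq_of_iterate_mem (z := G^[n] _) (N := n) (by rwa [hFGn]), hFGn, psiSeq,
      Function.iterate_zero, id, bigU_chartInv hk hω h0 h3, hlogU]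
    simp only [modelIterate, if_true]
    push_cast
    ring
  · have hE : Tendsto (fun p : ℕ × (Fin d → ℂ) =>
        tauLim k lam F j (chartInv k ω (modelIterate c lam p.1 p.2)) /
          tcoord k (chartInv k ω (modelIterate c lam p.1 p.2)) j) (atTop ×ˢ 𝓝 x) (𝓝 1) := by
      have hr : ∀ᶠ p : ℕ × (Fin d → ℂ) in atTop ×ˢ 𝓝 x, ∃ r : ℂ, ‖r‖ ≤ K * ((p.1 : ℝ) / 2) ^ (-a) ∧
          tauLim k lam F j (chartInv k ω (modelIterate c lam p.1 p.2)) /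
          tcoord k (chartInv k ω (modelIterate c lam p.1 p.2)) j = Complex.exp r := by
        filter_upwards [hmem, herr] with p hp hp2
        obtain ⟨r, hr⟩ := hD.tau_bound _ hp.1 j
        refine ⟨-r 0, by rw [norm_neg]; exact (hr 0).1.trans hp2, ?_⟩
        have h1 := (hr 0).2
        simp only [tauSeq, pow_zero, inv_one, one_mul, Function.iterate_zero, id] at h1
        have h0 : tcoord k (chartInv k ω (modelIterate c lam p.1 p.2)) j ≠ 0 :=
          tcoord_ne_zero hk (hD.bigU_ne_zero hp.1) j
        rw [div_eq_iff h0, h1, mul_comm, mul_assoc, ← Complex.exp_add]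
        simp
      rw [Metric.tendsto_nhds]
      intro ε hε
      have hexp : ∀ᶠ u : ℂ in 𝓝 0, dist (Complex.exp u) 1 < ε := by
        have h1 := (Complex.continuous_exp.tendsto 0).eventually (Metric.ball_mem_nhds _ hε)
        rwa [Complex.exp_zero] at h1
      obtain ⟨ρ, hρ, hρε⟩ := Metric.eventually_nhds_iff.mp hexp
      filter_upwards [hr, herr0.eventually (gt_mem_nhds hρ)] with p ⟨r, hr1, hr2⟩ hp
      rw [hr2]
      refine hρε ?_
      rw [dist_zero_right]
      exact hr1.trans_lt hp
    have hyj : Tendsto (fun p : ℕ × (Fin d → ℂ) => p.2 j) (atTop ×ˢ 𝓝 x) (𝓝 (x j)) :=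
      ((continuous_apply j).tendsto x).comp tendsto_snd
    have h2 := hyj.mul (hE.sub_const 1)
    rw [sub_self, mul_zero] at h2
    refine h2.congr' ?_
    filter_upwards [hmem] with ⟨n, y⟩ ⟨h1, h2, h3⟩
    simp only at *
    have h0 : modelIterate c lam n y 0 ≠ 0 := fun h => by simp [h] at h2
    have hl : lam j ≠ 0 := fun h => by simpa [h] using hlam j
    have hy : y j ≠ 0 := by
      have := h3 j hj
      rw [← norm_ne_zero_iff, norm_modelIterate_of_ne hlam n y hj, norm_ne_zero_iff] at this
      exact this
    simp only [Pi.sub_apply, fatouMap, hj, if_false]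
    rw [hD.tauLim_eq_of_iterate_mem (z := G^[n] _) (N := n) (by rwa [hFGn]) j, hFGn,
      tcoord_chartInv hk hω h0 h3, if_neg hj]
    have hm : modelIterate c lam n y j = lam j ^ n * y j := by simp [modelIterate, hj]
    rw [hm]
    generalize tauLim k lam F j (chartInv k ω (modelIterate c lam n y)) = T
    field_simp

theorem differentiableOn_fatouMap {D : Set (Fin d → ℂ)} (hD : IsFatouDomain k lam F c D K a)
    (hk : 0 < k) (hlam : ∀ j, ‖lam j‖ = 1) (hF : Differentiable ℂ F) :
    DifferentiableOn ℂ (fatouMap k c lam F) (globalBasin F D) := by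
  rw [differentiableOn_pi]
  intro j
  by_cases hj : j = 0
  · subst hj
    simpa only [fatouMap, if_true] using hD.differentiableOn_psi hF
  · have hl : lam j ≠ 0 := fun h => by simpa [h] using hlam j
    simp only [fatouMap, hj, if_false]
    exact hD.differentiableOn_tauLim hk hF hl

theorem isBiholOn_fatouMap
    (hD : IsFatouDomain k lam F c (chartDomain d k R κ δ ω) K a) (hk : 0 < k)
    (hlam : ∀ j, ‖lam j‖ = 1) (hω : ω ^ k = 1) (hκ : 0 < κ) (hδ : 0 < δ)
    (hF : IsHolAut F) :
    IsBiholOn (fatouMap k c lam F) (globalBasin F (chartDomain d k R κ δ ω)) (cylinder d) := by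
  obtain ⟨hFd, G, hG, hGF, hFG⟩ := hF
  have hΩ := hD.isOpen_globalBasin hFd.continuous
  have hΦd := hD.differentiableOn_fatouMap hk hlam hFd
  refine ⟨hΩ, isOpen_cylinder, hΦd, ?_⟩
  have hl : ∀ j, lam j ≠ 0 := fun j h => by simpa [h] using hlam j
  refine bijOn_and_differentiableOn_inverse_of_approx isOpen_cylinder
    (G := fun n x => G^[n] (chartInv k ω (modelIterate c lam n x)))
    (H := fun n z => fatouApprox k c lam F n z) ?_ ?_ ?_ ?_ ?_
  · intro z hz j hj
    simp only [fatouMap, hj, if_false]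
    exact hD.tauLim_ne_zero hk hz (hl j)
  · intro S hS hSc
    refine hSc.eventually_forall_of_eventually_prod_nhds fun x hx => ?_
    filter_upwards [eventually_chartInv_modelIterate_mem (R := R) (c := c) hk hlam hω hκ hδ (hS hx)]
      with ⟨n, y⟩ ⟨h1, h2, h3⟩
    simp only at *
    have hmem : G^[n] (chartInv k ω (modelIterate c lam n y)) ∈
        globalBasin F (chartDomain d k R κ δ ω) :=
      mem_globalBasin.mpr ⟨n, by rwa [hFG.iterate n]⟩
    have hmodel : Differentiable ℂ (modelIterate c lam n) := by
      rw [differentiable_pi]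
      intro j
      unfold modelIterate
      split_ifs <;> fun_prop
    have hGd : DifferentiableAt ℂ (fun x => G^[n] (chartInv k ω (modelIterate c lam n x))) y :=
      ((hG.iterate n) _).comp y ((differentiableAt_chartInv h2 h3).comp y (hmodel y))
    exact ⟨hmem, hGd, DifferentiableAt.comp (g := fatouMap k c lam F) y
      (hΦd.differentiableAt (hΩ.mem_nhds hmem)) hGd⟩
  · rw [tendstoLocallyUniformlyOn_iff_filter]
    intro x hx
    rw [Metric.tendstoUniformlyOnFilter_iff]
    intro ε hε
    have h1 := hD.tendsto_fatouMap_sub_id hk hlam hω hκ hδ hFG hx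
    have h2 := (h1.mono_left (prod_mono le_rfl (nhdsWithin_le_nhds (s := cylinder d)))).eventually
      (Metric.ball_mem_nhds (0 : Fin d → ℂ) hε)
    filter_upwards [h2] with p hp
    rw [dist_zero_right] at hp
    rwa [dist_comm, dist_eq_norm]
  · exact fun z hz => hD.tendsto_fatouApprox hz
  · intro z hz
    obtain ⟨N, hN⟩ := mem_globalBasin.mp hz
    filter_upwards [eventually_ge_atTop N] with n hn
    have hmem := hD.iterate_mem hN hn
    rw [modelIterate_fatouApprox hlam, chartInv_chart hk (hD.bigU_ne_zero hmem) hmem.2.2.1,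
      hGF.iterate n]

end IsFatouDomain

end Biholomorphic

/-! ### Roots and the coordinates `σ_j` -/

section Root

theorem root_ne_zero {N : ℕ} {x : ℂ} (hx : x ≠ 0) : root N x ≠ 0 := by
  simp [root, Complex.cpow_def_of_ne_zero hx]

theorem root_div {N : ℕ} {x y : ℂ} (hx : 0 < x.re) (hy : 0 < y.re) :
    root N (x / y) = root N x / root N y := by
  have hx0 : x ≠ 0 := fun h => by simp [h] at hx
  have hy0 : y ≠ 0 := fun h => by simp [h] at hy
  have h1 := Complex.abs_arg_lt_pi_div_two_iff.mpr (Or.inl hx)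
  have h2 := Complex.abs_arg_lt_pi_div_two_iff.mpr (Or.inl hy)
  have hlog : Complex.log (x / y) = Complex.log x - Complex.log y := by
    rw [abs_lt] at h1 h2
    conv_lhs => rw [← Complex.exp_log hx0, ← Complex.exp_log hy0, ← Complex.exp_sub]
    rw [Complex.log_exp]
    · rw [Complex.sub_im, Complex.log_im, Complex.log_im]; linarith
    · rw [Complex.sub_im, Complex.log_im, Complex.log_im]; linarith
  rw [root, root, root, Complex.cpow_def_of_ne_zero (div_ne_zero hx0 hy0),
    Complex.cpow_def_of_ne_zero hx0, Complex.cpow_def_of_ne_zero hy0, hlog, ← Complex.exp_sub,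
    sub_mul]

theorem differentiableAt_root {N : ℕ} {x : ℂ} (hx : 0 < x.re) : DifferentiableAt ℂ (root N) x :=
  differentiableAt_id.cpow_const (Or.inl hx)

theorem root_one (N : ℕ) : root N 1 = 1 := by simp [root]

theorem tcoord_eq_mul_root {d k : ℕ} {z : Fin d → ℂ} (hz : bigU k z ≠ 0) (j : Fin d) :
    tcoord k z j = z j * root (k * d) (bigU k z) := by
  rw [tcoord, root, Complex.cpow_def_of_ne_zero hz]
  push_cast
  ring_nf

end Root

section Sigma

variable {d k : ℕ} {lam : Fin d → ℂ} {F : (Fin d → ℂ) → (Fin d → ℂ)} {c : ℂ}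
  {B D : Set (Fin d → ℂ)} {K a : ℝ} {N : ℕ}

namespace IsFatouDomain

/-- Since `ψ` and `U_n` both have positive real part, the roots in the definition of `σ_{j,n}` can
be rearranged into `τ_j ψ^{-1/(kd)}` times factors that tend to one uniformly. -/
theorem tendstoLocallyUniformlyOn_sigmaSeq (hD : IsFatouDomain k lam F c D K a) (hk : 0 < k)
    (hF : Differentiable ℂ F) {j : Fin d} (hl : lam j ≠ 0) (hB : Set.MapsTo F^[N] B D)
    (hU : ∀ z ∈ B, ∀ n, 0 < (bigU k (F^[n] z)).re) (hψ : ∀ z ∈ B, 0 < (psi k c F z).re) :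
    TendstoLocallyUniformlyOn (sigmaSeq k c lam F j)
      (fun z => tauLim k lam F j z / root (k * d) (psi k c F z)) atTop B := by
  have hBΩ : B ⊆ globalBasin F D := fun z hz => mem_globalBasin.mpr ⟨N, hB hz⟩
  have hnorm : Tendsto (fun p : ℕ × (Fin d → ℂ) => ‖bigU k (F^[p.1] p.2)‖) (atTop ×ˢ 𝓟 B) atTop := by
    refine tendsto_atTop.mpr fun M => ?_
    rw [eventually_prod_principal_iff]
    filter_upwards [hD.eventually_lt_re hB M] with n hn z hz
    exact (hn z hz).le.trans (Complex.re_le_norm _)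
  have hdiff : Tendsto (fun p : ℕ × (Fin d → ℂ) => psi k c F p.2 - psiSeq k c F p.1 p.2)
      (atTop ×ˢ 𝓟 B) (𝓝 0) := by
    rw [Metric.tendsto_nhds]
    intro ε hε
    rw [eventually_prod_principal_iff]
    filter_upwards [Metric.tendstoUniformlyOn_iff.mp (hD.tendstoUniformlyOn_psi hB) ε hε]
      with n hn z hz
    rw [dist_zero_right, ← dist_eq_norm]
    exact hn z hz
  have hmem : ∀ᶠ p : ℕ × (Fin d → ℂ) in atTop ×ˢ 𝓟 B, p.2 ∈ B := by
    rw [eventually_prod_principal_iff]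
    exact Eventually.of_forall fun _ z hz => hz
  have hratio : Tendsto (fun p : ℕ × (Fin d → ℂ) =>
      (psi k c F p.2 + p.1) / bigU k (F^[p.1] p.2)) (atTop ×ˢ 𝓟 B) (𝓝 1) := by
    have h1 := hdiff.mul (tendsto_inv₀_cobounded.comp (tendsto_norm_atTop_iff_cobounded.mp hnorm))
    have h2 := ((tendsto_log_div_of_tendsto_norm_atTop hnorm).const_mul c).const_add 1
    have h3 := h1.add h2
    rw [mul_zero, mul_zero, add_zero, zero_add] at h3
    refine h3.congr' ?_
    filter_upwards [hmem] with p hp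
    have h0 : bigU k (F^[p.1] p.2) ≠ 0 := fun h => by simpa [h] using hU p.2 hp p.1
    simp only [Function.comp_apply, psiSeq]
    field_simp
    ring
  have hroot : Tendsto (fun p : ℕ × (Fin d → ℂ) =>
      root (k * d) ((psi k c F p.2 + p.1) / bigU k (F^[p.1] p.2))) (atTop ×ˢ 𝓟 B) (𝓝 1) := by
    have h1 : ContinuousAt (root (k * d)) 1 :=
      (differentiableAt_root (by norm_num)).continuousAt
    have h2 := h1.tendsto.comp hratio
    rwa [root_one] at h2
  have hone := hD.tendstoUniformlyOn_tauSeq_div hk hl hB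
  have hquot : Tendsto (fun p : ℕ × (Fin d → ℂ) =>
      tauSeq k lam F j p.1 p.2 / tauLim k lam F j p.2) (atTop ×ˢ 𝓟 B) (𝓝 1) :=
    tendsto_prod_principal_iff.mpr hone
  have hprod : TendstoUniformlyOn (fun (n : ℕ) z => tauSeq k lam F j n z / tauLim k lam F j z *
      root (k * d) ((psi k c F z + n) / bigU k (F^[n] z))) 1 atTop B := by
    have h1 := hquot.mul hroot
    rw [one_mul] at h1
    exact tendsto_prod_principal_iff.mp h1
  have hψ0 : ∀ z ∈ B, psi k c F z ≠ 0 := fun z hz h => by simpa [h] using hψ z hz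
  have hg : ContinuousOn (fun z => tauLim k lam F j z / root (k * d) (psi k c F z)) B := by
    refine ((hD.differentiableOn_tauLim hk hF hl).continuousOn.mono hBΩ).div ?_
      fun z hz => root_ne_zero (hψ0 z hz)
    exact fun z hz => ContinuousAt.comp_continuousWithinAt
      (differentiableAt_root (hψ z hz)).continuousAt
      (((hD.differentiableOn_psi hF).continuousOn.mono hBΩ) z hz)
  refine (tendstoLocallyUniformlyOn_mul_of_tendstoUniformlyOn_one hprod hg.norm
    fun z _ => le_rfl).congr fun n z hz => ?_
  have hn : 0 < (psi k c F z + n).re := by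
    simp only [Complex.add_re, Complex.natCast_re]
    have := hψ z hz
    positivity
  have hU0 : bigU k (F^[n] z) ≠ 0 := fun h => by simpa [h] using hU z hz n
  have hτ := hD.tauLim_ne_zero hk (hBΩ hz) hl
  have hr1 : root (k * d) (psi k c F z) ≠ 0 := root_ne_zero (hψ0 z hz)
  have hr2 : root (k * d) (bigU k (F^[n] z)) ≠ 0 := root_ne_zero hU0
  simp only
  rw [sigmaSeq, root_div hn (hψ z hz), root_div hn (hU z hz n), tauSeq, tcoord_eq_mul_root hU0]
  field_simp

theorem sigma_eq (hD : IsFatouDomain k lam F c D K a) (hk : 0 < k)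
    (hF : Differentiable ℂ F) {j : Fin d} (hl : lam j ≠ 0) (hB : Set.MapsTo F^[N] B D)
    (hU : ∀ z ∈ B, ∀ n, 0 < (bigU k (F^[n] z)).re) (hψ : ∀ z ∈ B, 0 < (psi k c F z).re)
    {z : Fin d → ℂ} (hz : z ∈ B) :
    sigma k c lam F j z = tauLim k lam F j z / root (k * d) (psi k c F z) :=
  ((hD.tendstoLocallyUniformlyOn_sigmaSeq hk hF hl hB hU hψ).tendsto_at hz).limUnder_eq

theorem tau_eq (hD : IsFatouDomain k lam F c D K a) (hk : 0 < k)
    (hF : Differentiable ℂ F) {j : Fin d} (hl : lam j ≠ 0) (hB : Set.MapsTo F^[N] B D)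
    (hU : ∀ z ∈ B, ∀ n, 0 < (bigU k (F^[n] z)).re) (hψ : ∀ z ∈ B, 0 < (psi k c F z).re)
    {z : Fin d → ℂ} (hz : z ∈ B) :
    tau k c lam F j z = tauLim k lam F j z := by
  rw [tau, hD.sigma_eq hk hF hl hB hU hψ hz, mul_div_cancel₀]
  exact root_ne_zero fun h => by simpa [h] using hψ z hz

end IsFatouDomain

end Sigma

/-! ### Straightening the rotation -/

/-- The biholomorphic map `(ζ, ξ) ↦ (ζ, ξ_j λ_j^{-ζ})`, which removes the rotation `Λ'`. -/
noncomputable def unrotate {d : ℕ} [NeZero d] (lam : Fin d → ℂ) (w : Fin d → ℂ) : Fin d → ℂ :=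
  fun j => if j = 0 then w 0 else w j * Complex.exp (-(Complex.log (lam j) * w 0))

section Unrotate

variable {d : ℕ} [NeZero d] {lam : Fin d → ℂ}

theorem isBiholOn_unrotate : IsBiholOn (unrotate lam) (cylinder d) (cylinder d) := by
  let g : (Fin d → ℂ) → (Fin d → ℂ) := fun w j =>
    if j = 0 then w 0 else w j * Complex.exp (Complex.log (lam j) * w 0)
  have hmaps : Set.MapsTo (unrotate lam) (cylinder d) (cylinder d) := fun w hw j hj => by
    simp [unrotate, hj, hw j hj]
  have hmaps' : Set.MapsTo g (cylinder d) (cylinder d) := fun w hw j hj => by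
    simp [g, hj, hw j hj]
  have hinv : Set.InvOn g (unrotate lam) (cylinder d) (cylinder d) := by
    constructor
    · intro w _
      ext j
      by_cases hj : j = 0
      · subst hj; simp [g, unrotate]
      · simp [g, unrotate, hj, mul_assoc, ← Complex.exp_add]
    · intro w _
      ext j
      by_cases hj : j = 0
      · subst hj; simp [g, unrotate]
      · simp [g, unrotate, hj, mul_assoc, ← Complex.exp_add]
  refine ⟨isOpen_cylinder, isOpen_cylinder, ?_,
    hinv.bijOn hmaps hmaps', g, ?_, hinv⟩
  · refine Differentiable.differentiableOn (differentiable_pi.mpr fun j => ?_)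
    unfold unrotate
    split_ifs <;> fun_prop
  · refine Differentiable.differentiableOn (differentiable_pi.mpr fun j => ?_)
    simp only [g]
    split_ifs <;> fun_prop

theorem unrotate_shiftRot (hlam : ∀ j, lam j ≠ 0) (w : Fin d → ℂ) :
    unrotate lam (shiftRot lam w) = shift (unrotate lam w) := by
  ext j
  by_cases hj : j = 0
  · subst hj; simp [unrotate, shiftRot, shift]
  · simp only [unrotate, shiftRot, shift, hj, if_false, if_true]
    rw [mul_add, neg_add, Complex.exp_add, mul_one, Complex.exp_neg (Complex.log (lam j)),
      Complex.exp_log (hlam j)]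
    have := hlam j
    field_simp

end Unrotate

/-! ### Local basins and their global basins -/

theorem IsBiholOn.comp {d : ℕ} {f f' : (Fin d → ℂ) → (Fin d → ℂ)} {U V W : Set (Fin d → ℂ)}
    (hf : IsBiholOn f U V) (hf' : IsBiholOn f' V W) : IsBiholOn (fun z => f' (f z)) U W := by
  obtain ⟨h1, h2, h3, h4, g, hg, hinv⟩ := hf
  obtain ⟨-, h5, h6, h7, g', hg', hinv'⟩ := hf'
  have hmaps : Set.MapsTo g' W V := fun y hy => by
    obtain ⟨x, hx, rfl⟩ := h7.surjOn hy
    rwa [hinv'.1 hx]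
  refine ⟨h1, h5, h6.comp h3 h4.mapsTo, h7.comp h4, fun y => g (g' y), hg.comp hg' hmaps, ?_, ?_⟩
  · intro z hz
    simp only
    rw [hinv'.1 (h4.mapsTo hz), hinv.1 hz]
  · intro y hy
    simp only
    rw [hinv.2 (hmaps hy), hinv'.2 hy]

section LocalBasin

variable {d k : ℕ} {lam : Fin d → ℂ} {F : (Fin d → ℂ) → (Fin d → ℂ)}

theorem isOpen_localBasin {h : ℕ} {R θ β : ℝ} (hk : 0 < k) (hR : 0 < R) (hθ : 0 < θ)
    (hθ2 : θ < Real.pi / 2) (hβ : 0 < β) : IsOpen (localBasin d k h R θ β) := by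
  set b : ℂ := Complex.exp (-(2 * (Real.pi : ℂ) * Complex.I * (h : ℂ) / (k : ℂ)))
  have hprod : Continuous fun z : Fin d → ℂ => ∏ i, z i := by fun_prop
  have hsector : sector k h R θ = {u : ℂ | ‖u ^ k - ((1 / (2 * R) : ℝ) : ℂ)‖ < 1 / (2 * R) ∧
      0 < (u * b).re ∧ |(u * b).im| < Real.tan θ * (u * b).re} := by
    ext u
    simp only [sector, Set.mem_ofPred_eq]
    refine and_congr_right fun hu => ?_
    have hu0 : u * b ≠ 0 := by
      refine mul_ne_zero (fun h0 => ?_) (Complex.exp_ne_zero _)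
      rw [h0, zero_pow hk.ne', zero_sub, norm_neg, Complex.norm_real, Real.norm_of_nonneg
        (by positivity)] at hu
      exact lt_irrefl _ hu
    constructor
    · intro harg
      have hre : 0 < (u * b).re :=
        (Complex.abs_arg_lt_pi_div_two_iff.mp (harg.trans hθ2)).resolve_right hu0
      exact ⟨hre, (abs_arg_lt_iff_abs_im_lt hre hθ2 hθ).mp harg⟩
    · rintro ⟨hre, him⟩
      exact (abs_arg_lt_iff_abs_im_lt hre hθ2 hθ).mpr him
  have hopen : IsOpen (sector k h R θ) := by
    rw [hsector]
    have h1 : IsOpen {u : ℂ | ‖u ^ k - ((1 / (2 * R) : ℝ) : ℂ)‖ < 1 / (2 * R)} :=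
      isOpen_lt (by fun_prop) (by fun_prop)
    have h2 : IsOpen {u : ℂ | 0 < (u * b).re} := isOpen_lt (by fun_prop) (by fun_prop)
    have h3 : IsOpen {u : ℂ | |(u * b).im| < Real.tan θ * (u * b).re} :=
      isOpen_lt (by fun_prop) (by fun_prop)
    exact h1.inter (h2.inter h3)
  refine IsOpen.inter ?_ (hopen.preimage hprod)
  have : {z : Fin d → ℂ | ∀ j, ‖z j‖ < ‖∏ i, z i‖ ^ β} =
      ⋂ j, {z : Fin d → ℂ | ‖z j‖ < ‖∏ i, z i‖ ^ β} := by ext; simp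
  change IsOpen {z : Fin d → ℂ | ∀ j, ‖z j‖ < ‖∏ i, z i‖ ^ β}
  rw [this]
  exact isOpen_iInter_of_finite fun j => isOpen_lt (by fun_prop)
    (hprod.norm.rpow_const fun _ => Or.inr hβ.le)

/-- The resonance relation with `q = 1`. -/
theorem prod_eq_one_of_isOneResonant [NeZero d] (hlam : ∀ j, ‖lam j‖ = 1)
    (hres : IsOneResonant lam (fun _ => 1)) : ∏ j, lam j = 1 := by
  have hl : lam 0 ≠ 0 := fun h => by simpa [h] using hlam 0
  have h1 := (hres 0 ((1 : ℕ) • (fun _ => 1) + Pi.single 0 1)).mpr ⟨1, rfl⟩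
  simp only [one_smul, Pi.add_apply, pow_add, pow_one, Finset.prod_mul_distrib] at h1
  have h2 : ∏ i, lam i ^ (Pi.single (0 : Fin d) 1 : Fin d → ℕ) i = lam 0 := by
    rw [Finset.prod_eq_single (0 : Fin d)]
    · simp
    · intro i _ hi; simp [hi]
    · simp
  rw [h2] at h1
  exact (mul_right_cancel₀ hl (by rw [← h1, one_mul])).symm

theorem image_globalBasin_eq {B : Set (Fin d → ℂ)} (hF : Function.Surjective F)
    (hB : Set.MapsTo F B B) : F '' globalBasin F B = globalBasin F B := by
  have hiff : ∀ z, F z ∈ globalBasin F B ↔ z ∈ globalBasin F B := by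
    intro z
    simp only [mem_globalBasin]
    constructor
    · rintro ⟨n, hn⟩
      exact ⟨n + 1, by rwa [Function.iterate_succ_apply]⟩
    · rintro ⟨n, hn⟩
      refine ⟨n, ?_⟩
      rw [← Function.iterate_succ_apply, Function.iterate_succ_apply']
      exact hB hn
  ext z
  constructor
  · rintro ⟨y, hy, rfl⟩
    exact (hiff y).mpr hy
  · intro hz
    obtain ⟨y, rfl⟩ := hF z
    exact ⟨y, (hiff y).mp hz, rfl⟩

variable {R κ δ K a : ℝ} {c ω : ℂ}

/-- Uniform convergence of the iterates to the origin forces `|U_n| → ∞` uniformly, so a uniform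
local basin enters any smaller basin after a bounded time. -/
theorem exists_mapsTo_iterate_chartDomain [NeZero d] (hk : 0 < k) (hR : 0 < R) (hκ : 0 < κ)
    (hB : IsUniformLocalBasin F (chartDomain d k R κ δ ω)) (R₁ : ℝ) :
    ∃ N, Set.MapsTo F^[N] (chartDomain d k R κ δ ω) (chartDomain d k R₁ κ δ ω) := by
  set M : ℝ := (1 + κ) * |R₁| + 1 with hM
  have hM1 : 1 ≤ M := by
    have : 0 ≤ (1 + κ) * |R₁| := by positivity
    linarith
  obtain ⟨N, hN⟩ := (Metric.tendstoUniformlyOn_iff.mp hB.2 (1 / M) (by positivity)).exists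
  refine ⟨N, fun z hz => ⟨?_, (hB.1.iterate N hz).2⟩⟩
  have hmem := hB.1.iterate N hz
  have hsmall := hN z hz
  rw [dist_zero_left] at hsmall
  have hn : 0 < ‖bigU k (F^[N] z)‖ := norm_pos_iff.mpr (bigU_ne_zero_of_mem hR.le hmem)
  have hprod : ‖∏ i, (F^[N] z) i‖ ≤ 1 / M := by
    have hle1 : 1 / M ≤ 1 := by rw [div_le_one (by linarith)]; exact hM1
    rw [norm_prod]
    calc ∏ i, ‖(F^[N] z) i‖ ≤ ∏ _i : Fin d, 1 / M :=
          Finset.prod_le_prod (fun _ _ => norm_nonneg _)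
            fun i _ => (norm_le_pi_norm _ i).trans hsmall.le
      _ = (1 / M) ^ d := by simp
      _ ≤ 1 / M := pow_le_of_le_one (by positivity) hle1 (NeZero.ne d)
  have hpow : ‖∏ i, (F^[N] z) i‖ ^ k ≤ 1 / M := by
    have hle1 : 1 / M ≤ 1 := by rw [div_le_one (by linarith)]; exact hM1
    exact (pow_le_of_le_one (norm_nonneg _) (hprod.trans hle1) hk.ne').trans hprod
  have hbig : M ≤ ‖bigU k (F^[N] z)‖ := by
    rw [norm_bigU] at hn ⊢
    rw [le_inv_comm₀ (by linarith) (inv_pos.mp hn), ← one_div]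
    exact hpow
  have h1 := hbig.trans (norm_bigU_le_of_mem hR.le hmem)
  have h2 : (1 + κ) * |R₁| < (1 + κ) * (bigU k (F^[N] z)).re := by linarith
  exact (le_abs_self R₁).trans_lt (lt_of_mul_lt_mul_left h2 (by linarith))

theorem isUniformLocalBasin_of_isFatouDomain
    (hD : IsFatouDomain k lam F c (chartDomain d k R κ δ ω) K a) (hR : 0 ≤ R)
    (hδ : δ < 1 / ((k : ℝ) * d)) : IsUniformLocalBasin F (chartDomain d k R κ δ ω) := by
  refine ⟨hD.mapsTo, ?_⟩
  rw [Metric.tendstoUniformlyOn_iff]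
  intro ε hε
  have h1 : Tendsto (fun x : ℝ => x ^ (δ - 1 / ((k : ℝ) * d))) atTop (𝓝 0) := by
    simpa using tendsto_rpow_neg_atTop (y := 1 / ((k : ℝ) * d) - δ) (by linarith)
  obtain ⟨M, hM⟩ := eventually_atTop.mp (h1.eventually (gt_mem_nhds hε))
  filter_upwards [hD.eventually_lt_re (N := 0) (Set.mapsTo_id _) M] with n hn z hz
  rw [dist_zero_left]
  have hmem := hD.mapsTo.iterate n hz
  refine (pi_norm_lt_iff hε).mpr fun j => (norm_apply_lt_of_mem hR hmem j).trans ?_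
  exact hM _ ((hn z hz).le.trans (Complex.re_le_norm _))

/-- On the part of a Fatou domain with `Re U` large, `ψ` is dominated by `U`. -/
theorem exists_forall_psi_re_pos {R₁ : ℝ} (hκ : 0 < κ)
    (hD : ∀ R, R₁ ≤ R → IsFatouDomain k lam F c (chartDomain d k R κ δ ω) K a) :
    ∃ R₂, R₁ ≤ R₂ ∧ ∀ R, R₂ ≤ R → ∀ z ∈ chartDomain d k R κ δ ω, 0 < (psi k c F z).re := by
  have h1 : Tendsto (fun U : ℂ => c * (Complex.log U / U)) (comap norm atTop) (𝓝 0) := by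
    have := (tendsto_log_div_of_tendsto_norm_atTop (U := fun U : ℂ => U)
      (l := comap norm atTop) tendsto_comap).const_mul c
    rwa [mul_zero] at this
  have h2 := h1.eventually (Metric.ball_mem_nhds 0 (by positivity : 0 < 1 / (2 * (1 + κ))))
  obtain ⟨M, hM⟩ := eventually_atTop.mp (eventually_comap.mp h2)
  refine ⟨max R₁ (max M (max (2 * K) 0)), le_max_left _ _, fun R hR z hz => ?_⟩
  have hR1 : R₁ ≤ R := (le_max_left _ _).trans hR
  have hRM : M ≤ R := ((le_max_left _ _).trans (le_max_right _ _)).trans hR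
  have hR2 : max (2 * K) 0 ≤ R := ((le_max_right _ _).trans (le_max_right _ _)).trans hR
  have hRK : 2 * K ≤ R := (le_max_left _ _).trans hR2
  have hR0 : 0 ≤ R := (le_max_right _ _).trans hR2
  have hD := hD R hR1
  have hU0 := hD.bigU_ne_zero hz
  have hn : 0 < ‖bigU k z‖ := norm_pos_iff.mpr hU0
  have h3 := hM ‖bigU k z‖ ((hRM.trans hz.1.le).trans (Complex.re_le_norm _)) _ rfl
  rw [dist_zero_right, ← mul_div_assoc, norm_div,
    div_lt_iff₀ hn] at h3
  have h4 : ‖c * Complex.log (bigU k z)‖ < (bigU k z).re / 2 := by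
    refine h3.trans_le ?_
    rw [one_div, inv_mul_le_iff₀ (by positivity)]
    linarith [norm_bigU_le_of_mem hR0 hz]
  have h5 := (hD.psi_bound z hz 0).trans (hD.mul_rpow_le hz 0)
  simp only [psiSeq, Function.iterate_zero, id, Nat.cast_zero, zero_div, add_zero,
    Real.one_rpow, mul_one, sub_zero] at h5
  have h6 := (abs_le.mp ((Complex.abs_re_le_norm _).trans h5)).2
  have h7 := (abs_le.mp ((Complex.abs_re_le_norm _).trans h4.le)).1
  rw [Complex.sub_re, Complex.add_re] at h6
  linarith [hz.1]

end LocalBasin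

theorem mainTheorem6 (d k : ℕ) [NeZero d] (hk : 0 < k) (lam : Fin d → ℂ)
    (hlam : ∀ j, ‖lam j‖ = 1) (hres : IsOneResonant lam (fun _ => 1)) :
    ∃ c : ℂ, ∀ (F : (Fin d → ℂ) → (Fin d → ℂ)) (l : ℕ), IsHolAut F → 2 * k * d + 1 < l →
      (fun z => F z - normalForm k lam z) =O[𝓝 0] (fun z => ‖z‖ ^ l) →
      ∀ (h : ℕ) (θ₀ β₀ : ℝ), h < k → 0 < θ₀ → θ₀ < Real.pi / (2 * k) →
      0 < β₀ → β₀ < 1 / d → 2 * k + 1 < β₀ * ((l : ℝ) + d - 1) →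
      -- for all large radii the setting is as required
      (∃ R₁ : ℝ, 0 < R₁ ∧ ∀ R₀ : ℝ, R₁ ≤ R₀ →
        IsUniformLocalBasin F (localBasin d k h R₀ θ₀ β₀) ∧
        ∀ z ∈ localBasin d k h R₀ θ₀ β₀, 0 < (psi k c F z).re) ∧
      ∀ (R₀ : ℝ) (B Ω : Set (Fin d → ℂ)), 0 < R₀ → B = localBasin d k h R₀ θ₀ β₀ →
        Ω = globalBasin F B → IsUniformLocalBasin F B →
        F '' Ω = Ω ∧
        ((∀ z ∈ B, 0 < (psi k c F z).re) →
          -- the Fatou coordinate on the local basin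
          TendstoUniformlyOn (psiSeq k c F) (psi k c F) atTop B ∧
          DifferentiableOn ℂ (psi k c F) B ∧
          (∀ z ∈ B, psi k c F (F z) = psi k c F z + 1) ∧
          -- the coordinates `σ_j` and `τ_j` on the local basin
          (∀ j, j ≠ 0 →
            TendstoLocallyUniformlyOn (sigmaSeq k c lam F j) (sigma k c lam F j) atTop B ∧
            DifferentiableOn ℂ (sigma k c lam F j) B ∧
            (∀ z ∈ B, sigma k c lam F j z ≠ 0) ∧
            (∀ z ∈ B, sigma k c lam F j (F z) = lam j * sigma k c lam F j z *
              root (k * d) (psi k c F z / (psi k c F z + 1))) ∧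
            DifferentiableOn ℂ (tau k c lam F j) B ∧
            (∀ z ∈ B, tau k c lam F j z ≠ 0) ∧
            (∀ z ∈ B, tau k c lam F j (F z) = lam j * tau k c lam F j z)) ∧
          -- their extension to the global basin
          ∃ Φ : (Fin d → ℂ) → (Fin d → ℂ),
            (∀ (z : Fin d → ℂ) (n : ℕ), F^[n] z ∈ B →
              Φ z 0 = psi k c F (F^[n] z) - n ∧
              ∀ j, j ≠ 0 → Φ z j = (lam j ^ n)⁻¹ * tau k c lam F j (F^[n] z)) ∧
            IsBiholOn Φ Ω (cylinder d) ∧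
            (∀ z ∈ Ω, Φ (F z) = shiftRot lam (Φ z)) ∧
            ∃ η : (Fin d → ℂ) → (Fin d → ℂ), IsBiholOn η (cylinder d) (cylinder d) ∧
              ∀ z ∈ Ω, η (Φ (F z)) = shift (η (Φ z))) ∧
        -- conjugation of `F` on the global basin to `(ζ,ξ) ↦ (ζ+1,ξ)`
        ∃ φ : (Fin d → ℂ) → (Fin d → ℂ), IsBiholOn φ Ω (cylinder d) ∧
          ∀ z ∈ Ω, φ (F z) = shift (φ z) := by
  refine ⟨-(1 / 2) * (1 + 1 / ((k : ℂ) * d)), ?_⟩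
  generalize hc : (-(1 / 2) * (1 + 1 / ((k : ℂ) * d)) : ℂ) = c
  intro F l hFaut _ hFO h θ₀ β₀ _ hθ hθk hβ hβd hβl
  have hl : ∀ j, lam j ≠ 0 := fun j h0 => by simpa [h0] using hlam j
  have hk' : (0 : ℝ) < k := by exact_mod_cast hk
  have hd' : (0 : ℝ) < d := by exact_mod_cast Nat.pos_of_ne_zero (NeZero.ne d)
  have hkθ : k * θ₀ < Real.pi / 2 := by
    rw [lt_div_iff₀ (by positivity)] at hθk
    linarith
  have hθ2 : θ₀ < Real.pi / 2 := by
    have : (1 : ℝ) ≤ k := by exact_mod_cast hk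
    nlinarith
  have hFd := hFaut.1
  have hFsurj : Function.Surjective F := by
    obtain ⟨-, G, -, -, hG⟩ := hFaut
    exact hG.surjective
  -- the parameters of the local basins in the chart
  set κ : ℝ := Real.tan (k * θ₀) with hκdef
  set δ : ℝ := (1 / d - β₀) / k with hδdef
  set ω : ℂ := Complex.exp (2 * (Real.pi : ℂ) * Complex.I * (h : ℂ) / (k : ℂ)) with hωdef
  have hκ : 0 < κ := Real.tan_pos_of_pos_of_lt_pi_div_two (by positivity) hkθ
  have hδ : 0 < δ := div_pos (by linarith) hk'
  have hδlt : δ < 1 / ((k : ℝ) * d) := by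
    have h1 : 1 / ((k : ℝ) * d) = (1 / d) / k := by field_simp
    rw [h1, hδdef, div_lt_div_iff_of_pos_right hk']
    linarith
  have hω : ω ^ k = 1 := by
    have hkc : (k : ℂ) ≠ 0 := by exact_mod_cast hk.ne'
    have h1 : (k : ℂ) * (2 * (Real.pi : ℂ) * Complex.I * (h : ℂ) / (k : ℂ)) =
        (h : ℤ) * (2 * Real.pi * Complex.I) := by push_cast; field_simp
    rw [hωdef, ← Complex.exp_nat_mul, h1, Complex.exp_int_mul_two_pi_mul_I]
  have hωn : ‖ω‖ = 1 := Complex.norm_eq_one_of_pow_eq_one hω hk.ne'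
  have hT : IsTangentToNormalForm k lam F l β₀ κ ω :=
    ⟨hk, hlam, prod_eq_one_of_isOneResonant hlam hres, hFO, hβ, hβd, hβl, hκ, hωn⟩
  have hchart : ∀ R, 0 < R → localBasin d k h R θ₀ β₀ = chartDomain d k R κ δ ω := fun R hR =>
    localBasin_eq_chartDomain hk h hR hθ hθk
  obtain ⟨K, a, R₁, hR₁, hD⟩ := hT.exists_isFatouDomain
    (fun R hR => by rw [← hchart R hR]; exact isOpen_localBasin hk hR hθ hθ2 hβ) hc.symm
  obtain ⟨R₂, hR₂, hψpos⟩ := exists_forall_psi_re_pos hκ hD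
  refine ⟨⟨R₂, by linarith, fun R₀ hR₀ => ?_⟩, ?_⟩
  · rw [hchart R₀ (by linarith)]
    exact ⟨isUniformLocalBasin_of_isFatouDomain (hD R₀ (hR₂.trans hR₀)) (by linarith) hδlt,
      hψpos R₀ hR₀⟩
  intro R₀ B Ω hR₀ hBdef hΩdef hB
  rw [hchart R₀ hR₀] at hBdef
  -- a smaller basin on which the estimates hold, with the same global basin
  obtain ⟨R, hRR₁, hRR₀⟩ : ∃ R, R₁ ≤ R ∧ R₀ ≤ R := ⟨max R₁ R₀, le_max_left _ _, le_max_right _ _⟩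
  have hD := hD R hRR₁
  obtain ⟨N, hN⟩ : ∃ N, Set.MapsTo F^[N] B (chartDomain d k R κ δ ω) := by
    subst hBdef
    exact exists_mapsTo_iterate_chartDomain hk hR₀ hκ hB R
  have hΩ : Ω = globalBasin F (chartDomain d k R κ δ ω) := by
    ext z
    rw [hΩdef, mem_globalBasin, mem_globalBasin]
    constructor
    · rintro ⟨n, hn⟩
      exact ⟨N + n, by rw [Function.iterate_add_apply]; exact hN hn⟩
    · rintro ⟨n, hn⟩
      refine ⟨n, ?_⟩
      rw [hBdef]
      exact ⟨hRR₀.trans_lt hn.1, hn.2⟩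
  have hBΩ : B ⊆ globalBasin F (chartDomain d k R κ δ ω) := fun z hz =>
    mem_globalBasin.mpr ⟨N, hN hz⟩
  have hbihol : IsBiholOn (fatouMap k c lam F) Ω (cylinder d) := by
    rw [hΩ]
    exact hD.isBiholOn_fatouMap hk hlam hω hκ hδ hFaut
  have hconj : ∀ z ∈ Ω, fatouMap k c lam F (F z) = shiftRot lam (fatouMap k c lam F z) := by
    intro z hz
    rw [hΩ] at hz
    ext j
    by_cases hj : j = 0
    · subst hj
      simpa [fatouMap, shiftRot] using hD.psi_map hz
    · simpa [fatouMap, shiftRot, hj] using hD.tauLim_map hz (hl j)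
  have hshift : ∀ z ∈ Ω, unrotate lam (fatouMap k c lam F (F z)) =
      shift (unrotate lam (fatouMap k c lam F z)) := fun z hz => by
    rw [hconj z hz, unrotate_shiftRot hl]
  have hUpos : ∀ z ∈ B, ∀ n, 0 < (bigU k (F^[n] z)).re := fun z hz n => by
    have := hB.1.iterate n hz
    rw [hBdef] at this
    exact bigU_re_pos_of_mem hR₀.le this
  refine ⟨?_, fun hψ => ⟨hD.tendstoUniformlyOn_psi hN, (hD.differentiableOn_psi hFd).mono hBΩ,
    fun z hz => hD.psi_map (hBΩ hz), fun j hj => ?_, fatouMap k c lam F, fun z n hz => ⟨?_, ?_⟩,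
    hbihol, hconj, unrotate lam, isBiholOn_unrotate, hshift⟩, ?_⟩
  · rw [hΩdef]
    exact image_globalBasin_eq hFsurj hB.1
  · have hψ0 : ∀ z ∈ B, psi k c F z ≠ 0 := fun z hz h0 => by simpa [h0] using hψ z hz
    have hσ : ∀ z ∈ B, sigma k c lam F j z = tauLim k lam F j z / root (k * d) (psi k c F z) :=
      fun z hz => hD.sigma_eq hk hFd (hl j) hN hUpos hψ hz
    have hτ : ∀ z ∈ B, tau k c lam F j z = tauLim k lam F j z :=
      fun z hz => hD.tau_eq hk hFd (hl j) hN hUpos hψ hz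
    have hτd : DifferentiableOn ℂ (tauLim k lam F j) B :=
      (hD.differentiableOn_tauLim hk hFd (hl j)).mono hBΩ
    have hτ0 : ∀ z ∈ B, tauLim k lam F j z ≠ 0 := fun z hz =>
      hD.tauLim_ne_zero hk (hBΩ hz) (hl j)
    have hψd := (hD.differentiableOn_psi hFd).mono hBΩ
    refine ⟨(hD.tendstoLocallyUniformlyOn_sigmaSeq hk hFd (hl j) hN hUpos hψ).congr_right
      fun z hz => (hσ z hz).symm, ?_, fun z hz => ?_, fun z hz => ?_, hτd.congr hτ,
      fun z hz => by rw [hτ z hz]; exact hτ0 z hz, fun z hz => ?_⟩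
    · refine DifferentiableOn.congr ?_ hσ
      simp only [div_eq_mul_inv]
      refine hτd.mul (DifferentiableOn.inv (fun z hz => ?_) fun z hz => root_ne_zero (hψ0 z hz))
      exact (differentiableAt_root (hψ z hz)).comp_differentiableWithinAt z (hψd z hz)
    · rw [hσ z hz]
      exact div_ne_zero (hτ0 z hz) (root_ne_zero (hψ0 z hz))
    · have hpos1 : 0 < (psi k c F z + 1).re := by
        rw [Complex.add_re, Complex.one_re]; linarith [hψ z hz]
      have h1 : root (k * d) (psi k c F z) ≠ 0 := root_ne_zero (hψ0 z hz)
      have h2 : root (k * d) (psi k c F z + 1) ≠ 0 :=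
        root_ne_zero fun h0 => by simp [h0] at hpos1
      rw [hσ _ (hB.1 hz), hσ z hz, hD.psi_map (hBΩ hz), hD.tauLim_map (hBΩ hz) (hl j),
        root_div (hψ z hz) hpos1]
      field_simp
    · rw [hτ _ (hB.1 hz), hτ z hz, hD.tauLim_map (hBΩ hz) (hl j)]
  · have hmem : F^[N + n] z ∈ chartDomain d k R κ δ ω := by
      rw [Function.iterate_add_apply]; exact hN hz
    simp only [fatouMap, if_true]
    rw [hD.psi_eq_of_iterate_mem hmem, hD.psi_eq_of_iterate_mem (hN hz),
      ← Function.iterate_add_apply]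
    push_cast
    ring
  · intro j hj
    have hmem : F^[N + n] z ∈ chartDomain d k R κ δ ω := by
      rw [Function.iterate_add_apply]; exact hN hz
    simp only [fatouMap, hj, if_false]
    rw [hD.tau_eq hk hFd (hl j) hN hUpos hψ hz, hD.tauLim_eq_of_iterate_mem hmem,
      hD.tauLim_eq_of_iterate_mem (hN hz), ← Function.iterate_add_apply, pow_add, mul_inv]
    ring
  · exact ⟨_, hbihol.comp isBiholOn_unrotate, hshift⟩
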